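/- Notation. For an integer $r$ put $\binom r2=r(r-1)/2$. For $0<|q|<1$ and $x\ne0$ let $(x;q)_\infty=\prod_{i\ge0}(1-q^ix)$ and $j(x;q)=(x;q)_\infty(q/x;q)_\infty(q;q)_\infty$. For nonzero $x,q,z$ with $|q|<1$ such that neither $z$ nor $xz$ is an integral power of $q$, let $$m(x,q,z)=\frac1{j(z;q)}\sum_{r\in\mathbb Z}\frac{(-1)^rq^{\binom r2}z^r}{1-q^{r-1}xz}.$$ A *theta quotient* in $q,z_0,z_1$ is an expression $$c\,q^{e}z_0^{f}z_1^{g}\,\frac{\prod_{i=1}^{s}j(\omega_iq^{\alpha_i}z_0^{\beta_i}z_1^{\gamma_i};\varepsilon_iq^{k_i})}{\prod_{i=s+1}^{s+t}j(\omega_iq^{\alpha_i}z_0^{\beta_i}z_1^{\gamma_i};\varepsilon_iq^{k_i})}$$ with $c\in\mathbb C$, integers $e,f,g,\alpha_i,\beta_i,\gamma_i$, roots of unity $\omega_i$, signs $\varepsilon_i=\pm1$ and integers $k_i\ge1$, all independent of $q,z_0,z_1$. Its weight is $(s-t)/2$. A *theta function* is a finite sum of theta quotients. For a partition $\lambda$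 with largest part $\ell(\lambda)$ and $\nu(\lambda)$ parts, the $M_2$-rank is $\lceil \ell(\lambda)/2\rceil-\nu(\lambda)$ (so the empty partition has $M_2$-rank $0$). Let $p_o(n)$ be the number of partitions of $n$ in which no odd part is repeated, and $N_2(a,M;n)$ the number of those whose $M_2$-rank is congruent to $a$ modulo $M$. **Theorem.** Let $a,M$ be integers with $0\le a<M$. There is a theta function $T_{a,M}(q)=T_{a,M}(q;z_0,z_1)$ with the following properties. If $a\neq0$, all its summands are theta quotients of weight $1/2$; if $a=0$, it is the constant $1$ plus a finite sum of theta quotients of weight $1/2$. For every complex $q$ with $0<|q|<1$ and all $z_0,z_1\in\mathbb C$ for which the two Appell–Lerch sums below are defined, no denominator in $T_{a,M}(q)$ vanishes, the series $D_2(a,M,q)=\sum_{n\ge0}\bigl(N_2(a,M;n)-\frac{p_o(n)}M\bigr)q^n$ converges absolutely, and $$D_2(a,M,q)=(-q)^{-\binom{a+1}2}m\bigl(-(-q)^{\binom M2-Ma},(-q)^{M^2},z_0\bigr)-(-q)^{-\binom a2}m\bigl(-(-q)^{\binom M2-M(a-1)},(-q)^{M^2},z_1\bigr)+T_{a,M}(q).$$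 -/

import Mathlib

/-! ### The theta function `j` and the Appell–Lerch sum `m` -/

/-- The binomial coefficient `r (r - 1) / 2` for an arbitrary integer `r` (the division is exact). -/
def binomTwo (r : ℤ) : ℤ := r * (r - 1) / 2

/-- `(x; q)_∞ = ∏_{i ≥ 0} (1 - q ^ i x)`, convergent for `|q| < 1`. -/
noncomputable def qPochInf (x q : ℂ) : ℂ := ∏' i : ℕ, (1 - q ^ i * x)

/-- `j(x; q) = (x; q)_∞ (q / x; q)_∞ (q; q)_∞`, for `x ≠ 0` and `0 < |q| < 1`. -/
noncomputable def jTheta (x q : ℂ) : ℂ := qPochInf x q * qPochInf (q / x) q * qPochInf q q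

/-- The conditions under which `m(x, q, z)` is defined: `x`, `q`, `z` are nonzero, `|q| < 1`, and
neither `z` nor `x z` is an integral power of `q`. -/
def AppellLerchAdmissible (x q z : ℂ) : Prop :=
  x ≠ 0 ∧ q ≠ 0 ∧ ‖q‖ < 1 ∧ z ≠ 0 ∧ (∀ k : ℤ, z ≠ q ^ k) ∧ ∀ k : ℤ, x * z ≠ q ^ k

/-- The Appell–Lerch sum
`m(x, q, z) = j(z; q)⁻¹ ∑_{r ∈ ℤ} (-1) ^ r q ^ (r (r - 1) / 2) z ^ r / (1 - q ^ (r - 1) x z)`;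
the series converges absolutely for admissible `x`, `q`, `z`. -/
noncomputable def appellLerch (x q z : ℂ) : ℂ :=
  (1 / jTheta z q) *
    ∑' r : ℤ, (-1) ^ r * q ^ binomTwo r * z ^ r / (1 - q ^ (r - 1) * x * z)

/-! ### Partitions without repeated odd parts and the `M₂`-rank -/

/-- No odd number occurs more than once as a part. -/
def NoRepeatedOddParts {n : ℕ} (p : n.Partition) : Prop :=
  ∀ i ∈ p.parts, Odd i → p.parts.count i ≤ 1

instance {n : ℕ} (p : n.Partition) : Decidable (NoRepeatedOddParts p) := by
  unfold NoRepeatedOddParts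
  infer_instance

/-- The `M₂`-rank `⌈ℓ / 2⌉ - ν`, where `ℓ` is the largest part (`0` for the empty partition) and
`ν` the number of parts. The empty partition has `M₂`-rank `0`. -/
def mTwoRank {n : ℕ} (p : n.Partition) : ℤ :=
  ⌈(p.parts.sup : ℚ) / 2⌉ - (p.parts.card : ℤ)

/-- `N₂(a, M; n)`: the number of partitions of `n` without repeated odd parts whose `M₂`-rank is
congruent to `a` modulo `M`. -/
def countNTwo (a M n : ℕ) : ℕ :=
  (Finset.univ.filter fun p : n.Partition =>
    NoRepeatedOddParts p ∧ mTwoRank p ≡ (a : ℤ) [ZMOD (M : ℤ)]).card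

/-- `p_o(n)`: the number of partitions of `n` without repeated odd parts. -/
def countPo (n : ℕ) : ℕ :=
  (Finset.univ.filter fun p : n.Partition => NoRepeatedOddParts p).card

/-- The coefficient of `q ^ n` in the `M₂`-rank deviation `D₂(a, M, q)`. -/
noncomputable def deviationCoeff (a M n : ℕ) : ℂ :=
  (countNTwo a M n : ℂ) - (countPo n : ℂ) / (M : ℂ)

/-! ### Theta functions: finite sums of quotients of products of `j`'s

The data below are independent of `q`, `z₀`, `z₁`. -/

/-- The data of one factor `j(ω q ^ α z₀ ^ β z₁ ^ γ; ε q ^ k)`, where `ω` is a root of unity,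
`α`, `β`, `γ` are integers, `ε = ± 1`, and `k` is a positive integer. -/
structure ThetaFactor where
  root : ℂ
  root_spec : ∃ n : ℕ, 0 < n ∧ root ^ n = 1
  qExp : ℤ
  z₀Exp : ℤ
  z₁Exp : ℤ
  sign : ℤˣ
  level : ℕ
  level_pos : 0 < level

/-- The value `j(ω q ^ α z₀ ^ β z₁ ^ γ; ε q ^ k)`. -/
noncomputable def ThetaFactor.eval (f : ThetaFactor) (q z₀ z₁ : ℂ) : ℂ :=
  jTheta (f.root * q ^ f.qExp * z₀ ^ f.z₀Exp * z₁ ^ f.z₁Exp) (((f.sign : ℤ) : ℂ) * q ^ f.level)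

/-- The data of a theta quotient: a constant times a monomial in `q`, `z₀`, `z₁`, times a product
of factors `j`, divided by a product of factors `j`. -/
structure ThetaQuotient where
  coeff : ℂ
  qExp : ℤ
  z₀Exp : ℤ
  z₁Exp : ℤ
  num : List ThetaFactor
  den : List ThetaFactor

/-- The value of a theta quotient. -/
noncomputable def ThetaQuotient.eval (t : ThetaQuotient) (q z₀ z₁ : ℂ) : ℂ :=
  t.coeff * q ^ t.qExp * z₀ ^ t.z₀Exp * z₁ ^ t.z₁Exp *
    (t.num.map fun f => f.eval q z₀ z₁).prod / (t.den.map fun f => f.eval q z₀ z₁).prod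

/-- No factor of the denominator vanishes, so that the quotient is genuinely defined. -/
def ThetaQuotient.Regular (t : ThetaQuotient) (q z₀ z₁ : ℂ) : Prop :=
  ∀ f ∈ t.den, f.eval q z₀ z₁ ≠ 0

/-- Each `j` has weight `1 / 2`. -/
def ThetaQuotient.weight (t : ThetaQuotient) : ℚ :=
  ((t.num.length : ℚ) - (t.den.length : ℚ)) / 2

/-- The constant theta quotient `1`. -/
noncomputable def ThetaQuotient.one : ThetaQuotient := ⟨1, 0, 0, 0, [], []⟩

/-- The value of a finite sum of theta quotients. -/
noncomputable def thetaSumEval (T : List ThetaQuotient) (q z₀ z₁ : ℂ) : ℂ :=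
  (T.map fun t => t.eval q z₀ z₁).sum

/-!
# The `M₂`-rank deviations of partitions without repeated odd parts

Write `p = -q` and `m(x, p, z) = L(x z, z) / j(z; p)`, where `L(a, w)` is the numerator series
`lerchSeries a w p`, which makes sense for all `w`.

**Appell–Lerch sums.** The combination `L(b, b t) j(a t) - L(a, a t) j(b t)` has, as a function of
`t`, Laurent coefficients satisfying a two-term recurrence (`exists_lerch_antisymm`); hence it is a
multiple of a single theta series, and the factor follows from the expansion of `1 / j(a; p)`
(`lerchSeries_one_mul_jTheta`). So `m(x, p, z)` and `m(x, p, z')` differ by one theta quotient of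
weight `1/2` (`lerchSeries_change`). Splitting the summation index and a finite geometric sum modulo
`M` expresses `L` in base `p` through series in base `p ^ (M ^ 2)` (`lerchSeries_dissect`), and the
corresponding theta factors recombine to a theta function in base `p` (`sum_jTheta_dissectArg`).

**The rank.** Let `P(q)` be the generating function of the partitions without repeated odd parts and
`R_m(q)` that of the nonempty ones with `M₂`-rank at least `m`. Counting partitions in a box by two
conjugate recurrences gives `R_m = q ^ (2 m + 1) (P - R_{m + 2})` (`rankGE_rec`), which determines
`R_m / P` as a partial theta series (`rankGE_eq`). Conjugation symmetry and summation over all ranks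
yield, for `|ζ| = 1` and `ζ ≠ 1`,
`∑ ζ ^ rank q ^ n = (1 - ζ) (L(ζ, -1) - L(ζ, 1)) / j(-1; p)` (`rankGF_mul_jTheta`).

**The theorem.** Let `ζ ^ M = 1`. The series `L(ζ, 1)` is a theta quotient. Changing the third
argument turns `L(ζ, -1) / j(-1; p)` into `m(-ζ, p, -η)` with a root of unity `η` such that `η ^ M` is
a primitive cube root of unity, so that no singularity occurs. Dissection and another change of the
third argument, to `i`, express this as `∑ s, ζ ^ s p ^ (-(s + 1) s / 2) m(x_s, p ^ (M ^ 2), i)`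
modulo theta functions, where `x_s` does not depend on `ζ` (`isThetaSum_rankGF`). Averaging over the
`M`-th roots of unity selects the terms `s = a` and `s = a - 1`. For `a = 0` the latter is the term
`s = M - 1`; the functional equation `m(Q x, Q, z) = 1 - x m(x, Q, z)` moves it to `s = -1` and
produces the constant `1`. Finally `i` is replaced by `z₀` and `z₁`.

That all error terms are theta quotients of weight `1/2` in `q`, `z₀`, `z₁` is recorded by the
predicates `ThetaDomain.IsThetaQuotient` and `ThetaDomain.IsThetaSum`, which are closed under the
operations used.
-/

open Filter Topology

/-! ### The exponents `r (r - 1) / 2` -/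

theorem two_mul_binomTwo (r : ℤ) : 2 * binomTwo r = r * (r - 1) := by
  unfold binomTwo
  have h : (2 : ℤ) ∣ r * (r - 1) := by
    have := Int.even_mul_pred_self r
    exact this.two_dvd
  omega

theorem binomTwo_eq_of_two_mul {r k : ℤ} (h : 2 * k = r * (r - 1)) : binomTwo r = k := by
  have := two_mul_binomTwo r
  omega

theorem binomTwo_add (r s : ℤ) : binomTwo (r + s) = binomTwo r + binomTwo s + r * s := by
  apply binomTwo_eq_of_two_mul
  linear_combination two_mul_binomTwo r + two_mul_binomTwo s

@[simp] theorem binomTwo_zero : binomTwo 0 = 0 := by decide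

@[simp] theorem binomTwo_one : binomTwo 1 = 0 := by decide

theorem binomTwo_add_one (r : ℤ) : binomTwo (r + 1) = binomTwo r + r := by
  simp [binomTwo_add]

theorem binomTwo_neg (r : ℤ) : binomTwo (-r) = binomTwo r + r := by
  apply binomTwo_eq_of_two_mul
  linear_combination two_mul_binomTwo r

theorem binomTwo_natCast (n : ℕ) : binomTwo n = (n.choose 2 : ℕ) := by
  induction n with
  | zero => simp
  | succ n ih =>
    push_cast [Nat.choose_succ_succ' n 1, Nat.choose_one_right]
    rw [binomTwo_add_one, ih]
    ring

/-! ### Theta series -/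

/-- The theta series `∑ (-1) ^ n q ^ (n (n - 1) / 2) x ^ n` over all integers `n`. -/
noncomputable def thetaSeries (x q : ℂ) : ℂ := ∑' n : ℤ, (-1) ^ n * q ^ binomTwo n * x ^ n

theorem summable_pow_choose_mul_pow {q : ℂ} (hq : ‖q‖ < 1) (x : ℂ) :
    Summable fun n : ℕ => ‖q ^ n.choose 2 * x ^ n‖ := by
  rcases eq_or_ne q 0 with rfl | hq0
  · refine summable_of_ne_finset_zero (s := Finset.range 2) fun n hn => ?_
    have : n.choose 2 ≠ 0 := (Nat.choose_pos (not_lt.1 (mt Finset.mem_range.2 hn))).ne'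
    simp [this]
  rcases eq_or_ne x 0 with rfl | hx
  · refine summable_of_ne_finset_zero (s := Finset.range 1) fun n hn => ?_
    have : n ≠ 0 := by simpa using hn
    simp [this]
  refine summable_of_ratio_test_tendsto_lt_one (l := 0) one_pos
    (Eventually.of_forall fun n => by simp [hq0, hx]) ?_
  have h : Tendsto (fun n : ℕ => ‖q‖ ^ n * ‖x‖) atTop (𝓝 (0 * ‖x‖)) :=
    (tendsto_pow_atTop_nhds_zero_of_lt_one (norm_nonneg _) hq).mul_const _
  rw [zero_mul] at h
  refine h.congr fun n => ?_
  have h1 : ‖q‖ ^ n.choose 2 ≠ 0 := by positivity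
  have h2 : ‖x‖ ^ n ≠ 0 := by positivity
  simp only [norm_norm, norm_mul, norm_pow]
  rw [Nat.choose_succ_succ' n 1, Nat.choose_one_right, pow_add, pow_succ]
  field_simp

theorem summable_norm_theta {q : ℂ} (hq0 : q ≠ 0) (hq : ‖q‖ < 1) (x : ℂ) :
    Summable fun n : ℤ => ‖(-1 : ℂ) ^ n * q ^ binomTwo n * x ^ n‖ := by
  refine Summable.of_nat_of_neg ?_ ?_
  · refine (summable_pow_choose_mul_pow hq x).congr fun n => ?_
    rw [binomTwo_natCast]
    simp
  · refine (summable_pow_choose_mul_pow hq (q / x)).congr fun n => ?_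
    rw [binomTwo_neg, binomTwo_natCast, zpow_add₀ hq0]
    simp only [norm_mul, norm_neg, norm_one, norm_pow, norm_div, zpow_neg,
      zpow_natCast, norm_inv, div_pow]
    ring

/-! ### The Jacobi triple product -/

/-- The Gaussian binomial coefficient `[m, k]_q`, by its Pascal rule. -/
noncomputable def gaussBinom (q : ℂ) : ℕ → ℕ → ℂ
  | _, 0 => 1
  | 0, _ + 1 => 0
  | m + 1, k + 1 => q ^ (k + 1) * gaussBinom q m (k + 1) + gaussBinom q m k

theorem gaussBinom_zero (q : ℂ) (m : ℕ) : gaussBinom q m 0 = 1 := by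
  cases m <;> simp [gaussBinom]

theorem gaussBinom_eq_zero (q : ℂ) {m k : ℕ} (h : m < k) : gaussBinom q m k = 0 := by
  induction m generalizing k with
  | zero =>
    obtain ⟨k, rfl⟩ := Nat.exists_eq_succ_of_ne_zero h.ne'
    rfl
  | succ m ih =>
    obtain ⟨k, rfl⟩ := Nat.exists_eq_succ_of_ne_zero (Nat.ne_zero_of_lt h)
    simp [gaussBinom, ih (show m < k by omega), ih (show m < k + 1 by omega)]

/-- The finite product `(q; q)_n`. -/
noncomputable def qFact (q : ℂ) (n : ℕ) : ℂ := ∏ i ∈ Finset.range n, (1 - q ^ i * q)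

theorem qFact_succ (q : ℂ) (n : ℕ) : qFact q (n + 1) = qFact q n * (1 - q ^ (n + 1)) := by
  rw [qFact, Finset.prod_range_succ, ← pow_succ]
  rfl

/-- The product formula `[k + l, k]_q (q; q)_k (q; q)_l = (q; q)_{k + l}`. -/
theorem gaussBinom_mul_qFact (q : ℂ) (k l : ℕ) :
    gaussBinom q (k + l) k * (qFact q k * qFact q l) = qFact q (k + l) := by
  suffices H : ∀ m k l : ℕ, k + l = m →
      gaussBinom q (k + l) k * (qFact q k * qFact q l) = qFact q (k + l) from H _ k l rfl
  intro m
  induction m with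
  | zero =>
    intro k l h
    obtain ⟨rfl, rfl⟩ : k = 0 ∧ l = 0 := by omega
    simp [gaussBinom, qFact]
  | succ m ih =>
    intro k l h
    rcases k with _ | k
    · simp [gaussBinom_zero, qFact]
    rcases l with _ | l
    · have h1 := ih k 0 (by omega)
      simp only [add_zero] at h1 ⊢
      rw [gaussBinom, gaussBinom_eq_zero q (Nat.lt_succ_self k), qFact_succ]
      linear_combination (1 - q ^ (k + 1)) * h1
    · have h1 := ih (k + 1) l (by omega)
      have h2 := ih k (l + 1) (by omega)
      rw [show k + 1 + (l + 1) = (k + 1 + l) + 1 by ring, gaussBinom, qFact_succ q (k + 1 + l)]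
      rw [show k + (l + 1) = k + 1 + l by ring] at h2
      rw [qFact_succ q l] at h2 ⊢
      rw [qFact_succ q k] at h1 ⊢
      rw [show k + 1 + l + 1 = (k + 1) + (l + 1) by ring, pow_add]
      linear_combination q ^ (k + 1) * (1 - q ^ (l + 1)) * h1 + (1 - q ^ (k + 1)) * h2

/-- The Gaussian binomial theorem. -/
theorem prod_one_add_mul_pow (q y : ℂ) (m : ℕ) :
    ∏ i ∈ Finset.range m, (1 + q ^ i * y)
      = ∑ k ∈ Finset.range (m + 1), gaussBinom q m k * q ^ k.choose 2 * y ^ k := by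
  induction m generalizing y with
  | zero => simp [gaussBinom]
  | succ m ih =>
    rw [Finset.prod_range_succ']
    have h1 : ∏ i ∈ Finset.range m, (1 + q ^ (i + 1) * y)
        = ∏ i ∈ Finset.range m, (1 + q ^ i * (q * y)) :=
      Finset.prod_congr rfl fun i _ => by ring
    have h2 : ∑ k ∈ Finset.range (m + 1), gaussBinom q m k * q ^ k.choose 2 * (q * y) ^ k
        = ∑ k ∈ Finset.range (m + 1),
          gaussBinom q m (k + 1) * q ^ (k + 1).choose 2 * (q * y) ^ (k + 1) + 1 := by
      have := Finset.sum_range_succ' (fun k => gaussBinom q m k * q ^ k.choose 2 * (q * y) ^ k)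
        (m + 1)
      rw [Finset.sum_range_succ, gaussBinom_eq_zero q (Nat.lt_succ_self m)] at this
      simpa [gaussBinom_zero] using this
    rw [h1, ih, Finset.sum_range_succ' _ (m + 1), pow_zero, one_mul, mul_add, mul_one]
    nth_rewrite 1 [h2]
    rw [add_right_comm, Finset.sum_mul, ← Finset.sum_add_distrib]
    simp only [gaussBinom_zero, Nat.choose_zero_succ, pow_zero, mul_one]
    congr 1
    refine Finset.sum_congr rfl fun k _ => ?_
    rw [gaussBinom, Nat.choose_succ_succ' k 1, Nat.choose_one_right]
    ring

/-- The finite form of the triple product: the Gaussian binomial theorem at `y = -x q ^ (-N)` with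
`2 N` factors, of which the first `N` are turned into factors `1 - q ^ i (q / x)`. -/
theorem finite_triple_product {q x : ℂ} (hq0 : q ≠ 0) (hx : x ≠ 0) (N : ℕ) :
    (∏ i ∈ Finset.range N, (1 - q ^ i * x)) * ∏ i ∈ Finset.range N, (1 - q ^ i * (q / x))
      = ∑' n : ℤ, (if 0 ≤ n + N then gaussBinom q (N + N) (n + N).toNat else 0) *
          ((-1) ^ n * q ^ binomTwo n * x ^ n) := by
  have hy := prod_one_add_mul_pow q (-x * q ^ (-N : ℤ)) (N + N)
  rw [Finset.prod_range_add, ← Finset.prod_range_reflect] at hy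
  have e1 : ∏ i ∈ Finset.range N, (1 + q ^ (N - 1 - i) * (-x * q ^ (-N : ℤ)))
      = ((-x) ^ N * q ^ (-binomTwo (N + 1))) *
        ∏ i ∈ Finset.range N, (1 - q ^ i * (q / x)) := by
    have : ((-x) ^ N * q ^ (-binomTwo (N + 1)))
        = ∏ i ∈ Finset.range N, (-x * q ^ (-(i + 1) : ℤ)) := by
      clear hy
      induction N with
      | zero => simp
      | succ N ih =>
        rw [Finset.prod_range_succ, ← ih, pow_succ]
        push_cast
        rw [binomTwo_add_one ((N : ℤ) + 1), neg_add, zpow_add₀ hq0]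
        ring
    rw [this, ← Finset.prod_mul_distrib]
    refine Finset.prod_congr rfl fun i hi => ?_
    have hi := Finset.mem_range.1 hi
    rw [← zpow_natCast, ← zpow_natCast, mul_left_comm, ← zpow_add₀ hq0]
    have h3 : ((N - 1 - i : ℕ) : ℤ) + -N = -(i + 1) := by omega
    rw [h3]
    have h4 : q ^ (-((i : ℤ) + 1)) * (q ^ (i : ℤ) * q) = 1 := by
      rw [← zpow_add_one₀ hq0, ← zpow_add₀ hq0]
      simp
    field_simp
    linear_combination -h4
  have e2 : ∏ i ∈ Finset.range N, (1 + q ^ (N + i) * (-x * q ^ (-N : ℤ)))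
      = ∏ i ∈ Finset.range N, (1 - q ^ i * x) := by
    refine Finset.prod_congr rfl fun i _ => ?_
    rw [zpow_neg, zpow_natCast, pow_add]
    field_simp
    ring
  rw [e1, e2] at hy
  have hc : ((-x) ^ N * q ^ (-binomTwo (N + 1))) ≠ 0 :=
    mul_ne_zero (pow_ne_zero _ (neg_ne_zero.2 hx)) (zpow_ne_zero _ hq0)
  rw [mul_assoc, mul_comm (∏ i ∈ Finset.range N, (1 - q ^ i * (q / x)))] at hy
  apply mul_left_cancel₀ hc
  rw [hy, tsum_eq_sum (s := (Finset.range (N + N + 1)).image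
    fun k : ℕ => (k : ℤ) - N), Finset.sum_image (fun a _ b _ h => by simpa using h),
    Finset.mul_sum]
  · refine Finset.sum_congr rfl fun k _ => ?_
    simp only [sub_add_cancel, Nat.cast_nonneg, if_true,
      Int.toNat_natCast]
    have h1 : q ^ k.choose 2 = q ^ (-binomTwo (N + 1)) * q ^ binomTwo ((k : ℤ) - N)
        * q ^ ((N : ℤ) * k) := by
      rw [← zpow_natCast, ← binomTwo_natCast, ← zpow_add₀ hq0, ← zpow_add₀ hq0]
      congr 1
      have a1 := two_mul_binomTwo ((N : ℤ) + 1)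
      have a2 := two_mul_binomTwo ((k : ℤ) - N)
      have a3 := two_mul_binomTwo (k : ℤ)
      have : 2 * binomTwo (k : ℤ)
          = 2 * (-binomTwo ((N : ℤ) + 1) + binomTwo ((k : ℤ) - N) + N * k) := by
        linear_combination a3 + a1 - a2
      omega
    have h2 : (-x * q ^ (-N : ℤ)) ^ k = (-x) ^ N * ((-1) ^ ((k : ℤ) - N) * x ^ ((k : ℤ) - N))
        * q ^ (-((N : ℤ) * k)) := by
      rw [mul_pow, ← mul_zpow, neg_one_mul, zpow_sub₀ (neg_ne_zero.2 hx), zpow_natCast,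
        zpow_natCast, mul_div_cancel₀ _ (pow_ne_zero _ (neg_ne_zero.2 hx)), ← neg_mul, zpow_mul,
        zpow_natCast]
    have h3 : q ^ ((N : ℤ) * k) * q ^ (-((N : ℤ) * k)) = 1 := by
      rw [← zpow_add₀ hq0]; simp
    rw [h1, h2]
    linear_combination (gaussBinom q (N + N) k * q ^ (-binomTwo (N + 1)) *
      q ^ binomTwo ((k : ℤ) - N) * (-x) ^ N * ((-1) ^ ((k : ℤ) - N) * x ^ ((k : ℤ) - N))) * h3
  · intro n hn
    split_ifs with h
    · rw [gaussBinom_eq_zero, zero_mul]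
      by_contra hlt
      exact hn (Finset.mem_image.2 ⟨(n + N).toNat, Finset.mem_range.2 (by omega), by omega⟩)
    · simp

theorem summable_norm_pow_mul {q : ℂ} (hq : ‖q‖ < 1) (x : ℂ) :
    Summable fun i : ℕ => ‖-(q ^ i * x)‖ := by
  simpa [norm_pow] using (summable_geometric_of_lt_one (norm_nonneg q) hq).mul_right ‖x‖

theorem multipliable_qPochInf {q : ℂ} (hq : ‖q‖ < 1) (x : ℂ) :
    Multipliable fun i : ℕ => 1 - q ^ i * x := by
  simpa [sub_eq_add_neg] using multipliable_one_add_of_summable (summable_norm_pow_mul hq x)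

theorem tendsto_qPochInf {q : ℂ} (hq : ‖q‖ < 1) (x : ℂ) :
    Tendsto (fun N => ∏ i ∈ Finset.range N, (1 - q ^ i * x)) atTop (𝓝 (qPochInf x q)) :=
  (multipliable_qPochInf hq x).hasProd.tendsto_prod_nat

theorem qPochInf_ne_zero {q x : ℂ} (hq : ‖q‖ < 1) (h : ∀ i : ℕ, 1 - q ^ i * x ≠ 0) :
    qPochInf x q ≠ 0 := by
  have := tprod_one_add_ne_zero_of_summable (f := fun i : ℕ => -(q ^ i * x))
    (fun i => by simpa [← sub_eq_add_neg] using h i) (summable_norm_pow_mul hq x)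
  simpa [qPochInf, sub_eq_add_neg] using this

theorem one_sub_pow_mul_self_ne_zero {q : ℂ} (hq : ‖q‖ < 1) (i : ℕ) : 1 - q ^ i * q ≠ 0 := by
  intro h
  have h1 : ‖q ^ (i + 1)‖ = 1 := by rw [pow_succ, ← sub_eq_zero.1 h, norm_one]
  rw [norm_pow] at h1
  exact (pow_lt_one₀ (norm_nonneg q) hq (Nat.succ_ne_zero i)).ne h1

theorem qPochInf_self_ne_zero {q : ℂ} (hq : ‖q‖ < 1) : qPochInf q q ≠ 0 :=
  qPochInf_ne_zero hq (one_sub_pow_mul_self_ne_zero hq)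

theorem qFact_ne_zero {q : ℂ} (hq : ‖q‖ < 1) (n : ℕ) : qFact q n ≠ 0 :=
  Finset.prod_ne_zero_iff.2 fun i _ => one_sub_pow_mul_self_ne_zero hq i

theorem gaussBinom_eq_div {q : ℂ} (hq : ‖q‖ < 1) (k l : ℕ) :
    gaussBinom q (k + l) k = qFact q (k + l) * ((qFact q k)⁻¹ * (qFact q l)⁻¹) := by
  rw [← gaussBinom_mul_qFact]
  have h1 := qFact_ne_zero hq k
  have h2 := qFact_ne_zero hq l
  field_simp

theorem exists_bound_of_tendsto {f : ℕ → ℂ} {a : ℂ} (h : Tendsto f atTop (𝓝 a)) :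
    ∃ B : ℝ, 0 ≤ B ∧ ∀ n, ‖f n‖ ≤ B := by
  obtain ⟨B, hB⟩ := (Metric.isBounded_range_of_tendsto f h).exists_norm_le
  exact ⟨B, (norm_nonneg (f 0)).trans (hB _ ⟨0, rfl⟩), fun n => hB _ ⟨n, rfl⟩⟩

/-- The Jacobi triple product identity, as the limit of its finite form. -/
theorem jTheta_eq_thetaSeries {q x : ℂ} (hq0 : q ≠ 0) (hq : ‖q‖ < 1) (hx : x ≠ 0) :
    jTheta x q = thetaSeries x q := by
  have hne := qPochInf_self_ne_zero hq
  have hF : Tendsto (qFact q) atTop (𝓝 (qPochInf q q)) := tendsto_qPochInf hq q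
  have hFi : Tendsto (fun n => (qFact q n)⁻¹) atTop (𝓝 (qPochInf q q)⁻¹) := hF.inv₀ hne
  obtain ⟨U, hU0, hU⟩ := exists_bound_of_tendsto hF
  obtain ⟨V, hV0, hV⟩ := exists_bound_of_tendsto hFi
  have hG : ∀ m k, ‖gaussBinom q m k‖ ≤ U * (V * V) := by
    intro m k
    rcases lt_or_ge m k with h | h
    · rw [gaussBinom_eq_zero q h, norm_zero]; positivity
    · obtain ⟨l, rfl⟩ := Nat.exists_eq_add_of_le h
      rw [gaussBinom_eq_div hq, norm_mul, norm_mul]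
      exact mul_le_mul (hU _) (mul_le_mul (hV _) (hV _) (norm_nonneg _) hV0) (by positivity) hU0
  have hlim := tendsto_tsum_of_dominated_convergence (𝓕 := atTop)
    (f := fun (N : ℕ) (n : ℤ) => (if 0 ≤ n + N then gaussBinom q (N + N) (n + N).toNat else 0) *
          ((-1) ^ n * q ^ binomTwo n * x ^ n))
    (g := fun n : ℤ => (qPochInf q q)⁻¹ * ((-1) ^ n * q ^ binomTwo n * x ^ n))
    ((summable_norm_theta hq0 hq x).mul_left (U * (V * V))) ?_ ?_
  · have hprod := (tendsto_qPochInf hq x).mul (tendsto_qPochInf hq (q / x))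
    simp_rw [finite_triple_product hq0 hx] at hprod
    have := tendsto_nhds_unique hprod hlim
    rw [tsum_mul_left] at this
    rw [jTheta, this, thetaSeries]
    field_simp
  · intro n
    refine Tendsto.mul_const _ ?_
    have hN : Tendsto (fun N : ℕ => N + N) atTop atTop :=
      tendsto_atTop_mono (fun N => Nat.le_add_left N N) tendsto_id
    have h1 : Tendsto (fun N : ℕ => (n + N).toNat) atTop atTop := by
      refine tendsto_atTop_atTop.2 fun b => ⟨b + n.natAbs, fun N hN => by omega⟩
    have h2 : Tendsto (fun N : ℕ => (-n + N).toNat) atTop atTop := by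
      refine tendsto_atTop_atTop.2 fun b => ⟨b + n.natAbs, fun N hN => by omega⟩
    have := (hF.comp hN).mul ((hFi.comp h1).mul (hFi.comp h2))
    rw [mul_inv_cancel_left₀ hne] at this
    refine this.congr' ?_
    filter_upwards [eventually_ge_atTop n.natAbs] with N hN
    rw [if_pos (by omega)]
    have h3 : N + N = (n + N).toNat + (-n + N).toNat := by omega
    simp only [Function.comp_apply]
    rw [h3, gaussBinom_eq_div hq]
  · refine Eventually.of_forall fun N n => ?_
    rw [norm_mul]
    refine mul_le_mul_of_nonneg_right ?_ (norm_nonneg _)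
    split_ifs
    · exact hG _ _
    · rw [norm_zero]; positivity

/-! ### Zeros and functional equation of `j` -/

theorem qPochInf_eq_mul {q : ℂ} (hq : ‖q‖ < 1) (x : ℂ) :
    qPochInf x q = (1 - x) * qPochInf (q * x) q := by
  have h := (multipliable_qPochInf hq (q * x))
  rw [qPochInf, tprod_eq_zero_mul']
  · simp only [pow_zero, one_mul, qPochInf]
    congr 2
    ext i
    ring
  · refine h.congr fun i => ?_
    ring

theorem continuous_qPochInf {q : ℂ} (hq : ‖q‖ < 1) : Continuous fun x => qPochInf x q := by
  refine continuous_iff_continuousAt.2 fun x => ?_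
  have := tendsto_tprod_one_add_of_dominated_convergence (𝓕 := 𝓝 x)
    (f := fun (y : ℂ) (i : ℕ) => -(q ^ i * y)) (g := fun i : ℕ => -(q ^ i * x))
    (bound := fun i => ‖q‖ ^ i * (‖x‖ + 1))
    ((summable_geometric_of_lt_one (norm_nonneg q) hq).mul_right _)
    (fun i => (by fun_prop : Continuous fun y : ℂ => -(q ^ i * y)).tendsto x) ?_
  · simpa [ContinuousAt, qPochInf, sub_eq_add_neg] using this
  · filter_upwards [(continuous_norm.tendsto x).eventually_le_const (lt_add_one ‖x‖)] with y hy i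
    rw [norm_neg, norm_mul, norm_pow]
    exact mul_le_mul_of_nonneg_left hy (by positivity)

theorem jTheta_one {q : ℂ} (hq : ‖q‖ < 1) : jTheta 1 q = 0 := by
  rw [jTheta, qPochInf_eq_mul hq]
  simp

theorem jTheta_ne_zero {q x : ℂ} (hq0 : q ≠ 0) (hq : ‖q‖ < 1) (hx : x ≠ 0)
    (h : ∀ k : ℤ, x ≠ q ^ k) : jTheta x q ≠ 0 := by
  refine mul_ne_zero (mul_ne_zero (qPochInf_ne_zero hq fun i hi => ?_)
    (qPochInf_ne_zero hq fun i hi => ?_)) (qPochInf_self_ne_zero hq)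
  · apply h (-i)
    rw [zpow_neg, zpow_natCast]
    exact eq_inv_of_mul_eq_one_right (sub_eq_zero.1 hi).symm
  · apply h (i + 1)
    rw [zpow_add_one₀ hq0, zpow_natCast]
    have := sub_eq_zero.1 hi
    field_simp at this
    exact this

theorem thetaSeries_mul_zpow {q x : ℂ} (hq0 : q ≠ 0) (hx : x ≠ 0) (s : ℤ) :
    thetaSeries (x * q ^ s) q = (-1) ^ s * q ^ (-binomTwo s) * x ^ (-s) * thetaSeries x q := by
  unfold thetaSeries
  rw [← tsum_mul_left, ← (Equiv.addRight s).tsum_eq fun n : ℤ => (-1) ^ s * q ^ (-binomTwo s) *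
    x ^ (-s) * ((-1) ^ n * q ^ binomTwo n * x ^ n)]
  refine tsum_congr fun n => ?_
  rw [Equiv.coe_addRight, binomTwo_add, mul_zpow, ← zpow_mul, zpow_add₀ (by norm_num : (-1:ℂ) ≠ 0),
    zpow_add₀ hx, zpow_add₀ hq0, zpow_add₀ hq0, zpow_neg, zpow_neg]
  have h1 : ((-1 : ℂ) ^ s) * (-1) ^ s = 1 := by rw [← mul_zpow]; simp
  have h2 := zpow_ne_zero (binomTwo s) hq0
  have h3 := zpow_ne_zero s hx
  rw [mul_comm s n]
  field_simp
  linear_combination -h1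

theorem jTheta_mul_zpow {q x : ℂ} (hq0 : q ≠ 0) (hq : ‖q‖ < 1) (hx : x ≠ 0) (s : ℤ) :
    jTheta (x * q ^ s) q = (-1) ^ s * q ^ (-binomTwo s) * x ^ (-s) * jTheta x q := by
  rw [jTheta_eq_thetaSeries hq0 hq hx,
    jTheta_eq_thetaSeries hq0 hq (mul_ne_zero hx (zpow_ne_zero _ hq0)), thetaSeries_mul_zpow hq0 hx]

theorem jTheta_inv {q x : ℂ} (hq0 : q ≠ 0) (hq : ‖q‖ < 1) (hx : x ≠ 0) :
    jTheta x⁻¹ q = -x⁻¹ * jTheta x q := by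
  have h1 : jTheta (q / x) q = jTheta x q := by
    have : q / (q / x) = x := by field_simp
    rw [jTheta, jTheta, this, mul_comm (qPochInf (q / x) q)]
  have h2 := jTheta_mul_zpow hq0 hq (inv_ne_zero hx) 1
  rw [zpow_one, inv_mul_eq_div, h1] at h2
  rw [h2]
  simp
  field_simp

/-! ### Appell–Lerch series -/

/-- The numerator of the Appell–Lerch sum, `∑ (-1) ^ r q ^ (r (r - 1) / 2) w ^ r / (1 - q ^ (r - 1) a)`
over all integers `r`, so that `m(x, q, z) = lerchSeries (x z) z q / j(z; q)`. Keeping `a` and `w`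
independent allows `w` to be a power of `q`, where `m` is not defined. -/
noncomputable def lerchSeries (a w q : ℂ) : ℂ :=
  ∑' r : ℤ, (-1) ^ r * q ^ binomTwo r * w ^ r * (1 - q ^ (r - 1) * a)⁻¹

theorem appellLerch_eq (x q z : ℂ) : appellLerch x q z = lerchSeries (x * z) z q / jTheta z q := by
  simp only [appellLerch, lerchSeries, div_eq_mul_inv, one_mul, mul_assoc]
  rw [mul_comm]

theorem one_sub_zpow_mul_ne_zero {q a : ℂ} (ha : ∀ k : ℤ, a ≠ q ^ k) (r : ℤ) :
    1 - q ^ r * a ≠ 0 := by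
  intro h
  apply ha (-r)
  rw [zpow_neg]
  exact eq_inv_of_mul_eq_one_right (sub_eq_zero.1 h).symm

theorem exists_bound_one_sub_zpow {q a : ℂ} (hq0 : q ≠ 0) (hq : ‖q‖ < 1) (ha0 : a ≠ 0) :
    ∃ B : ℝ, ∀ r : ℤ, ‖(1 - q ^ r * a)⁻¹‖ ≤ B := by
  have hpow := tendsto_pow_atTop_nhds_zero_of_norm_lt_one hq
  have h1 : Tendsto (fun n : ℕ => (1 - q ^ n * a)⁻¹) atTop (𝓝 (1 - 0 * a)⁻¹) :=
    ((hpow.mul_const a).const_sub 1).inv₀ (by simp)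
  have h2 : Tendsto (fun n : ℕ => q ^ n * (q ^ n - a)⁻¹) atTop (𝓝 (0 * (0 - a)⁻¹)) :=
    hpow.mul ((hpow.sub_const a).inv₀ (by simpa using ha0))
  obtain ⟨B1, _, hB1⟩ := exists_bound_of_tendsto h1
  obtain ⟨B2, _, hB2⟩ := exists_bound_of_tendsto h2
  refine ⟨max B1 B2, fun r => ?_⟩
  obtain ⟨n, rfl | rfl⟩ := r.eq_nat_or_neg
  · simpa using Or.inl (hB1 n)
  · refine le_trans (le_of_eq ?_) ((hB2 n).trans (le_max_right _ _))
    have : 1 - q ^ (-n : ℤ) * a = (q ^ n - a) / q ^ n := by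
      rw [zpow_neg, zpow_natCast]
      field_simp
    rw [this, inv_div, div_eq_mul_inv]

theorem summable_norm_lerch {a q : ℂ} (hq0 : q ≠ 0) (hq : ‖q‖ < 1) (ha0 : a ≠ 0) (w : ℂ) :
    Summable fun r : ℤ => ‖(-1) ^ r * q ^ binomTwo r * w ^ r * (1 - q ^ (r - 1) * a)⁻¹‖ := by
  obtain ⟨B, hB⟩ := exists_bound_one_sub_zpow hq0 hq ha0
  refine ((summable_norm_theta hq0 hq w).mul_right B).of_nonneg_of_le (fun _ => norm_nonneg _)
    fun r => ?_
  rw [norm_mul]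
  exact mul_le_mul_of_nonneg_left (hB _) (norm_nonneg _)

theorem summable_shift {f : ℤ → ℂ} (hf : Summable f) : Summable fun r => f (r + 1) :=
  (Equiv.addRight (1 : ℤ)).summable_iff.2 hf

theorem tsum_shift (f : ℤ → ℂ) : ∑' r, f (r + 1) = ∑' r, f r :=
  (Equiv.addRight (1 : ℤ)).tsum_eq f

/-- The antisymmetric combination of two Appell–Lerch series is, as a function of the scaling
variable `t`, a multiple of one theta series: its Laurent coefficients satisfy the same two-term
recurrence. -/
theorem exists_lerch_antisymm {a b q : ℂ} (hq0 : q ≠ 0) (hq : ‖q‖ < 1) (ha0 : a ≠ 0) (hb0 : b ≠ 0)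
    (ha : ∀ k : ℤ, a ≠ q ^ k) (hb : ∀ k : ℤ, b ≠ q ^ k) :
    ∃ c : ℂ, ∀ t : ℂ, t ≠ 0 →
      lerchSeries b (b * t) q * thetaSeries (a * t) q
        - lerchSeries a (a * t) q * thetaSeries (b * t) q
      = c * thetaSeries (a * b * q⁻¹ * t) q := by
  obtain ⟨W, hW⟩ : ∃ W : ℤ → ℤ → ℂ, W = fun r s =>
    ((-1) ^ r * q ^ binomTwo r * b ^ r) * ((-1) ^ s * q ^ binomTwo s * a ^ s) := ⟨_, rfl⟩
  obtain ⟨R, hR⟩ : ∃ R : ℤ → ℂ, R = fun r => (1 - q ^ (r - 1) * b)⁻¹ := ⟨_, rfl⟩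
  obtain ⟨S, hS⟩ : ∃ S : ℤ → ℂ, S = fun s => (1 - q ^ (s - 1) * a)⁻¹ := ⟨_, rfl⟩
  obtain ⟨c, hc⟩ : ∃ c : ℤ → ℂ, c = fun n => ∑' r : ℤ, W r (n - r) * (R r - S (n - r)) :=
    ⟨_, rfl⟩
  let e : ℤ × ℤ ≃ ℤ × ℤ :=
    { toFun := fun x => (x.2, x.1 - x.2)
      invFun := fun x => (x.1 + x.2, x.1)
      left_inv := fun x => by ext <;> simp
      right_inv := fun x => by ext <;> simp }
  -- Summability of the three double families, at an arbitrary scaling `t`.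
  have sW : Summable fun x : ℤ × ℤ => W x.1 x.2 := by
    have h := summable_mul_of_summable_norm (summable_norm_theta hq0 hq b)
      (summable_norm_theta hq0 hq a)
    rw [hW]
    exact h
  have sR : ∀ t : ℂ, Summable fun x : ℤ × ℤ => ((-1) ^ x.1 * q ^ binomTwo x.1 * (b * t) ^ x.1 *
      R x.1) * ((-1) ^ x.2 * q ^ binomTwo x.2 * (a * t) ^ x.2) := fun t => by
    have h := summable_mul_of_summable_norm (summable_norm_lerch hq0 hq hb0 (b * t))
      (summable_norm_theta hq0 hq (a * t))
    rw [hR]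
    exact h
  have sS : ∀ t : ℂ, Summable fun x : ℤ × ℤ => ((-1) ^ x.1 * q ^ binomTwo x.1 * (b * t) ^ x.1) *
      ((-1) ^ x.2 * q ^ binomTwo x.2 * (a * t) ^ x.2 * S x.2) := fun t => by
    have h := summable_mul_of_summable_norm (summable_norm_theta hq0 hq (b * t))
      (summable_norm_lerch hq0 hq ha0 (a * t))
    rw [hS]
    exact h
  have diag : ∀ {f : ℤ × ℤ → ℂ}, Summable f → ∀ n : ℤ, Summable fun r => f (r, n - r) :=
    fun hf n => hf.comp_injective (i := fun r : ℤ => (r, n - r)) fun r r' h => (Prod.ext_iff.1 h).1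
  have dW : ∀ n, Summable fun r => W r (n - r) := diag sW
  have dR : ∀ n, Summable fun r => W r (n - r) * R r := fun n =>
    (diag (sR 1) n).congr fun r => by simp only [hW, mul_one]; ring
  have dS : ∀ n, Summable fun r => W r (n - r) * S (n - r) := fun n =>
    (diag (sS 1) n).congr fun r => by simp only [hW, mul_one]; ring
  have hWr : ∀ r s, W (r + 1) s = -(W r s * (b * q ^ r)) := fun r s => by
    simp only [hW]
    rw [binomTwo_add_one, zpow_add₀ hq0, zpow_add_one₀ hb0, zpow_add_one₀ (by norm_num)]
    ring
  have hWs : ∀ r s, W r (s + 1) = -(W r s * (a * q ^ s)) := fun r s => by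
    simp only [hW]
    rw [binomTwo_add_one, zpow_add₀ hq0, zpow_add_one₀ ha0, zpow_add_one₀ (by norm_num)]
    ring
  have hrec : ∀ n, c (n + 1) = -(a * b * q⁻¹ * q ^ n) * c n := by
    intro n
    have d1 : Summable fun r => W r (n + 1 - r) * (R r - 1) :=
      ((dR (n + 1)).sub (dW (n + 1))).congr fun r => by ring
    have d2 : Summable fun r => W r (n + 1 - r) * (S (n + 1 - r) - 1) :=
      ((dS (n + 1)).sub (dW (n + 1))).congr fun r => by ring
    have d2' : Summable fun r => W (r + 1) (n + 1 - (r + 1)) * (S (n + 1 - (r + 1)) - 1) :=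
      summable_shift d2
    have h1 : c (n + 1) = ∑' r : ℤ, W r (n + 1 - r) * (R r - 1)
        - ∑' r : ℤ, W r (n + 1 - r) * (S (n + 1 - r) - 1) := by
      rw [← d1.tsum_sub d2, hc]
      exact tsum_congr fun r => by ring
    have h2 : ∑' r : ℤ, W r (n + 1 - r) * (S (n + 1 - r) - 1)
        = ∑' r : ℤ, W (r + 1) (n + 1 - (r + 1)) * (S (n + 1 - (r + 1)) - 1) :=
      (tsum_shift fun r => W r (n + 1 - r) * (S (n + 1 - r) - 1)).symm
    rw [h1, h2, ← d1.tsum_sub d2', hc, ← tsum_mul_left]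
    refine tsum_congr fun r => ?_
    simp only [add_sub_add_right_eq_sub]
    rw [show n + 1 - r = n - r + 1 by ring, hWs, hWr]
    obtain ⟨s, rfl⟩ : ∃ s, n = r + s := ⟨n - r, by ring⟩
    simp only [add_sub_cancel_left, hR, hS]
    have n1 : q - q ^ r * b ≠ 0 := fun h => hb (1 - r) (by
      rw [zpow_sub₀ hq0, zpow_one, eq_div_iff (zpow_ne_zero r hq0)]
      linear_combination -h)
    have n2 : q - q ^ s * a ≠ 0 := fun h => ha (1 - s) (by
      rw [zpow_sub₀ hq0, zpow_one, eq_div_iff (zpow_ne_zero s hq0)]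
      linear_combination -h)
    have e1 : (1 - q ^ (r - 1) * b)⁻¹ = q / (q - q ^ r * b) := by
      rw [zpow_sub_one₀ hq0, ← inv_div, sub_div, div_self hq0]
      ring
    have e2 : (1 - q ^ (s - 1) * a)⁻¹ = q / (q - q ^ s * a) := by
      rw [zpow_sub_one₀ hq0, ← inv_div, sub_div, div_self hq0]
      ring
    rw [e1, e2, zpow_add₀ hq0, mul_comm b, mul_comm a (q ^ s),
      show a * b * q⁻¹ * (q ^ r * q ^ s) = (q ^ s * a) * (q ^ r * b) * q⁻¹ by ring]
    generalize q ^ r * b = X at n1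
    generalize q ^ s * a = Y at n2
    field_simp
    ring
  have hclosed : ∀ n : ℤ, c n = c 0 * ((-1) ^ n * q ^ binomTwo n * (a * b * q⁻¹) ^ n) := by
    have hx : a * b * q⁻¹ ≠ 0 := by positivity
    have hstep : ∀ n : ℤ, (-1 : ℂ) ^ (n + 1) * q ^ binomTwo (n + 1) * (a * b * q⁻¹) ^ (n + 1)
        = -(a * b * q⁻¹ * q ^ n) * ((-1) ^ n * q ^ binomTwo n * (a * b * q⁻¹) ^ n) := fun n => by
      rw [binomTwo_add_one, zpow_add₀ hq0, zpow_add_one₀ hx, zpow_add_one₀ (by norm_num)]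
      ring
    intro n
    induction n with
    | zero => simp
    | succ n ih => rw [hrec, hstep, ih]; ring
    | pred n ih =>
      have h1 := hrec (-n - 1)
      have h2 := hstep (-n - 1)
      rw [sub_add_cancel] at h1 h2
      rw [h1, h2] at ih
      have h3 : -(a * b * q⁻¹ * q ^ (-(n : ℤ) - 1)) ≠ 0 :=
        neg_ne_zero.2 (mul_ne_zero hx (zpow_ne_zero _ hq0))
      apply mul_left_cancel₀ h3
      rw [ih]; ring
  refine ⟨c 0, fun t ht => ?_⟩
  have sR' := sR t
  have sS' := sS t
  have hsub := sR'.sub sS'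
  rw [hR] at sR'
  rw [hS] at sS'
  rw [hR, hS] at hsub
  rw [lerchSeries, thetaSeries, lerchSeries, thetaSeries,
    mul_comm (∑' r : ℤ, (-1) ^ r * q ^ binomTwo r * (a * t) ^ r * (1 - q ^ (r - 1) * a)⁻¹),
    tsum_mul_tsum_of_summable_norm (summable_norm_lerch hq0 hq hb0 (b * t))
      (summable_norm_theta hq0 hq (a * t)),
    tsum_mul_tsum_of_summable_norm (summable_norm_theta hq0 hq (b * t))
      (summable_norm_lerch hq0 hq ha0 (a * t)), ← sR'.tsum_sub sS']
  refine (e.tsum_eq _).symm.trans ((e.summable_iff.2 hsub).tsum_prod.trans ?_)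
  rw [thetaSeries, ← tsum_mul_left]
  refine tsum_congr fun n => ?_
  have hn : c 0 * ((-1) ^ n * q ^ binomTwo n * (a * b * q⁻¹ * t) ^ n) = t ^ n * c n := by
    rw [hclosed n, mul_zpow _ t]
    ring
  rw [hn, hc, ← tsum_mul_left]
  refine tsum_congr fun r => ?_
  obtain ⟨s, rfl⟩ : ∃ s, n = r + s := ⟨n - r, by ring⟩
  simp only [e, Function.comp_apply, Equiv.coe_fn_mk, add_sub_cancel_left, hW, hR, hS, mul_zpow]
  rw [zpow_add₀ ht]
  ring

/-- As `a → 1`, the denominators `1 - q ^ k a` with `k ≠ 0` stay away from `0` uniformly in `k`. -/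
theorem exists_lower_bound_near_one {q : ℂ} (hq0 : q ≠ 0) (hq : ‖q‖ < 1) :
    ∃ δ : ℝ, 0 < δ ∧ ∀ᶠ a : ℂ in 𝓝 1, ∀ k : ℤ, k ≠ 0 → δ ≤ ‖1 - q ^ k * a‖ := by
  have hq0' : 0 < ‖q‖ := norm_pos_iff.2 hq0
  refine ⟨(1 - ‖q‖) / 2, by linarith, ?_⟩
  have hn : Tendsto (fun a : ℂ => ‖a‖) (𝓝 1) (𝓝 1) := by
    simpa using continuous_norm.tendsto (1 : ℂ)
  have h1 : ∀ᶠ a : ℂ in 𝓝 1, ‖q‖ * ‖a‖ < (1 + ‖q‖) / 2 :=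
    (hn.const_mul ‖q‖).eventually_lt_const (by linarith)
  have h2 : ∀ᶠ a : ℂ in 𝓝 1, (1 + (1 - ‖q‖) / 2) * ‖q‖ < ‖a‖ :=
    hn.eventually_const_lt (by nlinarith)
  filter_upwards [h1, h2] with a ha1 ha2 k hk
  rcases lt_or_gt_of_ne hk with hk | hk
  · have h3 : ‖q‖⁻¹ ≤ ‖q‖ ^ k := by
      rw [← zpow_neg_one]
      exact zpow_le_zpow_right_of_le_one₀ hq0' hq.le (by omega)
    have h4 : ‖q ^ k * a‖ - ‖(1 : ℂ)‖ ≤ ‖1 - q ^ k * a‖ := by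
      rw [norm_sub_rev]; exact norm_sub_norm_le _ _
    rw [norm_mul, norm_zpow, norm_one] at h4
    have h5 : 1 + (1 - ‖q‖) / 2 ≤ ‖q‖⁻¹ * ‖a‖ := by
      rw [inv_mul_eq_div, le_div_iff₀ hq0']
      exact ha2.le
    have h6 := mul_le_mul_of_nonneg_right h3 (norm_nonneg a)
    linarith
  · have h3 : ‖q‖ ^ k ≤ ‖q‖ := by
      simpa using zpow_le_zpow_right_of_le_one₀ hq0' hq.le (show (1 : ℤ) ≤ k by omega)
    have h4 : ‖(1 : ℂ)‖ - ‖q ^ k * a‖ ≤ ‖1 - q ^ k * a‖ := norm_sub_norm_le _ _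
    rw [norm_mul, norm_zpow, norm_one] at h4
    have h6 := mul_le_mul_of_nonneg_right h3 (norm_nonneg a)
    linarith

/-- Only the summand for `r = 1` has a pole at `a = 1`. -/
theorem tendsto_one_sub_mul_lerchSeries {q : ℂ} (hq0 : q ≠ 0) (hq : ‖q‖ < 1) :
    Tendsto (fun a : ℂ => (1 - a) * lerchSeries a 1 q) (𝓝[≠] 1) (𝓝 (-1)) := by
  obtain ⟨δ, hδ, hev⟩ := exists_lower_bound_near_one hq0 hq
  have hlim := tendsto_tsum_of_dominated_convergence (𝓕 := 𝓝[≠] (1 : ℂ))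
    (f := fun (a : ℂ) (r : ℤ) =>
      (-1) ^ r * q ^ binomTwo r * 1 ^ r * ((1 - a) * (1 - q ^ (r - 1) * a)⁻¹))
    (g := fun r : ℤ => if r = 1 then (-1 : ℂ) else 0)
    ((summable_norm_theta hq0 hq 1).mul_right (1 + δ⁻¹)) ?_ ?_
  · rw [tsum_ite_eq] at hlim
    refine hlim.congr fun a => ?_
    rw [lerchSeries, ← tsum_mul_left]
    exact tsum_congr fun r => by ring
  · intro r
    rcases eq_or_ne r 1 with rfl | hr
    · refine tendsto_const_nhds.congr' ?_
      filter_upwards [self_mem_nhdsWithin] with a ha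
      have : 1 - a ≠ 0 := sub_ne_zero.2 (Ne.symm ha)
      simp [this]
    · rw [if_neg hr]
      have hk : 1 - q ^ (r - 1) * 1 ≠ 0 := by
        have := hev.self_of_nhds (r - 1) (sub_ne_zero.2 hr)
        exact norm_pos_iff.1 (hδ.trans_le this)
      have h1 : ContinuousAt (fun a : ℂ =>
          (-1) ^ r * q ^ binomTwo r * 1 ^ r * ((1 - a) * (1 - q ^ (r - 1) * a)⁻¹)) 1 := by
        refine ContinuousAt.mul continuousAt_const (ContinuousAt.mul (by fun_prop) ?_)
        exact ContinuousAt.inv₀ (by fun_prop) hk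
      have h2 := h1.tendsto
      simp only [sub_self, zero_mul, mul_zero] at h2
      exact h2.mono_left nhdsWithin_le_nhds
  · have hne : ∀ᶠ a : ℂ in 𝓝 1, ‖1 - a‖ ≤ 1 := by
      have : Tendsto (fun a : ℂ => ‖1 - a‖) (𝓝 1) (𝓝 ‖(1 : ℂ) - 1‖) :=
        (by fun_prop : Continuous fun a : ℂ => ‖1 - a‖).tendsto 1
      exact (this.eventually_lt_const (by simp)).mono fun a h => h.le
    filter_upwards [nhdsWithin_le_nhds hev, nhdsWithin_le_nhds hne, self_mem_nhdsWithin]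
      with a ha1 ha2 ha3 r
    rw [norm_mul]
    refine mul_le_mul_of_nonneg_left ?_ (norm_nonneg _)
    rcases eq_or_ne r 1 with rfl | hr
    · have : 1 - a ≠ 0 := sub_ne_zero.2 (Ne.symm ha3)
      simp [this, hδ.le]
    · rw [norm_mul, norm_inv]
      have h1 := ha1 (r - 1) (sub_ne_zero.2 hr)
      have h2 : ‖1 - a‖ * ‖1 - q ^ (r - 1) * a‖⁻¹ ≤ 1 * δ⁻¹ :=
        mul_le_mul ha2 (inv_anti₀ hδ h1) (by positivity) zero_le_one
      linarith

/-- The relation between the constant of `exists_lerch_antisymm` and the values of the Appell–Lerch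
series at `w = 1`, from the zeros `t = 1 / a` and `t = 1 / b` of the theta factors. -/
theorem exists_lerch_antisymm_one {a b q : ℂ} (hq0 : q ≠ 0) (hq : ‖q‖ < 1) (ha0 : a ≠ 0)
    (hb0 : b ≠ 0) (ha : ∀ k : ℤ, a ≠ q ^ k) (hb : ∀ k : ℤ, b ≠ q ^ k) :
    ∃ c : ℂ, (∀ t : ℂ, t ≠ 0 →
      lerchSeries b (b * t) q * jTheta (a * t) q - lerchSeries a (a * t) q * jTheta (b * t) q
        = c * (t * jTheta (a * b * t) q)) ∧
      lerchSeries a 1 q * jTheta (b / a) q = -(c * a⁻¹ * jTheta b q) ∧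
      lerchSeries b 1 q * jTheta (b / a) q = -(c * a⁻¹ * jTheta a q) := by
  obtain ⟨c, hc⟩ := exists_lerch_antisymm hq0 hq ha0 hb0 ha hb
  have hc' : ∀ t : ℂ, t ≠ 0 →
      lerchSeries b (b * t) q * jTheta (a * t) q - lerchSeries a (a * t) q * jTheta (b * t) q
        = -(c * (a * b * q⁻¹)) * (t * jTheta (a * b * t) q) := by
    intro t ht
    have hx : a * b * t ≠ 0 := mul_ne_zero (mul_ne_zero ha0 hb0) ht
    rw [jTheta_eq_thetaSeries hq0 hq (mul_ne_zero ha0 ht),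
      jTheta_eq_thetaSeries hq0 hq (mul_ne_zero hb0 ht), hc t ht,
      show a * b * q⁻¹ * t = a * b * t * q ^ (-1 : ℤ) by rw [zpow_neg_one]; ring,
      thetaSeries_mul_zpow hq0 hx, jTheta_eq_thetaSeries hq0 hq hx,
      show binomTwo (-1) = 1 by decide]
    simp
    ring
  refine ⟨_, hc', ?_, ?_⟩
  · have h := hc' a⁻¹ (inv_ne_zero ha0)
    rw [mul_inv_cancel₀ ha0, jTheta_one hq, mul_zero, zero_sub, ← div_eq_mul_inv b a,
      show a * b * a⁻¹ = b by field_simp] at h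
    linear_combination -h
  · have h := hc' b⁻¹ (inv_ne_zero hb0)
    have h2 := jTheta_inv hq0 hq (div_ne_zero hb0 ha0)
    rw [inv_div] at h2
    rw [mul_inv_cancel₀ hb0, jTheta_one hq, mul_zero, sub_zero, ← div_eq_mul_inv a b,
      mul_inv_cancel_right₀ hb0, h2] at h
    field_simp at h ⊢
    linear_combination -h

theorem jTheta_eq_one_sub_mul {q : ℂ} (hq : ‖q‖ < 1) (a : ℂ) :
    jTheta a q = (1 - a) * (qPochInf (q * a) q * qPochInf (q / a) q * qPochInf q q) := by
  rw [jTheta, qPochInf_eq_mul hq]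
  ring

theorem continuousAt_jTheta {q x : ℂ} (hq : ‖q‖ < 1) (hx : x ≠ 0) :
    ContinuousAt (fun x => jTheta x q) x := by
  have h := continuous_qPochInf hq
  unfold jTheta
  refine ContinuousAt.mul (ContinuousAt.mul h.continuousAt ?_) continuousAt_const
  exact h.continuousAt.comp (f := fun y => q / y) (continuousAt_const.div continuousAt_id hx)

/-- The partial fraction expansion of `1 / j(a; q)`. The product `lerchSeries a 1 q * j(a; q)` does
not depend on `a`, and its value is read off as `a → 1`. -/
theorem lerchSeries_one_mul_jTheta {b q : ℂ} (hq0 : q ≠ 0) (hq : ‖q‖ < 1) (hb0 : b ≠ 0)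
    (hb : ∀ k : ℤ, b ≠ q ^ k) : lerchSeries b 1 q * jTheta b q = -qPochInf q q ^ 3 := by
  have hJ := qPochInf_self_ne_zero hq
  have hcont := continuous_qPochInf hq
  have hg : Tendsto (fun a : ℂ => qPochInf (q * a) q * qPochInf (q / a) q * qPochInf q q)
      (𝓝 1) (𝓝 (qPochInf q q ^ 3)) := by
    have h1 : ContinuousAt
        (fun a : ℂ => qPochInf (q * a) q * qPochInf (q / a) q * qPochInf q q) 1 := by
      refine ContinuousAt.mul (ContinuousAt.mul ?_ ?_) continuousAt_const
      · exact hcont.continuousAt.comp (f := fun y => q * y) (by fun_prop)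
      · exact hcont.continuousAt.comp (f := fun y => q / y)
          (continuousAt_const.div continuousAt_id one_ne_zero)
    have h2 := h1.tendsto
    rw [mul_one, div_one] at h2
    convert h2 using 2
    ring
  have hlim := (tendsto_one_sub_mul_lerchSeries hq0 hq).mul (hg.mono_left nhdsWithin_le_nhds)
  have hgne : ∀ᶠ a : ℂ in 𝓝 1,
      qPochInf (q * a) q * qPochInf (q / a) q * qPochInf q q ≠ 0 :=
    hg.eventually_ne (pow_ne_zero 3 hJ)
  have hjb := jTheta_ne_zero hq0 hq hb0 hb
  have hba : ∀ᶠ a : ℂ in 𝓝 1, jTheta (b / a) q ≠ 0 := by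
    have h1 : ContinuousAt (fun a : ℂ => jTheta (b / a) q) 1 :=
      ContinuousAt.comp (f := fun y => b / y) (g := fun x => jTheta x q)
        (continuousAt_jTheta hq (by simpa using hb0))
        (continuousAt_const.div continuousAt_id one_ne_zero)
    refine h1.eventually_ne ?_
    simpa using hjb
  have hne0 : ∀ᶠ a : ℂ in 𝓝 1, a ≠ 0 := eventually_ne_nhds one_ne_zero
  have hconst : ∀ᶠ a : ℂ in 𝓝[≠] 1, lerchSeries b 1 q * jTheta b q
      = (1 - a) * lerchSeries a 1 q * (qPochInf (q * a) q * qPochInf (q / a) q * qPochInf q q) := by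
    filter_upwards [nhdsWithin_le_nhds hgne, nhdsWithin_le_nhds hba, nhdsWithin_le_nhds hne0,
      self_mem_nhdsWithin] with a h1 h2 h3 h4
    have hja : jTheta a q ≠ 0 := by
      rw [jTheta_eq_one_sub_mul hq]
      exact mul_ne_zero (sub_ne_zero.2 (Ne.symm h4)) h1
    have ha : ∀ k : ℤ, a ≠ q ^ k := by
      rintro k rfl
      apply hja
      have := jTheta_mul_zpow hq0 hq one_ne_zero k
      rw [one_mul] at this
      rw [this, jTheta_one hq, mul_zero]
    obtain ⟨c, _, e1, e2⟩ := exists_lerch_antisymm_one hq0 hq h3 hb0 ha hb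
    have e3 := jTheta_eq_one_sub_mul hq a
    apply mul_right_cancel₀ h2
    have : lerchSeries b 1 q * jTheta b q * jTheta (b / a) q
        = lerchSeries a 1 q * jTheta a q * jTheta (b / a) q := by
      linear_combination jTheta b q * e2 - jTheta a q * e1
    rw [this, e3]
    ring
  have := tendsto_nhds_unique (tendsto_const_nhds.congr' hconst) hlim
  rw [this]
  ring

/-- The dependence of the Appell–Lerch sum on its third argument: a single theta quotient. -/
theorem lerchSeries_change {a b t q : ℂ} (hq0 : q ≠ 0) (hq : ‖q‖ < 1) (ha0 : a ≠ 0)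
    (hb0 : b ≠ 0) (ht : t ≠ 0) (ha : ∀ k : ℤ, a ≠ q ^ k) (hb : ∀ k : ℤ, b ≠ q ^ k) :
    lerchSeries b (b * t) q * jTheta (a * t) q = lerchSeries a (a * t) q * jTheta (b * t) q
      + a * t * qPochInf q q ^ 3 * jTheta (b / a) q * jTheta (a * b * t) q
        / (jTheta a q * jTheta b q) := by
  obtain ⟨c, hc, e1, _⟩ := exists_lerch_antisymm_one hq0 hq ha0 hb0 ha hb
  have h1 := lerchSeries_one_mul_jTheta hq0 hq ha0 ha
  have hja := jTheta_ne_zero hq0 hq ha0 ha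
  have hjb := jTheta_ne_zero hq0 hq hb0 hb
  have hcv : c * (jTheta a q * jTheta b q) = a * qPochInf q q ^ 3 * jTheta (b / a) q := by
    field_simp at e1
    linear_combination (-a * jTheta (b / a) q) * h1 + jTheta a q * e1
  have h2 := hc t ht
  have h3 : a * t * qPochInf q q ^ 3 * jTheta (b / a) q * jTheta (a * b * t) q
      / (jTheta a q * jTheta b q) = c * (t * jTheta (a * b * t) q) := by
    rw [div_eq_iff (mul_ne_zero hja hjb)]
    linear_combination (-t * jTheta (a * b * t) q) * hcv
  linear_combination h2 - h3

/-! ### Dissection of an Appell–Lerch series -/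

theorem tsum_int_dissect {f : ℤ → ℂ} (hf : Summable f) {M : ℕ} (hM : 0 < M) :
    ∑' r : ℤ, f r = ∑ u ∈ Finset.range M, ∑' t : ℤ, f (t * M + u) := by
  have : NeZero M := ⟨hM.ne'⟩
  let e : Fin M × ℤ ≃ ℤ := (Equiv.prodComm _ _).trans (Int.divModEquiv M).symm
  rw [← e.tsum_eq]
  refine ((e.summable_iff.2 hf).tsum_prod).trans ?_
  rw [tsum_fintype, ← Fin.sum_univ_eq_sum_range fun u => ∑' t : ℤ, f (t * M + u)]
  rfl

theorem binomTwo_mul_add (M t u : ℤ) :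
    binomTwo (t * M + u) = M ^ 2 * binomTwo t + (binomTwo M + M * u) * t + binomTwo u := by
  apply binomTwo_eq_of_two_mul
  linear_combination M ^ 2 * two_mul_binomTwo t + t * two_mul_binomTwo M + two_mul_binomTwo u

theorem neg_one_zpow_mul_natCast (M : ℕ) (t : ℤ) :
    (-1 : ℂ) ^ (t * (M : ℤ)) = (-1) ^ t * ((-1) ^ (M + 1)) ^ t := by
  rw [mul_comm, zpow_mul, ← mul_zpow, zpow_natCast, pow_succ]
  simp

theorem theta_term_dissect {q w : ℂ} (hq0 : q ≠ 0) (hw : w ≠ 0) (M : ℕ) (t u : ℤ) :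
    (-1) ^ (t * M + u) * q ^ binomTwo (t * M + u) * w ^ (t * M + u)
      = (-1) ^ u * q ^ binomTwo u * w ^ u *
        ((-1) ^ t * (q ^ (M ^ 2)) ^ binomTwo t *
          ((-1) ^ (M + 1) * w ^ M * q ^ (binomTwo M + M * u)) ^ t) := by
  rw [binomTwo_mul_add, zpow_add₀ (by norm_num : (-1 : ℂ) ≠ 0), zpow_add₀ hw, zpow_add₀ hq0,
    zpow_add₀ hq0, neg_one_zpow_mul_natCast, mul_zpow, mul_zpow, mul_comm t (M : ℤ), zpow_mul w,
    zpow_natCast, zpow_mul q (binomTwo M + M * u), zpow_mul q ((M : ℤ) ^ 2)]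
  norm_cast
  ring

theorem norm_pow_sq_lt_one {q : ℂ} (hq : ‖q‖ < 1) {M : ℕ} (hM : 0 < M) : ‖q ^ (M ^ 2)‖ < 1 := by
  rw [norm_pow]
  exact pow_lt_one₀ (norm_nonneg q) hq (by positivity)

theorem thetaSeries_dissect {q w : ℂ} (hq0 : q ≠ 0) (hq : ‖q‖ < 1) (hw : w ≠ 0) {M : ℕ}
    (hM : 0 < M) :
    thetaSeries w q = ∑ u ∈ Finset.range M, (-1) ^ u * q ^ binomTwo u * w ^ u *
      thetaSeries ((-1) ^ (M + 1) * w ^ M * q ^ (binomTwo M + M * u)) (q ^ (M ^ 2)) := by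
  rw [thetaSeries, tsum_int_dissect (summable_norm_theta hq0 hq w).of_norm hM]
  refine Finset.sum_congr rfl fun u _ => ?_
  simp_rw [theta_term_dissect hq0 hw]
  rw [tsum_mul_left, thetaSeries, zpow_natCast, zpow_natCast]

/-- The argument of the theta factors occurring in the dissection of `lerchSeries a w q`. -/
noncomputable def dissectArg (w q : ℂ) (M : ℕ) (k : ℕ) : ℂ :=
  (-1) ^ (M + 1) * w ^ M * q ^ (binomTwo M + M * k)

/-- Writing `1 / (1 - Y)` as `(1 + Y + ⋯ + Y ^ (M - 1)) / (1 - Y ^ M)` and splitting the summation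
index modulo `M` turns a series with base `q` into series with base `q ^ (M ^ 2)`. -/
theorem lerchSeries_dissect {q a w : ℂ} (hq0 : q ≠ 0) (hq : ‖q‖ < 1) (ha0 : a ≠ 0) (hw : w ≠ 0)
    {M : ℕ} (hM : 0 < M) (ha : ∀ k : ℤ, a ^ M ≠ q ^ k) :
    lerchSeries a w q = ∑ s ∈ Finset.range M, ∑ u ∈ Finset.range M,
      ((-1) ^ u * q ^ binomTwo u * w ^ u * (q ^ ((u : ℤ) - 1) * a) ^ s) *
        lerchSeries (q ^ ((M : ℤ) ^ 2 + M * ((u : ℤ) - 1)) * a ^ M) (dissectArg w q M (u + s))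
          (q ^ (M ^ 2)) := by
  have hQ0 : q ^ (M ^ 2) ≠ 0 := pow_ne_zero _ hq0
  have hQ := norm_pow_sq_lt_one hq hM
  rw [lerchSeries, tsum_int_dissect (summable_norm_lerch hq0 hq ha0 w).of_norm hM,
    Finset.sum_comm]
  refine Finset.sum_congr rfl fun u _ => ?_
  have hA0 : q ^ ((M : ℤ) ^ 2 + M * ((u : ℤ) - 1)) * a ^ M ≠ 0 :=
    mul_ne_zero (zpow_ne_zero _ hq0) (pow_ne_zero _ ha0)
  simp only [lerchSeries, ← tsum_mul_left]
  rw [← Summable.tsum_finsetSum fun s _ =>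
    ((summable_norm_lerch hQ0 hQ hA0 (dissectArg w q M (u + s))).of_norm).mul_left _]
  refine tsum_congr fun t => ?_
  rw [theta_term_dissect hq0 hw]
  have hden : (q ^ (M ^ 2)) ^ (t - 1) * (q ^ ((M : ℤ) ^ 2 + M * ((u : ℤ) - 1)) * a ^ M)
      = (q ^ (t * M + u - 1) * a) ^ M := by
    rw [mul_pow, ← zpow_natCast q (M ^ 2), ← zpow_mul, ← mul_assoc, ← zpow_add₀ hq0,
      ← zpow_natCast (q ^ _) M, ← zpow_mul]
    congr 2
    push_cast
    ring
  rw [hden]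
  have hY : (q ^ (t * M + u - 1) * a) ^ M ≠ 1 := by
    intro h
    apply ha (-((t * M + u - 1) * M))
    rw [mul_pow, ← zpow_natCast (q ^ _) M, ← zpow_mul] at h
    rw [zpow_neg]
    exact eq_inv_of_mul_eq_one_right h
  have hY1 : q ^ (t * M + u - 1) * a ≠ 1 := fun h => hY (by rw [h, one_pow])
  have hgeom : (1 - q ^ (t * M + u - 1) * a)⁻¹ = ∑ s ∈ Finset.range M,
      (q ^ (t * M + u - 1) * a) ^ s * (1 - (q ^ (t * M + u - 1) * a) ^ M)⁻¹ := by
    rw [← Finset.sum_mul]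
    have h1 := sub_ne_zero.2 (Ne.symm hY)
    have h2 := sub_ne_zero.2 (Ne.symm hY1)
    rw [inv_eq_iff_eq_inv, mul_inv, inv_inv, eq_comm, inv_mul_eq_iff_eq_mul₀]
    · rw [← geom_sum_mul_neg]
    · intro h0
      rw [← geom_sum_mul_neg, h0, zero_mul] at h1
      exact h1 rfl
  rw [hgeom, Finset.mul_sum]
  refine Finset.sum_congr rfl fun s _ => ?_
  have e1 : (q ^ (t * M + u - 1) * a) ^ s
      = (q ^ ((u : ℤ) - 1) * a) ^ s * (q ^ ((M : ℤ) * s)) ^ t := by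
    rw [show t * M + u - 1 = ((u : ℤ) - 1) + t * M by ring, zpow_add₀ hq0, mul_pow, mul_pow,
      mul_pow, ← zpow_natCast (q ^ (t * (M : ℤ))) s, ← zpow_mul, ← zpow_mul]
    ring_nf
  have e2 : dissectArg w q M (u + s) = (-1) ^ (M + 1) * w ^ M * q ^ (binomTwo M + M * u) *
      q ^ ((M : ℤ) * s) := by
    rw [dissectArg, mul_assoc _ (q ^ _) (q ^ _), ← zpow_add₀ hq0]
    congr 2
    push_cast
    ring
  rw [e1, e2, mul_zpow _ (q ^ ((M : ℤ) * s)), zpow_natCast, zpow_natCast]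
  ring

/-- The theta factors of the dissection recombine. -/
theorem sum_jTheta_dissectArg {q a w : ℂ} (hq0 : q ≠ 0) (hq : ‖q‖ < 1) (hw : w ≠ 0)
    {M : ℕ} (hM : 0 < M) (s : ℕ) :
    ∑ u ∈ Finset.range M,
      ((-1) ^ u * q ^ binomTwo u * w ^ u * (q ^ ((u : ℤ) - 1) * a) ^ s) *
        jTheta (dissectArg w q M (u + s)) (q ^ (M ^ 2))
      = (-a / w) ^ s * q ^ (-binomTwo (s + 1)) * jTheta w q := by
  have hQ0 : q ^ (M ^ 2) ≠ 0 := pow_ne_zero _ hq0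
  have hQ := norm_pow_sq_lt_one hq hM
  have hws : w * q ^ (s : ℤ) ≠ 0 := mul_ne_zero hw (zpow_ne_zero _ hq0)
  have h1 := thetaSeries_dissect hq0 hq hws hM
  rw [thetaSeries_mul_zpow hq0 hw, ← jTheta_eq_thetaSeries hq0 hq hw] at h1
  have h2 : (-a / w) ^ s * q ^ (-binomTwo (s + 1)) * jTheta w q = (q⁻¹ * a) ^ s *
      ((-1) ^ (s : ℤ) * q ^ (-binomTwo s) * w ^ (-s : ℤ) * jTheta w q) := by
    rw [binomTwo_add_one, neg_add, zpow_add₀ hq0, zpow_neg w, zpow_neg q s, zpow_natCast,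
      zpow_natCast, zpow_natCast, mul_pow, div_pow, neg_pow, inv_pow]
    ring
  rw [h2, h1, Finset.mul_sum]
  refine Finset.sum_congr rfl fun u _ => ?_
  have e2 : dissectArg w q M (u + s)
      = (-1) ^ (M + 1) * (w * q ^ (s : ℤ)) ^ M * q ^ (binomTwo M + M * u) := by
    rw [dissectArg, mul_pow, ← zpow_natCast (q ^ (s : ℤ)) M, ← zpow_mul, mul_assoc, mul_assoc,
      mul_assoc, ← zpow_add₀ hq0]
    congr 3
    push_cast
    ring
  have e3 : dissectArg w q M (u + s) ≠ 0 := by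
    rw [e2]
    exact mul_ne_zero (mul_ne_zero (pow_ne_zero _ (by norm_num)) (pow_ne_zero _ hws))
      (zpow_ne_zero _ hq0)
  rw [jTheta_eq_thetaSeries hQ0 hQ e3, e2, zpow_sub_one₀ hq0]
  rw [zpow_natCast, zpow_natCast]
  simp only [mul_pow]
  ring

/-! ### Partitions without repeated odd parts in a box -/

/-- A multiset of positive integers without repeated odd members: the parts of a partition without
repeated odd parts. -/
def OddDistinct (s : Multiset ℕ) : Prop :=
  (∀ i ∈ s, 0 < i) ∧ ∀ i ∈ s, Odd i → s.count i ≤ 1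

/-- The height `⌈ℓ / 2⌉`, where `ℓ` is the largest part. -/
def halfHeight (s : Multiset ℕ) : ℕ := (s.sup + 1) / 2

theorem halfHeight_le_iff {s : Multiset ℕ} {k : ℕ} : halfHeight s ≤ k ↔ ∀ i ∈ s, i ≤ 2 * k := by
  rw [← Multiset.sup_le, halfHeight]
  omega

theorem oddDistinct_zero : OddDistinct 0 := by simp [OddDistinct]

theorem oddDistinct_cons_even {s : Multiset ℕ} {k : ℕ} :
    OddDistinct ((2 * k + 2) ::ₘ s) ↔ OddDistinct s := by
  have hodd : ∀ i, Odd i → i ≠ 2 * k + 2 := by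
    rintro i ⟨r, rfl⟩
    omega
  simp only [OddDistinct, Multiset.mem_cons, forall_eq_or_imp]
  constructor
  · rintro ⟨⟨_, h1⟩, _, h2⟩
    exact ⟨h1, fun i hi ho => by simpa [Multiset.count_cons_of_ne (hodd i ho)] using h2 i hi ho⟩
  · rintro ⟨h1, h2⟩
    refine ⟨⟨by omega, h1⟩, fun ho => absurd rfl (hodd _ ho), fun i hi ho => ?_⟩
    simpa [Multiset.count_cons_of_ne (hodd i ho)] using h2 i hi ho

theorem oddDistinct_cons_odd {s : Multiset ℕ} {k : ℕ} :
    OddDistinct ((2 * k + 1) ::ₘ s) ↔ OddDistinct s ∧ 2 * k + 1 ∉ s := by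
  simp only [OddDistinct, Multiset.mem_cons, forall_eq_or_imp]
  constructor
  · rintro ⟨⟨_, h1⟩, h0, h2⟩
    refine ⟨⟨h1, fun i hi ho => (Multiset.count_le_count_cons _ _ _).trans (h2 i hi ho)⟩, ?_⟩
    have := h0 ⟨k, rfl⟩
    rw [Multiset.count_cons_self] at this
    rw [← Multiset.count_eq_zero]
    omega
  · rintro ⟨⟨h1, h2⟩, h0⟩
    refine ⟨⟨by omega, h1⟩, fun _ => ?_, fun i hi ho => ?_⟩
    · rw [Multiset.count_cons_self, Multiset.count_eq_zero.2 h0]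
    · rw [Multiset.count_cons_of_ne fun h : i = 2 * k + 1 => h0 (h ▸ hi)]
      exact h2 i hi ho

/-- The partitions without repeated odd parts that have at most `j` parts, all at most `2 k`,
generated by removing a largest part, equal to `2 k` or to `2 k - 1`. -/
def boxed : ℕ → ℕ → Finset (Multiset ℕ)
  | 0, _ => {0}
  | _ + 1, 0 => {0}
  | k + 1, j + 1 => boxed k (j + 1) ∪ (boxed (k + 1) j).image (fun s => (2 * k + 2) ::ₘ s) ∪
      (boxed k j).image (fun s => (2 * k + 1) ::ₘ s)

theorem mem_boxed {k j : ℕ} {s : Multiset ℕ} :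
    s ∈ boxed k j ↔ OddDistinct s ∧ halfHeight s ≤ k ∧ s.card ≤ j := by
  rw [halfHeight_le_iff]
  induction k generalizing j s with
  | zero =>
    rw [boxed, Finset.mem_singleton]
    constructor
    · rintro rfl
      simp [oddDistinct_zero]
    · rintro ⟨h1, h2, _⟩
      refine Multiset.eq_zero_of_forall_notMem fun i hi => ?_
      have := h1.1 i hi
      have := h2 i hi
      omega
  | succ k ihk =>
    induction j generalizing s with
    | zero =>
      rw [boxed, Finset.mem_singleton]
      constructor
      · rintro rfl
        simp [oddDistinct_zero]
      · rintro ⟨_, _, h3⟩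
        exact Multiset.card_eq_zero.1 (Nat.le_zero.1 h3)
    | succ j ihj =>
      rw [boxed]
      simp only [Finset.mem_union, Finset.mem_image, ihk, ihj]
      constructor
      · rintro ((⟨h1, h2, h3⟩ | ⟨t, ⟨h1, h2, h3⟩, rfl⟩) | ⟨t, ⟨h1, h2, h3⟩, rfl⟩)
        · exact ⟨h1, fun i hi => (h2 i hi).trans (by omega), h3⟩
        · refine ⟨oddDistinct_cons_even.2 h1, fun i hi => ?_, by simpa using h3⟩
          rcases Multiset.mem_cons.1 hi with rfl | hi
          · omega
          · exact h2 i hi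
        · refine ⟨oddDistinct_cons_odd.2 ⟨h1, fun h => ?_⟩, fun i hi => ?_, by simpa using h3⟩
          · have := h2 _ h
            omega
          · rcases Multiset.mem_cons.1 hi with rfl | hi
            · omega
            · exact (h2 i hi).trans (by omega)
      · rintro ⟨h1, h2, h3⟩
        by_cases he : 2 * k + 2 ∈ s
        · obtain ⟨t, rfl⟩ := Multiset.exists_cons_of_mem he
          refine Or.inl (Or.inr ⟨t, ⟨oddDistinct_cons_even.1 h1, fun i hi =>
            h2 i (Multiset.mem_cons_of_mem hi), by simpa using h3⟩, rfl⟩)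
        by_cases ho : 2 * k + 1 ∈ s
        · obtain ⟨t, rfl⟩ := Multiset.exists_cons_of_mem ho
          obtain ⟨h4, h5⟩ := oddDistinct_cons_odd.1 h1
          refine Or.inr ⟨t, ⟨h4, fun i hi => ?_, by simpa using h3⟩, rfl⟩
          have h6 := h2 i (Multiset.mem_cons_of_mem hi)
          have h7 : i ≠ 2 * k + 1 := fun h => h5 (h ▸ hi)
          have h8 : i ≠ 2 * k + 2 := fun h => he (h ▸ Multiset.mem_cons_of_mem hi)
          omega
        · refine Or.inl (Or.inl ⟨h1, fun i hi => ?_, h3⟩)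
          have h6 := h2 i hi
          have h7 : i ≠ 2 * k + 1 := fun h => ho (h ▸ hi)
          have h8 : i ≠ 2 * k + 2 := fun h => he (h ▸ hi)
          omega

/-- The generating polynomial `∑ q ^ |λ|` of the partitions in a box. -/
def boxGF {R : Type*} [CommRing R] (q : R) (k j : ℕ) : R := ∑ s ∈ boxed k j, q ^ s.sum

section boxGF

variable {R : Type*} [CommRing R] (q : R)

@[simp] theorem boxGF_zero_left (j : ℕ) : boxGF q 0 j = 1 := by simp [boxGF, boxed]

@[simp] theorem boxGF_zero_right (k : ℕ) : boxGF q k 0 = 1 := by cases k <;> simp [boxGF, boxed]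

/-- Removal of a largest part. -/
theorem boxGF_succ_succ (k j : ℕ) : boxGF q (k + 1) (j + 1)
    = boxGF q k (j + 1) + q ^ (2 * k + 2) * boxGF q (k + 1) j + q ^ (2 * k + 1) * boxGF q k j := by
  have d1 : Disjoint (boxed k (j + 1)) ((boxed (k + 1) j).image fun s => (2 * k + 2) ::ₘ s) := by
    refine Finset.disjoint_left.2 fun s h1 h2 => ?_
    obtain ⟨t, _, rfl⟩ := Finset.mem_image.1 h2
    have := halfHeight_le_iff.1 (mem_boxed.1 h1).2.1 _ (Multiset.mem_cons_self _ _)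
    omega
  have d2 : Disjoint (boxed k (j + 1) ∪ (boxed (k + 1) j).image fun s => (2 * k + 2) ::ₘ s)
      ((boxed k j).image fun s => (2 * k + 1) ::ₘ s) := by
    refine Finset.disjoint_left.2 fun s h1 h2 => ?_
    obtain ⟨t, ht, rfl⟩ := Finset.mem_image.1 h2
    rcases Finset.mem_union.1 h1 with h1 | h1
    · have := halfHeight_le_iff.1 (mem_boxed.1 h1).2.1 _ (Multiset.mem_cons_self _ _)
      omega
    · obtain ⟨u, _, hu⟩ := Finset.mem_image.1 h1
      have h3 : 2 * k + 2 ∈ (2 * k + 1) ::ₘ t := hu ▸ Multiset.mem_cons_self _ _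
      rcases Multiset.mem_cons.1 h3 with h3 | h3
      · omega
      · have := halfHeight_le_iff.1 (mem_boxed.1 ht).2.1 _ h3
        omega
  have hinj : ∀ a : ℕ, Function.Injective fun s : Multiset ℕ => a ::ₘ s := fun a s t h =>
    (Multiset.cons_inj_right a).1 h
  rw [boxGF, boxed, Finset.sum_union d2, Finset.sum_union d1, Finset.sum_image (hinj _).injOn,
    Finset.sum_image (hinj _).injOn, boxGF, boxGF, boxGF, Finset.mul_sum, Finset.mul_sum]
  simp only [Multiset.sum_cons, pow_add]

theorem boxGF_succ_one (k : ℕ) :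
    boxGF q (k + 1) 1 = 1 + q ^ 2 * boxGF q k 1 + q := by
  induction k with
  | zero =>
    rw [boxGF_succ_succ]
    simp
  | succ k ih =>
    rw [boxGF_succ_succ]
    nth_rewrite 1 [ih]
    rw [boxGF_succ_succ q k]
    simp only [boxGF_zero_right]
    ring

theorem boxGF_one_succ (j : ℕ) :
    boxGF q 1 (j + 1) = boxGF q 1 j + q ^ (2 * j + 2) + q ^ (2 * j + 1) := by
  induction j with
  | zero =>
    rw [boxGF_succ_succ]
    simp
  | succ j ih =>
    rw [boxGF_succ_succ]
    nth_rewrite 1 [ih]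
    rw [boxGF_succ_succ q 0 j]
    simp only [boxGF_zero_left]
    ring

/-- The conjugate recurrence. Combinatorially it subtracts `2` from every part of a partition with
exactly `j + 1` parts, after removal of a part `1`; it follows from `boxGF_succ_succ` by
induction. -/
theorem boxGF_succ_succ' (k j : ℕ) : boxGF q (k + 1) (j + 1)
    = boxGF q (k + 1) j + q ^ (2 * j + 2) * boxGF q k (j + 1) + q ^ (2 * j + 1) * boxGF q k j := by
  induction k generalizing j with
  | zero => simpa using boxGF_one_succ q j
  | succ k ihk =>
    induction j with
    | zero => simpa using boxGF_succ_one q (k + 1)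
    | succ j ihj =>
      have a1 := boxGF_succ_succ q (k + 1) (j + 1)
      have a2 := boxGF_succ_succ q (k + 1) j
      have a3 := boxGF_succ_succ q k (j + 1)
      have a4 := boxGF_succ_succ q k j
      have b1 := ihk (j + 1)
      have b2 := ihk j
      linear_combination a1 - a2 + b1 + q ^ (2 * (k + 1) + 2) * ihj
        + q ^ (2 * (k + 1) + 1) * b2 - q ^ (2 * (j + 1) + 2) * a3 - q ^ (2 * (j + 1) + 1) * a4

theorem boxGF_comm (k j : ℕ) : boxGF q k j = boxGF q j k := by
  induction k generalizing j with
  | zero => simp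
  | succ k ihk =>
    induction j with
    | zero => simp
    | succ j ihj => rw [boxGF_succ_succ, boxGF_succ_succ', ihk, ihk, ihj]

/-- The generating polynomial of the partitions with height exactly `k` and exactly `j` parts. -/
def cellGF (q : R) (k j : ℕ) : R :=
  ∑ s ∈ boxed k j with halfHeight s = k ∧ s.card = j, q ^ s.sum

theorem boxGF_eq_sum (k j : ℕ) : boxGF q k j
    = ∑ k' ∈ Finset.range (k + 1), ∑ j' ∈ Finset.range (j + 1), cellGF q k' j' := by
  rw [boxGF, ← Finset.sum_product' (Finset.range (k + 1)) (Finset.range (j + 1)),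
    ← Finset.sum_fiberwise_of_maps_to (t := Finset.range (k + 1) ×ˢ Finset.range (j + 1))
      (g := fun s : Multiset ℕ => (halfHeight s, s.card))]
  · refine Finset.sum_congr rfl fun x hx => Finset.sum_congr ?_ fun _ _ => rfl
    have hx := Finset.mem_product.1 hx
    have h1 := Finset.mem_range.1 hx.1
    have h2 := Finset.mem_range.1 hx.2
    ext s
    simp only [Finset.mem_filter, mem_boxed, Prod.ext_iff]
    constructor
    · rintro ⟨⟨h, _, _⟩, h3, h4⟩
      exact ⟨⟨h, h3.le, h4.le⟩, h3, h4⟩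
    · rintro ⟨⟨h, _, _⟩, h3, h4⟩
      exact ⟨⟨h, by omega, by omega⟩, h3, h4⟩
  · intro s hs
    have := (mem_boxed.1 hs).2
    simp only [Finset.mem_product, Finset.mem_range]
    omega

theorem cellGF_comm (k j : ℕ) : cellGF q k j = cellGF q j k := by
  suffices H : ∀ n k j : ℕ, k + j = n → cellGF q k j = cellGF q j k from H _ k j rfl
  intro n
  induction n using Nat.strong_induction_on with
  | _ n ih =>
    intro k j hn
    have h := boxGF_comm q k j
    rw [boxGF_eq_sum, boxGF_eq_sum, Finset.sum_comm (s := Finset.range (j + 1)),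
      Finset.sum_range_succ, Finset.sum_range_succ, Finset.sum_range_succ _ k,
      Finset.sum_range_succ _ j] at h
    have e1 : ∑ x ∈ Finset.range k, ∑ y ∈ Finset.range (j + 1), cellGF q x y
        = ∑ x ∈ Finset.range k, ∑ y ∈ Finset.range (j + 1), cellGF q y x := by
      refine Finset.sum_congr rfl fun x hx => Finset.sum_congr rfl fun y hy => ?_
      have := Finset.mem_range.1 hx
      have := Finset.mem_range.1 hy
      exact ih (x + y) (by omega) x y rfl
    have e2 : ∑ y ∈ Finset.range j, cellGF q k y = ∑ y ∈ Finset.range j, cellGF q y k := by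
      refine Finset.sum_congr rfl fun y hy => ?_
      have := Finset.mem_range.1 hy
      exact ih (k + y) (by omega) k y rfl
    simp only [Finset.sum_range_succ] at h e1
    rw [e1, e2] at h
    exact add_left_cancel (add_left_cancel h)

end boxGF

theorem boxGF_mono_right {t : ℝ} (ht : 0 ≤ t) (k j : ℕ) : boxGF t k j ≤ boxGF t k (j + 1) := by
  refine Finset.sum_le_sum_of_subset_of_nonneg (fun s hs => ?_) fun _ _ _ => by positivity
  have := mem_boxed.1 hs
  exact mem_boxed.2 ⟨this.1, this.2.1, this.2.2.trans j.le_succ⟩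

theorem norm_boxGF_le (q : ℂ) (k j : ℕ) : ‖boxGF q k j‖ ≤ boxGF ‖q‖ k j :=
  (norm_sum_le _ _).trans_eq (by simp [boxGF])

/-- The generating polynomials of all boxes are bounded by
`∏ (1 + t ^ (2 i + 1)) / (1 - t ^ (2 i + 2))`. -/
theorem exists_boxGF_le {t : ℝ} (ht : 0 ≤ t) (ht1 : t < 1) :
    ∃ B : ℝ, 0 ≤ B ∧ ∀ k j : ℕ, boxGF t k j ≤ B := by
  have hstep : ∀ k j : ℕ, boxGF t (k + 1) j * (1 - t ^ (2 * k + 2))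
      ≤ boxGF t k j * (1 + t ^ (2 * k + 1)) := by
    intro k j
    have hp1 : t ^ (2 * k + 2) ≤ 1 := pow_le_one₀ ht ht1.le
    have hp2 : 0 ≤ t ^ (2 * k + 1) := by positivity
    rcases j with _ | j
    · have hp3 : 0 ≤ t ^ (2 * k + 2) := by positivity
      simp only [boxGF_zero_right]
      linarith
    · have h1 := mul_le_mul_of_nonneg_left (boxGF_mono_right ht (k + 1) j)
        (show 0 ≤ t ^ (2 * k + 2) by positivity)
      have h2 := mul_le_mul_of_nonneg_left (boxGF_mono_right ht k j) hp2
      have h3 := boxGF_succ_succ t k j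
      linarith
  -- The logarithm of the product is dominated by a geometric series.
  have hexp : ∀ k : ℕ, (1 + t ^ (2 * k + 1)) / (1 - t ^ (2 * k + 2))
      ≤ Real.exp (2 * (1 - t)⁻¹ * t ^ k) := by
    intro k
    have hk0 : 0 ≤ t ^ k := by positivity
    have h1 : t ^ (2 * k + 1) ≤ t ^ k := pow_le_pow_of_le_one ht ht1.le (by omega)
    have h2 : t ^ (2 * k + 2) ≤ t ^ k := pow_le_pow_of_le_one ht ht1.le (by omega)
    have h3 : t ^ (2 * k + 2) ≤ t := pow_le_of_le_one ht ht1.le (by omega)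
    have hpos : 0 < 1 - t ^ (2 * k + 2) := by linarith
    refine le_trans ?_ (Real.add_one_le_exp _)
    rw [div_le_iff₀ hpos]
    have h4 : 1 - t ≤ 1 - t ^ (2 * k + 2) := by linarith
    have h5 : 1 ≤ (1 - t)⁻¹ * (1 - t ^ (2 * k + 2)) := by
      rw [inv_mul_eq_div, le_div_iff₀ (by linarith)]
      linarith
    nlinarith [mul_le_mul_of_nonneg_left h5 hk0]
  have hbd : ∀ k j : ℕ, boxGF t k j
      ≤ Real.exp (2 * (1 - t)⁻¹ * ∑ i ∈ Finset.range k, t ^ i) := by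
    intro k j
    induction k with
    | zero => simp
    | succ k ih =>
      have h3 : t ^ (2 * k + 2) ≤ t := pow_le_of_le_one ht ht1.le (by omega)
      have hpos : 0 < 1 - t ^ (2 * k + 2) := by linarith
      rw [Finset.sum_range_succ, mul_add, Real.exp_add]
      calc boxGF t (k + 1) j
          ≤ boxGF t k j * ((1 + t ^ (2 * k + 1)) / (1 - t ^ (2 * k + 2))) := by
            rw [← mul_div_assoc, le_div_iff₀ hpos]
            exact hstep k j
        _ ≤ _ := mul_le_mul ih (hexp k) (by positivity) (Real.exp_pos _).le
  refine ⟨Real.exp (2 * (1 - t)⁻¹ * (1 - t)⁻¹), (Real.exp_pos _).le, fun k j =>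
    (hbd k j).trans (Real.exp_le_exp.2 (mul_le_mul_of_nonneg_left ?_ ?_))⟩
  · rw [← tsum_geometric_of_lt_one ht ht1]
    exact (summable_geometric_of_lt_one ht ht1).sum_le_tsum _ fun i _ => by positivity
  · have : 0 < 1 - t := by linarith
    positivity

/-! ### Generating functions over all partitions without repeated odd parts -/

/-- The `M₂`-rank of a partition, given by the multiset of its parts. -/
def rankOf (s : Multiset ℕ) : ℤ := (halfHeight s : ℤ) - s.card

open Classical in
/-- The contribution `q ^ |λ|` of a partition without repeated odd parts, and `0` for any other
multiset. -/
noncomputable def oddTerm (q : ℂ) (s : Multiset ℕ) : ℂ := if OddDistinct s then q ^ s.sum else 0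

theorem summable_norm_oddTerm {q : ℂ} (hq : ‖q‖ < 1) : Summable fun s => ‖oddTerm q s‖ := by
  classical
  obtain ⟨B, _, hB⟩ := exists_boxGF_le (norm_nonneg q) hq
  refine summable_of_sum_le (c := B) (fun _ => norm_nonneg _) fun u =>
    le_trans ?_ (hB (u.sup halfHeight) (u.sup Multiset.card))
  rw [boxGF]
  have h1 : ∑ s ∈ u, ‖oddTerm q s‖ = ∑ s ∈ u with OddDistinct s, ‖q‖ ^ s.sum := by
    rw [Finset.sum_filter]
    refine Finset.sum_congr rfl fun s _ => ?_
    rw [oddTerm]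
    split_ifs <;> simp
  rw [h1]
  refine Finset.sum_le_sum_of_subset_of_nonneg (fun s hs => ?_) fun _ _ _ => by positivity
  obtain ⟨h2, h3⟩ := Finset.mem_filter.1 hs
  exact mem_boxed.2 ⟨h3, Finset.le_sup h2, Finset.le_sup (f := Multiset.card) h2⟩

open Classical in
/-- The generating function `∑ q ^ |λ|` of the partitions without repeated odd parts that satisfy a
condition `P`. -/
noncomputable def oddGF (q : ℂ) (P : Multiset ℕ → Prop) : ℂ :=
  ∑' s, if P s then oddTerm q s else 0

open Classical in
theorem summable_norm_oddGF {q : ℂ} (hq : ‖q‖ < 1) (P : Multiset ℕ → Prop) :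
    Summable fun s => ‖if P s then oddTerm q s else 0‖ := by
  refine (summable_norm_oddTerm hq).of_nonneg_of_le (fun _ => norm_nonneg _) fun s => ?_
  split_ifs <;> simp

theorem norm_oddGF_le {q : ℂ} (hq : ‖q‖ < 1) (P : Multiset ℕ → Prop) :
    ‖oddGF q P‖ ≤ ∑' s, ‖oddTerm q s‖ := by
  classical
  have h : ∀ s, ‖if P s then oddTerm q s else 0‖ ≤ ‖oddTerm q s‖ := fun s => by
    by_cases hP : P s
    · simp [hP]
    · simp [hP]
  exact (norm_tsum_le_tsum_norm (summable_norm_oddGF hq P)).trans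
    ((summable_norm_oddGF hq P).tsum_le_tsum h (summable_norm_oddTerm hq))

theorem oddGF_congr (q : ℂ) {P Q : Multiset ℕ → Prop} (h : ∀ s, OddDistinct s → (P s ↔ Q s)) :
    oddGF q P = oddGF q Q := by
  refine tsum_congr fun s => ?_
  by_cases hs : OddDistinct s
  · have h1 := h s hs
    by_cases hP : P s
    · simp [hP, h1.1 hP]
    · simp [hP, mt h1.2 hP]
  · simp [oddTerm, hs]

theorem oddGF_add {q : ℂ} (hq : ‖q‖ < 1) {P Q R : Multiset ℕ → Prop}
    (h : ∀ s, OddDistinct s → (P s ↔ Q s ∨ R s)) (hd : ∀ s, OddDistinct s → ¬(Q s ∧ R s)) :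
    oddGF q P = oddGF q Q + oddGF q R := by
  classical
  rw [oddGF, oddGF, oddGF,
    ← (summable_norm_oddGF hq Q).of_norm.tsum_add (summable_norm_oddGF hq R).of_norm]
  refine tsum_congr fun s => ?_
  by_cases hs : OddDistinct s
  · have h1 := hd s hs
    have h2 := h s hs
    by_cases hQ : Q s <;> by_cases hR : R s <;> simp_all
  · simp [oddTerm, hs]

theorem oddGF_eq_sum (q : ℂ) {P : Multiset ℕ → Prop} {F : Finset (Multiset ℕ)}
    (h : ∀ s, s ∈ F ↔ OddDistinct s ∧ P s) : oddGF q P = ∑ s ∈ F, q ^ s.sum := by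
  rw [oddGF, tsum_eq_sum (s := F)]
  · refine Finset.sum_congr rfl fun s hs => ?_
    obtain ⟨h1, h2⟩ := (h s).1 hs
    simp [h2, oddTerm, h1]
  · intro s hs
    by_cases hs' : OddDistinct s
    · have : ¬P s := fun hP => hs ((h s).2 ⟨hs', hP⟩)
      simp [this]
    · simp [oddTerm, hs']

theorem hasSum_of_forall_eq {β : Type*} {f g : β → ℂ} {a : ℂ} (e : ∀ b, f b = g b)
    (h : HasSum f a) : HasSum g a :=
  funext e ▸ h

theorem hasSum_oddGF_fiber {q : ℂ} (hq : ‖q‖ < 1) (P : Multiset ℕ → Prop) {γ : Type*}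
    (g : Multiset ℕ → γ) : HasSum (fun c => oddGF q fun s => P s ∧ g s = c) (oddGF q P) := by
  classical
  have h := (summable_norm_oddGF hq P).of_norm.hasSum.tsum_fiberwise g
  refine hasSum_of_forall_eq (fun c => ?_) h
  rw [oddGF, tsum_subtype (g ⁻¹' {c}) fun s => if P s then oddTerm q s else 0]
  refine tsum_congr fun s => ?_
  by_cases h1 : g s = c <;> by_cases h2 : P s <;> simp [h1, h2, Set.indicator]

theorem oddGF_box (q : ℂ) (k j : ℕ) :
    oddGF q (fun s => halfHeight s ≤ k ∧ s.card ≤ j) = boxGF q k j :=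
  oddGF_eq_sum q fun _ => mem_boxed

theorem oddGF_cell (q : ℂ) (k j : ℕ) :
    oddGF q (fun s => halfHeight s = k ∧ s.card = j) = cellGF q k j := by
  refine oddGF_eq_sum q fun s => ?_
  rw [Finset.mem_filter, mem_boxed]
  constructor
  · exact fun h => ⟨h.1.1, h.2⟩
  · exact fun h => ⟨⟨h.1, h.2.1.le, h.2.2.le⟩, h.2⟩

theorem oddGF_height_eq {q : ℂ} (hq : ‖q‖ < 1) (k j : ℕ) :
    oddGF q (fun s => halfHeight s = k + 1 ∧ s.card ≤ j) = boxGF q (k + 1) j - boxGF q k j := by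
  rw [← oddGF_box, ← oddGF_box, eq_sub_iff_add_eq]
  refine (oddGF_add hq (fun s _ => ?_) fun s _ => ?_).symm <;> omega

theorem oddGF_card_eq {q : ℂ} (hq : ‖q‖ < 1) (k j : ℕ) :
    oddGF q (fun s => halfHeight s ≤ k ∧ s.card = j + 1) = boxGF q k (j + 1) - boxGF q k j := by
  rw [← oddGF_box, ← oddGF_box, eq_sub_iff_add_eq]
  refine (oddGF_add hq (fun s _ => ?_) fun s _ => ?_).symm <;> omega

@[simp] theorem halfHeight_zero : halfHeight 0 = 0 := by simp [halfHeight]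

theorem summable_pow_mul_boxGF {q : ℂ} (hq : ‖q‖ < 1) (c : ℕ) (f g : ℕ → ℕ) :
    Summable fun i : ℕ => q ^ (2 * i + c) * boxGF q (f i) (g i) := by
  obtain ⟨B, hB0, hB⟩ := exists_boxGF_le (norm_nonneg q) hq
  refine Summable.of_norm_bounded ((summable_geometric_of_lt_one (norm_nonneg q) hq).mul_right B)
    fun i => ?_
  rw [norm_mul, norm_pow]
  exact mul_le_mul (pow_le_pow_of_le_one (norm_nonneg q) hq.le (by omega))
    ((norm_boxGF_le q _ _).trans (hB _ _)) (norm_nonneg _) (by positivity)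

/-- The generating function of the nonempty partitions with `M₂`-rank at least `m`. -/
noncomputable def rankGE (q : ℂ) (m : ℕ) : ℂ := oddGF q fun s => s ≠ 0 ∧ (m : ℤ) ≤ rankOf s

theorem card_pos_iff_ne_zero {s : Multiset ℕ} : 0 < s.card ↔ s ≠ 0 := Multiset.card_pos

/-- A generating function form of Dyson's adjoint: nonempty partitions of rank at least `m`
correspond to partitions of rank at most `m + 1` whose size is smaller by `2 m + 1`. Both sides are
expanded by a single step of one of the two recurrences for boxes. -/
theorem rankGE_rec {q : ℂ} (hq : ‖q‖ < 1) (m : ℕ) :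
    rankGE q m = q ^ (2 * m + 1) * (oddGF q (fun _ => True) - rankGE q (m + 2)) := by
  have hR : HasSum (fun i : ℕ => q ^ (2 * (m + i) + 2) * boxGF q (m + i + 1) i
      + q ^ (2 * (m + i) + 1) * boxGF q (m + i) i) (rankGE q m) := by
    refine hasSum_of_forall_eq (fun i => ?_) (hasSum_oddGF_fiber hq
      (fun s => s ≠ 0 ∧ (m : ℤ) ≤ rankOf s) fun s => halfHeight s - (m + 1))
    have h1 := oddGF_height_eq hq (m + i) (i + 1)
    rw [boxGF_succ_succ] at h1
    rw [show ∀ a b c : ℂ, a + b + c - a = b + c by intros; ring] at h1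
    rw [← h1]
    refine oddGF_congr q fun s hs => ?_
    rw [← card_pos_iff_ne_zero, rankOf]
    have h2 : s.card = 0 → halfHeight s = 0 := fun h => by
      rw [Multiset.card_eq_zero.1 h, halfHeight_zero]
    omega
  have hW : oddGF q (fun s => rankOf s ≤ (m : ℤ) + 1)
      = oddGF q (fun _ => True) - rankGE q (m + 2) := by
    rw [eq_sub_iff_add_eq, rankGE]
    refine (oddGF_add hq (fun s _ => ?_) fun s _ => ?_).symm
    · have h2 : s = 0 → halfHeight s = 0 := fun h => by rw [h, halfHeight_zero]
      by_cases h0 : s = 0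
      · simp [h0, rankOf]
        omega
      · simp only [ne_eq, h0, not_false_eq_true, true_and, true_iff, rankOf]
        push_cast
        omega
    · push_cast
      omega
  have hW' : HasSum (fun j : ℕ => oddGF q fun s => rankOf s ≤ (m : ℤ) + 1 ∧ s.card = j)
      (oddGF q (fun s => rankOf s ≤ (m : ℤ) + 1)) := hasSum_oddGF_fiber hq _ Multiset.card
  have hW0 : (oddGF q fun s => rankOf s ≤ (m : ℤ) + 1 ∧ s.card = 0) = 1 := by
    rw [← boxGF_zero_right q (m + 1), ← oddGF_box]
    refine oddGF_congr q fun s _ => ?_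
    rw [rankOf]
    omega
  have hWj : ∀ j : ℕ, (oddGF q fun s => rankOf s ≤ (m : ℤ) + 1 ∧ s.card = j + 1)
      = q ^ (2 * j + 2) * boxGF q (m + j + 1) (j + 1) + q ^ (2 * j + 1) * boxGF q (m + j + 1) j := by
    intro j
    have h1 := oddGF_card_eq hq (m + j + 2) j
    rw [boxGF_succ_succ', show ∀ a b c : ℂ, a + b + c - a = b + c by intros; ring] at h1
    rw [← h1]
    refine oddGF_congr q fun s _ => ?_
    rw [rankOf]
    omega
  rw [← hW, ← hW'.tsum_eq, hW'.summable.tsum_eq_zero_add, hW0, ← hR.tsum_eq]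
  simp only [hWj]
  have sα : Summable fun i : ℕ => q ^ (2 * i + (2 * m + 1)) * boxGF q (m + i) i :=
    summable_pow_mul_boxGF hq _ _ _
  have sβ : Summable fun i : ℕ => q ^ (2 * i + (2 * m + 2)) * boxGF q (m + i + 1) i :=
    summable_pow_mul_boxGF hq _ _ _
  have e1 : ∑' i : ℕ, (q ^ (2 * (m + i) + 2) * boxGF q (m + i + 1) i
      + q ^ (2 * (m + i) + 1) * boxGF q (m + i) i)
      = ∑' i : ℕ, q ^ (2 * i + (2 * m + 2)) * boxGF q (m + i + 1) i
        + ∑' i : ℕ, q ^ (2 * i + (2 * m + 1)) * boxGF q (m + i) i := by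
    rw [← sβ.tsum_add sα]
    exact tsum_congr fun i => by ring
  rw [e1, sα.tsum_eq_zero_add, mul_add, ← tsum_mul_left,
    ← add_assoc, add_comm (tsum _) (_ * _), add_assoc,
    ← sβ.tsum_add ((summable_nat_add_iff 1).2 sα)]
  congr 1
  · simp
  · refine tsum_congr fun j => ?_
    rw [show m + (j + 1) = m + j + 1 by ring]
    ring

/-! ### Closed form of the rank generating functions -/

/-- The exponent `n (2 n - 1)` at `n + 1`. -/
def hexExp (n : ℕ) : ℕ := (n + 1) * (2 * n + 1)

theorem le_hexExp (n : ℕ) : n ≤ hexExp n := by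
  unfold hexExp
  nlinarith

/-- The partial theta series which multiplies the generating function of all partitions. -/
noncomputable def rankSeries (q : ℂ) (m : ℕ) : ℂ :=
  ∑' n : ℕ, (-1) ^ n * q ^ (hexExp n + 2 * (n + 1) * m)

theorem summable_rankSeries {q : ℂ} (hq : ‖q‖ < 1) (m : ℕ) :
    Summable fun n : ℕ => ‖(-1) ^ n * q ^ (hexExp n + 2 * (n + 1) * m)‖ := by
  refine (summable_geometric_of_lt_one (norm_nonneg q) hq).of_nonneg_of_le
    (fun _ => norm_nonneg _) fun n => ?_
  rw [norm_mul, norm_pow, norm_pow, norm_neg, norm_one, one_pow, one_mul]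
  exact pow_le_pow_of_le_one (norm_nonneg q) hq.le ((le_hexExp n).trans (Nat.le_add_right _ _))

theorem norm_rankSeries_le {q : ℂ} (hq : ‖q‖ < 1) (m : ℕ) :
    ‖rankSeries q m‖ ≤ (1 - ‖q‖)⁻¹ := by
  rw [← tsum_geometric_of_lt_one (norm_nonneg q) hq]
  refine (norm_tsum_le_tsum_norm (summable_rankSeries hq m)).trans
    ((summable_rankSeries hq m).tsum_le_tsum (fun n => ?_)
      (summable_geometric_of_lt_one (norm_nonneg q) hq))
  rw [norm_mul, norm_pow, norm_pow, norm_neg, norm_one, one_pow, one_mul]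
  exact pow_le_pow_of_le_one (norm_nonneg q) hq.le ((le_hexExp n).trans (Nat.le_add_right _ _))

theorem rankSeries_rec {q : ℂ} (hq : ‖q‖ < 1) (m : ℕ) :
    rankSeries q m = q ^ (2 * m + 1) * (1 - rankSeries q (m + 2)) := by
  rw [rankSeries, (summable_rankSeries hq m).of_norm.tsum_eq_zero_add, mul_sub, rankSeries,
    ← tsum_mul_left, sub_eq_add_neg, ← tsum_neg]
  congr 1
  · simp [hexExp]; ring
  · refine tsum_congr fun n => ?_
    have : hexExp (n + 1) + 2 * (n + 1 + 1) * m
        = (2 * m + 1) + (hexExp n + 2 * (n + 1) * (m + 2)) := by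
      unfold hexExp
      ring
    rw [this, pow_add q (2 * m + 1), pow_succ]
    ring

/-- The difference of the two sides is bounded uniformly in `m`, and `rankGE_rec` and `rankSeries_rec`
bound it at `m` by `|q|` times its value at `m + 2`; so it vanishes. -/
theorem rankGE_eq {q : ℂ} (hq : ‖q‖ < 1) (m : ℕ) :
    rankGE q m = oddGF q (fun _ => True) * rankSeries q m := by
  set P := oddGF q (fun _ => True) with hP
  obtain ⟨B, hB⟩ : ∃ B : ℝ, ∀ m, ‖rankGE q m - P * rankSeries q m‖ ≤ B := by
    refine ⟨∑' s, ‖oddTerm q s‖ + ‖P‖ * (1 - ‖q‖)⁻¹, fun m => (norm_sub_le _ _).trans ?_⟩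
    rw [norm_mul]
    exact add_le_add (norm_oddGF_le hq _)
      (mul_le_mul_of_nonneg_left (norm_rankSeries_le hq m) (norm_nonneg _))
  have hstep : ∀ n m, ‖rankGE q m - P * rankSeries q m‖ ≤ ‖q‖ ^ n * B := by
    intro n
    induction n with
    | zero => simpa using hB
    | succ n ih =>
      intro m
      have h : rankGE q m - P * rankSeries q m
          = -(q ^ (2 * m + 1) * (rankGE q (m + 2) - P * rankSeries q (m + 2))) := by
        rw [rankGE_rec hq m, rankSeries_rec hq m]
        ring
      rw [h, norm_neg, norm_mul, norm_pow, pow_succ' ‖q‖ n, mul_assoc]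
      refine mul_le_mul ?_ (ih (m + 2)) (norm_nonneg _) (norm_nonneg _)
      exact pow_le_of_le_one (norm_nonneg q) hq.le (by omega)
  have hlim : Tendsto (fun n : ℕ => ‖q‖ ^ n * B) atTop (𝓝 (0 * B)) :=
    (tendsto_pow_atTop_nhds_zero_of_lt_one (norm_nonneg q) hq).mul_const B
  rw [zero_mul] at hlim
  have h0 := ge_of_tendsto' hlim fun n => hstep n m
  exact sub_eq_zero.1 (norm_le_zero_iff.1 h0)

/-- The generating function of the partitions with a given `M₂`-rank. -/
noncomputable def rankEq (q : ℂ) (m : ℤ) : ℂ := oddGF q fun s => rankOf s = m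

/-- Conjugation, in the form `cellGF_comm`, exchanges the height and the number of parts. -/
theorem rankEq_neg {q : ℂ} (hq : ‖q‖ < 1) (m : ℕ) : rankEq q (-m) = rankEq q m := by
  have h1 : HasSum (fun j => cellGF q (j + m) j) (rankEq q m) := by
    refine hasSum_of_forall_eq (fun j => ?_) (hasSum_oddGF_fiber hq (fun s => rankOf s = m) Multiset.card)
    rw [← oddGF_cell]
    refine oddGF_congr q fun s _ => ?_
    rw [rankOf]
    omega
  have h2 : HasSum (fun k => cellGF q k (k + m)) (rankEq q (-m)) := by
    refine hasSum_of_forall_eq (fun j => ?_) (hasSum_oddGF_fiber hq (fun s => rankOf s = -m) halfHeight)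
    rw [← oddGF_cell]
    refine oddGF_congr q fun s _ => ?_
    rw [rankOf]
    omega
  simp only [cellGF_comm q _ (_ + m)] at h2
  exact h2.unique h1

theorem rankEq_succ {q : ℂ} (hq : ‖q‖ < 1) (m : ℕ) :
    rankEq q ((m : ℤ) + 1) = rankGE q (m + 1) - rankGE q (m + 2) := by
  rw [eq_sub_iff_add_eq, rankEq, rankGE, rankGE]
  refine (oddGF_add hq (fun s _ => ?_) fun s _ => ?_).symm
  · by_cases h0 : s = 0
    · simp [h0, rankOf]
      omega
    · simp only [ne_eq, h0, not_false_eq_true, true_and]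
      push_cast
      omega
  · push_cast
    omega

theorem rankEq_zero {q : ℂ} (hq : ‖q‖ < 1) : rankEq q 0 = 1 + rankGE q 0 - rankGE q 1 := by
  have h0 : oddGF q (fun s => s = 0) = 1 := by
    rw [← boxGF_zero_right q 0, ← oddGF_box]
    refine oddGF_congr q fun s _ => ?_
    constructor
    · rintro rfl
      simp
    · exact fun h => Multiset.card_eq_zero.1 (Nat.le_zero.1 h.2)
  have h1 : oddGF q (fun s => s = 0 ∨ 0 ≤ rankOf s) = 1 + rankGE q 0 := by
    rw [← h0, rankGE]
    refine oddGF_add hq (fun s _ => ?_) fun s _ => ?_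
    · by_cases h0 : s = 0 <;> simp [h0]
    · rintro ⟨h, h', _⟩
      exact h' h
  rw [eq_sub_iff_add_eq, ← h1, rankEq, rankGE]
  refine (oddGF_add hq (fun s _ => ?_) fun s _ => ?_).symm
  · by_cases h0 : s = 0
    · simp [h0, rankOf]
    · simp only [ne_eq, h0, not_false_eq_true, true_and, false_or]
      push_cast
      omega
  · push_cast
    omega

/-- The generating function `∑ ζ ^ rank q ^ |λ|` of the `M₂`-rank. -/
noncomputable def rankGF (ζ q : ℂ) : ℂ := ∑' s, ζ ^ rankOf s * oddTerm q s

theorem summable_norm_rankGF {ζ q : ℂ} (hζ : ‖ζ‖ = 1) (hq : ‖q‖ < 1) :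
    Summable fun s => ‖ζ ^ rankOf s * oddTerm q s‖ := by
  refine (summable_norm_oddTerm hq).congr fun s => ?_
  rw [norm_mul, norm_zpow, hζ, one_zpow, one_mul]

theorem hasSum_rankGF {ζ q : ℂ} (hζ : ‖ζ‖ = 1) (hq : ‖q‖ < 1) :
    HasSum (fun m : ℤ => ζ ^ m * rankEq q m) (rankGF ζ q) := by
  classical
  refine hasSum_of_forall_eq (fun m => ?_)
    ((summable_norm_rankGF hζ hq).of_norm.hasSum.tsum_fiberwise rankOf)
  rw [rankEq, oddGF, ← tsum_mul_left,
    tsum_subtype (rankOf ⁻¹' {m}) fun s => ζ ^ rankOf s * oddTerm q s]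
  refine tsum_congr fun s => ?_
  by_cases h : rankOf s = m <;> simp [h, Set.indicator]

theorem rankGF_one (q : ℂ) : rankGF 1 q = oddGF q fun _ => True := by
  simp [rankGF, oddGF]

/-- The summand of the rank generating functions that does not depend on the rank. -/
noncomputable def rankCoeff (q : ℂ) (n : ℕ) : ℂ :=
  (-1) ^ n * q ^ hexExp n * (1 - q ^ (2 * (n + 1)))

theorem norm_rankCoeff_le {q : ℂ} (hq : ‖q‖ < 1) (n : ℕ) : ‖rankCoeff q n‖ ≤ 2 * ‖q‖ ^ n := by
  rw [rankCoeff, norm_mul, norm_mul, norm_pow, norm_neg, norm_one, one_pow, one_mul, norm_pow,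
    mul_comm]
  refine mul_le_mul ?_ (pow_le_pow_of_le_one (norm_nonneg q) hq.le (le_hexExp n)) (by positivity)
    zero_le_two
  refine (norm_sub_le _ _).trans ?_
  have : ‖q‖ ^ (2 * (n + 1)) ≤ 1 := pow_le_one₀ (norm_nonneg q) hq.le
  rw [norm_one, norm_pow]
  linarith

theorem summable_norm_rankCoeff {q : ℂ} (hq : ‖q‖ < 1) : Summable fun n => ‖rankCoeff q n‖ :=
  ((summable_geometric_of_lt_one (norm_nonneg q) hq).mul_left 2).of_nonneg_of_le
    (fun _ => norm_nonneg _) (norm_rankCoeff_le hq)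

theorem rankSeries_sub {q : ℂ} (hq : ‖q‖ < 1) (m : ℕ) :
    rankSeries q m - rankSeries q (m + 1)
      = ∑' n : ℕ, rankCoeff q n * (q ^ (2 * (n + 1))) ^ m := by
  rw [rankSeries, rankSeries,
    ← (summable_rankSeries hq m).of_norm.tsum_sub (summable_rankSeries hq (m + 1)).of_norm]
  refine tsum_congr fun n => ?_
  rw [rankCoeff, ← pow_mul, mul_add (2 * (n + 1)) m 1, pow_add, pow_add, pow_add, mul_one]
  ring

/-- Interchange of summations in `∑ n, c n ∑ m, x n ^ (m + 1)`. -/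
theorem hasSum_tsum_mul_pow {c x : ℕ → ℂ} {r : ℝ} (hr : r < 1) (hc : Summable fun n => ‖c n‖)
    (hx : ∀ n, ‖x n‖ ≤ r) :
    HasSum (fun m : ℕ => ∑' n, c n * x n ^ (m + 1)) (∑' n, c n * (x n * (1 - x n)⁻¹)) ∧
      Summable fun n => c n * (x n * (1 - x n)⁻¹) := by
  have hr0 : 0 ≤ r := (norm_nonneg _).trans (hx 0)
  have hg := summable_geometric_of_lt_one hr0 hr
  have hgeo : ∀ n, HasSum (fun m : ℕ => c n * x n ^ (m + 1)) (c n * (x n * (1 - x n)⁻¹)) := by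
    intro n
    simp only [pow_succ']
    exact ((hasSum_geometric_of_norm_lt_one ((hx n).trans_lt hr)).mul_left _).mul_left _
  have hb : Summable fun z : ℕ × ℕ => ‖c z.1‖ * r ^ z.2 :=
    hc.mul_of_nonneg hg (fun n => norm_nonneg _) fun m => pow_nonneg hr0 m
  have hs : Summable fun z : ℕ × ℕ => c z.1 * x z.1 ^ (z.2 + 1) := by
    refine Summable.of_norm_bounded hb fun z => ?_
    rw [norm_mul, norm_pow]
    refine mul_le_mul_of_nonneg_left ?_ (norm_nonneg _)
    exact (pow_le_pow_left₀ (norm_nonneg _) (hx _) _).trans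
      (pow_le_pow_of_le_one hr0 hr.le (Nat.le_succ _))
  have h1 := hs.hasSum.prod_fiberwise hgeo
  have h2 := hs.prod_symm.hasSum.prod_fiberwise fun m => (hs.prod_symm.prod_factor m).hasSum
  refine ⟨?_, h1.summable⟩
  rw [h1.tsum_eq, ← (Equiv.prodComm ℕ ℕ).tsum_eq]
  exact h2

/-- The closed form of the rank generating functions, summed over all ranks as geometric series. -/
theorem rankGF_eq_tsum {ζ q : ℂ} (hζ : ‖ζ‖ = 1) (hq : ‖q‖ < 1) :
    rankGF ζ q = 1 + oddGF q (fun _ => True) * ∑' n : ℕ, rankCoeff q n *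
      (1 + ζ * q ^ (2 * (n + 1)) * (1 - ζ * q ^ (2 * (n + 1)))⁻¹
        + ζ⁻¹ * q ^ (2 * (n + 1)) * (1 - ζ⁻¹ * q ^ (2 * (n + 1)))⁻¹) := by
  set P := oddGF q (fun _ => True) with hP
  have hsC := summable_norm_rankCoeff hq
  have hx : ∀ ξ : ℂ, ‖ξ‖ = 1 → ∀ n : ℕ, ‖ξ * q ^ (2 * (n + 1))‖ ≤ ‖q‖ := fun ξ hξ n => by
    rw [norm_mul, hξ, one_mul, norm_pow]
    exact pow_le_of_le_one (norm_nonneg q) hq.le (by omega)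
  have hx1 := hx ζ hζ
  have hx2 := hx ζ⁻¹ (by rw [norm_inv, hζ, inv_one])
  obtain ⟨a1, b1⟩ := hasSum_tsum_mul_pow hq hsC hx1
  obtain ⟨a2, b2⟩ := hasSum_tsum_mul_pow hq hsC hx2
  have h := (hasSum_rankGF hζ hq).nat_add_neg
  have h1 := (hasSum_nat_add_iff' 1).2 h
  simp only [Finset.range_one, Finset.sum_singleton, Nat.cast_zero, neg_zero, zpow_zero,
    one_mul] at h1
  have hC0 : rankEq q 0 = 1 + P * ∑' n : ℕ, rankCoeff q n := by
    rw [rankEq_zero hq, rankGE_eq hq, rankGE_eq hq]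
    have := rankSeries_sub hq 0
    simp only [pow_zero, mul_one, zero_add] at this
    rw [← this]
    ring
  have hCm : ∀ m : ℕ, ζ ^ (((m + 1 : ℕ) : ℤ)) * rankEq q ((m + 1 : ℕ) : ℤ)
      + ζ ^ (-((m + 1 : ℕ) : ℤ)) * rankEq q (-((m + 1 : ℕ) : ℤ))
      = P * (∑' n : ℕ, rankCoeff q n * (ζ * q ^ (2 * (n + 1))) ^ (m + 1)
        + ∑' n : ℕ, rankCoeff q n * (ζ⁻¹ * q ^ (2 * (n + 1))) ^ (m + 1)) := by
    intro m
    have e : rankEq q ((m + 1 : ℕ) : ℤ)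
        = P * ∑' n : ℕ, rankCoeff q n * (q ^ (2 * (n + 1))) ^ (m + 1) := by
      rw [← rankSeries_sub hq, Nat.cast_add, Nat.cast_one]
      rw [rankEq_succ hq, rankGE_eq hq, rankGE_eq hq, ← mul_sub]
    have e' : ∀ ξ : ℂ, ∑' n : ℕ, rankCoeff q n * (ξ * q ^ (2 * (n + 1))) ^ (m + 1)
        = ξ ^ (m + 1) * ∑' n : ℕ, rankCoeff q n * (q ^ (2 * (n + 1))) ^ (m + 1) := fun ξ => by
      rw [← tsum_mul_left]
      exact tsum_congr fun n => by rw [mul_pow, mul_left_comm]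
    rw [rankEq_neg hq, e, zpow_neg, zpow_natCast, e', e', inv_pow]
    ring
  have h2 := h1.unique (hasSum_of_forall_eq (fun m => (hCm m).symm) ((a1.add a2).mul_left P))
  have h3 := ((hsC.of_norm.hasSum.add b1.hasSum).add b2.hasSum).tsum_eq
  rw [tsum_congr fun n => show rankCoeff q n *
      (1 + ζ * q ^ (2 * (n + 1)) * (1 - ζ * q ^ (2 * (n + 1)))⁻¹
        + ζ⁻¹ * q ^ (2 * (n + 1)) * (1 - ζ⁻¹ * q ^ (2 * (n + 1)))⁻¹)
      = rankCoeff q n + rankCoeff q n * (ζ * q ^ (2 * (n + 1)) * (1 - ζ * q ^ (2 * (n + 1)))⁻¹)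
        + rankCoeff q n * (ζ⁻¹ * q ^ (2 * (n + 1)) * (1 - ζ⁻¹ * q ^ (2 * (n + 1)))⁻¹) by ring, h3]
  linear_combination h2 + hC0

theorem sum_range_two (f : ℕ → ℂ) : ∑ u ∈ Finset.range 2, f u = f 0 + f 1 := by
  simp [Finset.sum_range_succ]

/-! ### The rank generating function as an Appell–Lerch series -/

/-- The substitution `q = -p` removes the alternating signs. -/
theorem neg_pow_hexExp (p : ℂ) (n : ℕ) : (-1) ^ n * (-p) ^ hexExp n = -p ^ hexExp n := by
  have h1 : (-1 : ℂ) ^ hexExp n = (-1) ^ (n + 1) := by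
    rw [hexExp, show (n + 1) * (2 * n + 1) = 2 * (n * (n + 1)) + (n + 1) by ring, pow_add, pow_mul]
    simp
  rw [neg_pow p (hexExp n), h1, ← mul_assoc, pow_succ, ← mul_assoc, ← mul_pow]
  simp

theorem rankCoeff_neg (p : ℂ) (n : ℕ) :
    rankCoeff (-p) n = -(p ^ hexExp n * (1 - p ^ (2 * (n + 1)))) := by
  rw [rankCoeff, neg_pow_hexExp, (even_two_mul (n + 1)).neg_pow]
  ring

theorem binomTwo_two_mul (t : ℤ) : binomTwo (t * (2 : ℕ) + (0 : ℕ)) = -t * (2 * -t + 1) := by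
  apply binomTwo_eq_of_two_mul
  push_cast
  ring

theorem binomTwo_two_mul_add_one (t : ℤ) :
    binomTwo (t * (2 : ℕ) + (1 : ℕ)) = t * (2 * t + 1) := by
  apply binomTwo_eq_of_two_mul
  push_cast
  ring

theorem summable_zpow_hex {p : ℂ} (hp0 : p ≠ 0) (hp : ‖p‖ < 1) :
    Summable fun t : ℤ => ‖p ^ (t * (2 * t + 1))‖ := by
  refine ((summable_norm_theta hp0 hp 1).comp_injective
    (i := fun t : ℤ => t * (2 : ℕ) + (1 : ℕ)) fun a b h => by simpa using h).congr fun t => ?_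
  simp only [Function.comp_apply, binomTwo_two_mul_add_one]
  simp

/-- A series over all integers with weights `p ^ (t (2 t + 1))`, folded at `t = 0`. -/
theorem tsum_zpow_hex {p : ℂ} (hp0 : p ≠ 0) {g : ℤ → ℂ} {B : ℝ} (hp : ‖p‖ < 1)
    (hg : ∀ t, ‖g t‖ ≤ B) : HasSum (fun n : ℕ => p ^ hexExp n *
        (p ^ (2 * (n + 1)) * g (n + 1) + g (-(n + 1))))
      (∑' t : ℤ, p ^ (t * (2 * t + 1)) * g t - g 0) := by
  have hs : Summable fun t : ℤ => p ^ (t * (2 * t + 1)) * g t := by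
    refine Summable.of_norm_bounded ((summable_zpow_hex hp0 hp).mul_right B) fun t => ?_
    rw [norm_mul]
    exact mul_le_mul_of_nonneg_left (hg t) (norm_nonneg _)
  have h := hs.hasSum.nat_add_neg
  have h1 := (hasSum_nat_add_iff' 1).2 h
  simp only [Finset.range_one, Finset.sum_singleton, Nat.cast_zero, neg_zero, zero_mul, zpow_zero,
    one_mul] at h1
  rw [add_sub_add_right_eq_sub] at h1
  refine hasSum_of_forall_eq (fun n => ?_) h1
  have e1 : p ^ (((n + 1 : ℕ) : ℤ) * (2 * ((n + 1 : ℕ) : ℤ) + 1))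
      = p ^ hexExp n * p ^ (2 * (n + 1)) := by
    rw [← pow_add, ← zpow_natCast]
    congr 1
    unfold hexExp
    push_cast
    ring
  have e2 : p ^ (-((n + 1 : ℕ) : ℤ) * (2 * -((n + 1 : ℕ) : ℤ) + 1)) = p ^ hexExp n := by
    rw [← zpow_natCast]
    congr 1
  rw [e1, e2]
  push_cast
  ring

theorem thetaSeries_neg_one {p : ℂ} (hp0 : p ≠ 0) (hp : ‖p‖ < 1) :
    HasSum (fun n : ℕ => p ^ hexExp n * (p ^ (2 * (n + 1)) + 1)) (thetaSeries (-1) p / 2 - 1) := by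
  have h := tsum_zpow_hex hp0 (g := fun _ => 1) (B := 1) hp (by simp)
  simp only [mul_one] at h
  convert h using 2
  rw [thetaSeries, tsum_int_dissect (summable_norm_theta hp0 hp (-1)).of_norm two_pos,
    sum_range_two]
  have hneg : ∀ r : ℤ, (-1 : ℂ) ^ r * p ^ binomTwo r * (-1) ^ r = p ^ binomTwo r := fun r => by
    rw [mul_right_comm, ← mul_zpow]
    simp
  simp only [hneg]
  simp only [binomTwo_two_mul, binomTwo_two_mul_add_one]
  have := (Equiv.neg ℤ).tsum_eq fun t : ℤ => p ^ (t * (2 * t + 1))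
  simp only [Equiv.neg_apply] at this
  rw [this]
  ring

theorem lerchSeries_neg_one_sub {p ζ : ℂ} (hp0 : p ≠ 0) (hp : ‖p‖ < 1) (hζ : ζ ≠ 0) :
    lerchSeries ζ (-1) p - lerchSeries ζ 1 p
      = 2 * ∑' t : ℤ, p ^ (t * (2 * t + 1)) * (1 - p ^ (2 * t) * ζ)⁻¹ := by
  have s1 := (summable_norm_lerch hp0 hp hζ (-1)).of_norm
  have s2 := (summable_norm_lerch hp0 hp hζ 1).of_norm
  rw [lerchSeries, lerchSeries, ← s1.tsum_sub s2, tsum_int_dissect (s1.sub s2) two_pos,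
    sum_range_two, ← tsum_mul_left]
  have h0 : ∀ t : ℤ, (-1 : ℂ) ^ (t * (2 : ℕ) + (0 : ℕ)) = 1 := fun t => by
    rw [Nat.cast_zero, add_zero, mul_comm, zpow_mul]
    simp
  have h1 : ∀ t : ℤ, (-1 : ℂ) ^ (t * (2 : ℕ) + (1 : ℕ)) = -1 := fun t => by
    rw [zpow_add₀ (by norm_num), mul_comm, mul_comm t, zpow_mul]
    simp
  simp only [h0, h1, one_zpow, one_mul, mul_one, sub_self, tsum_zero, zero_add,
    binomTwo_two_mul_add_one]
  refine tsum_congr fun t => ?_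
  rw [show t * ((2 : ℕ) : ℤ) + ((1 : ℕ) : ℤ) - 1 = 2 * t by push_cast; ring]
  ring

theorem ne_zpow_of_norm_eq_one {p ζ : ℂ} (hp : ‖p‖ < 1) (hζ : ‖ζ‖ = 1)
    (hζ1 : ζ ≠ 1) (k : ℤ) : ζ ≠ p ^ k := by
  rintro rfl
  rw [norm_zpow] at hζ
  have hk : k = 0 := by
    by_contra hk
    rw [zpow_eq_one_iff_right₀ (norm_nonneg p) hp.ne] at hζ
    exact hk hζ
  rw [hk, zpow_zero] at hζ1
  exact hζ1 rfl

theorem one_sub_mul_pow_ne_zero {p ζ : ℂ} (hp : ‖p‖ < 1) (hζ : ‖ζ‖ = 1) (n : ℕ) :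
    1 - ζ * p ^ (2 * (n + 1)) ≠ 0 := by
  intro h
  have h1 : ‖ζ * p ^ (2 * (n + 1))‖ = 1 := by rw [← sub_eq_zero.1 h, norm_one]
  rw [norm_mul, hζ, one_mul, norm_pow] at h1
  exact (pow_lt_one₀ (norm_nonneg p) hp (by omega)).ne h1

/-- The case `ζ = 1`, in which the rank generating function is the generating function itself, yields
its product formula. -/
theorem oddGF_mul_jTheta {p : ℂ} (hp0 : p ≠ 0) (hp : ‖p‖ < 1) :
    oddGF (-p) (fun _ => True) * jTheta (-1) p = 2 := by
  rw [jTheta_eq_thetaSeries hp0 hp (by norm_num)]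
  have h := rankGF_eq_tsum (ζ := 1) (q := -p) norm_one (by rwa [norm_neg])
  have h2 : ∑' n : ℕ, rankCoeff (-p) n *
      (1 + 1 * (-p) ^ (2 * (n + 1)) * (1 - 1 * (-p) ^ (2 * (n + 1)))⁻¹
        + 1⁻¹ * (-p) ^ (2 * (n + 1)) * (1 - 1⁻¹ * (-p) ^ (2 * (n + 1)))⁻¹)
      = -(thetaSeries (-1) p / 2 - 1) := by
    rw [← (thetaSeries_neg_one hp0 hp).tsum_eq, ← tsum_neg]
    refine tsum_congr fun n => ?_
    have hne := one_sub_mul_pow_ne_zero hp norm_one n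
    rw [one_mul] at hne
    rw [rankCoeff_neg, (even_two_mul (n + 1)).neg_pow, inv_one, one_mul]
    field_simp
    ring
  rw [rankGF_one, h2] at h
  linear_combination 2 * h

/-- The rank generating function at `ζ` on the unit circle as a difference of two Appell–Lerch series;
the summands with even index cancel in that difference. -/
theorem rankGF_mul_jTheta {p ζ : ℂ} (hp0 : p ≠ 0) (hp : ‖p‖ < 1) (hζ : ‖ζ‖ = 1) (hζ1 : ζ ≠ 1) :
    rankGF ζ (-p) * jTheta (-1) p = (1 - ζ) * (lerchSeries ζ (-1) p - lerchSeries ζ 1 p) := by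
  have hζ0 : ζ ≠ 0 := norm_ne_zero_iff.1 (by rw [hζ]; exact one_ne_zero)
  have hP := oddGF_mul_jTheta hp0 hp
  have h := rankGF_eq_tsum (q := -p) hζ (by rwa [norm_neg])
  rw [lerchSeries_neg_one_sub hp0 hp hζ0, h, add_mul, mul_right_comm, hP]
  have hj := jTheta_eq_thetaSeries hp0 hp (neg_ne_zero.2 one_ne_zero)
  have ht := thetaSeries_neg_one hp0 hp
  rw [← hj] at ht
  obtain ⟨B, hB⟩ := exists_bound_one_sub_zpow hp0 hp hζ0
  have hl := tsum_zpow_hex hp0 (g := fun t => (1 - p ^ (2 * t) * ζ)⁻¹) hp fun t => hB (2 * t)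
  simp only [mul_zero, zpow_zero, one_mul] at hl
  have key : HasSum (fun n : ℕ => rankCoeff (-p) n *
      (1 + ζ * (-p) ^ (2 * (n + 1)) * (1 - ζ * (-p) ^ (2 * (n + 1)))⁻¹
        + ζ⁻¹ * (-p) ^ (2 * (n + 1)) * (1 - ζ⁻¹ * (-p) ^ (2 * (n + 1)))⁻¹)) _ :=
    hasSum_of_forall_eq (fun n => ?_) ((hl.mul_left (1 - ζ)).sub ht)
  · rw [key.tsum_eq]
    have : 1 - ζ ≠ 0 := sub_ne_zero.2 (Ne.symm hζ1)
    field_simp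
    ring
  · have n1 := one_sub_mul_pow_ne_zero hp hζ n
    have n2 := one_sub_mul_pow_ne_zero (ζ := ζ⁻¹) hp (by rw [norm_inv, hζ, inv_one]) n
    rw [rankCoeff_neg, (even_two_mul (n + 1)).neg_pow]
    have e1 : p ^ (2 * ((n : ℤ) + 1)) = p ^ (2 * (n + 1)) := by
      rw [← zpow_natCast]
      push_cast
      rfl
    have e2 : p ^ (2 * -((n : ℤ) + 1)) = (p ^ (2 * (n + 1)))⁻¹ := by
      rw [mul_neg, zpow_neg, e1]
    rw [e1, e2]
    have hQ0 : p ^ (2 * (n + 1)) ≠ 0 := pow_ne_zero _ hp0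
    generalize p ^ (2 * (n + 1)) = Q at n1 n2 hQ0
    have n3 : ζ - Q ≠ 0 := by
      intro h
      apply n2
      rw [← sub_eq_zero.1 h]
      simp [hζ0]
    have n4 : Q - ζ ≠ 0 := by
      rw [← neg_sub]
      exact neg_ne_zero.2 n3
    have f1 : (1 - ζ⁻¹ * Q)⁻¹ = ζ / (ζ - Q) := by
      rw [inv_eq_one_div, div_eq_div_iff n2 n3]
      field_simp
    have f2 : (1 - Q⁻¹ * ζ)⁻¹ = -Q / (ζ - Q) := by
      have : 1 - Q⁻¹ * ζ = (Q - ζ) / Q := by field_simp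
      rw [this, inv_div, div_eq_div_iff n4 n3]
      ring
    rw [f1, f2, mul_comm Q ζ]
    field_simp
    ring

/-! ### From multisets to partitions of `n` -/

theorem ceil_half (n : ℕ) : ⌈(n : ℚ) / 2⌉ = (((n + 1) / 2 : ℕ) : ℤ) := by
  rw [Int.ceil_eq_iff]
  have h3 : ((n + 1) / 2 : ℕ) * 2 ≤ n + 1 := Nat.div_mul_le_self _ _
  have h4 : n ≤ ((n + 1) / 2 : ℕ) * 2 := by omega
  generalize (n + 1) / 2 = k at h3 h4
  have h5 : (k : ℚ) * 2 ≤ n + 1 := by exact_mod_cast h3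
  have h6 : (n : ℚ) ≤ (k : ℚ) * 2 := by exact_mod_cast h4
  rw [Int.cast_natCast]
  constructor <;> linarith

theorem mTwoRank_eq {n : ℕ} (p : n.Partition) : mTwoRank p = rankOf p.parts := by
  rw [mTwoRank, rankOf, ceil_half]
  rfl

theorem noRepeatedOddParts_iff {n : ℕ} (p : n.Partition) :
    NoRepeatedOddParts p ↔ OddDistinct p.parts :=
  ⟨fun h => ⟨fun _ hi => p.parts_pos hi, h⟩, fun h => h.2⟩

theorem hasSum_rankGF_partition {ζ q : ℂ} (hζ : ‖ζ‖ = 1) (hq : ‖q‖ < 1) :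
    HasSum (fun n : ℕ => (∑ p : n.Partition with NoRepeatedOddParts p, ζ ^ mTwoRank p) * q ^ n)
      (rankGF ζ q) := by
  classical
  refine hasSum_of_forall_eq (fun n => ?_)
    ((summable_norm_rankGF hζ hq).of_norm.hasSum.tsum_fiberwise Multiset.sum)
  rw [tsum_subtype (Multiset.sum ⁻¹' {n}) fun s => ζ ^ rankOf s * oddTerm q s,
    tsum_eq_sum (s := (Finset.univ.filter fun p : n.Partition => NoRepeatedOddParts p).image
      Nat.Partition.parts), Finset.sum_image fun a _ b _ h => Nat.Partition.ext h, Finset.sum_mul]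
  · refine Finset.sum_congr rfl fun p hp => ?_
    have h1 := (noRepeatedOddParts_iff p).1 (Finset.mem_filter.1 hp).2
    rw [Set.indicator_of_mem (by simp [p.parts_sum]), oddTerm, if_pos h1, p.parts_sum,
      mTwoRank_eq]
  · intro s hs
    by_cases h1 : s ∈ Multiset.sum ⁻¹' {n}
    · rw [Set.indicator_of_mem h1]
      by_cases h2 : OddDistinct s
      · refine absurd (Finset.mem_image.2 ⟨(⟨s, fun {i} hi => h2.1 i hi, h1⟩ : n.Partition), ?_, rfl⟩) hs
        exact Finset.mem_filter.2 ⟨Finset.mem_univ _, (noRepeatedOddParts_iff _).2 h2⟩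
      · rw [oddTerm, if_neg h2, mul_zero]
    · rw [Set.indicator_of_notMem h1]

/-! ### Rank deviations by orthogonality of roots of unity -/

theorem sum_pow_root_of_unity {ω : ℂ} {M : ℕ} (hω : IsPrimitiveRoot ω M)
    (d : ℤ) : ∑ k ∈ Finset.range M, (ω ^ d) ^ k = if (M : ℤ) ∣ d then (M : ℂ) else 0 := by
  split_ifs with h
  · rw [(hω.zpow_eq_one_iff_dvd d).2 h]
    simp
  · have h1 : ω ^ d ≠ 1 := fun h1 => h ((hω.zpow_eq_one_iff_dvd d).1 h1)
    have h2 : (ω ^ d) ^ M = 1 := by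
      rw [← zpow_natCast, ← zpow_mul, mul_comm, zpow_mul, zpow_natCast, hω.pow_eq_one, one_zpow]
    rw [geom_sum_eq h1, h2, sub_self, zero_div]

theorem deviationCoeff_eq {ω : ℂ} {M : ℕ} (hM : 0 < M) (hω : IsPrimitiveRoot ω M) (a n : ℕ) :
    deviationCoeff a M n = (1 / M : ℂ) * ∑ k ∈ (Finset.range M).erase 0,
      (ω ^ k) ^ (-(a : ℤ)) * ∑ p : n.Partition with NoRepeatedOddParts p, (ω ^ k) ^ mTwoRank p := by
  have hM0 : (M : ℂ) ≠ 0 := Nat.cast_ne_zero.2 hM.ne'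
  have hω0 : ω ≠ 0 := hω.ne_zero hM.ne'
  have hcount : (countNTwo a M n : ℂ) = ∑ p : n.Partition with NoRepeatedOddParts p,
      if (M : ℤ) ∣ mTwoRank p - a then (1 : ℂ) else 0 := by
    rw [Finset.sum_boole, countNTwo, Finset.filter_filter]
    congr 2
    ext p
    simp only [Finset.mem_filter, Finset.mem_univ, true_and]
    rw [Int.modEq_comm, Int.modEq_iff_dvd]
  have hswap : ∀ k : ℕ, (ω ^ k) ^ (-(a : ℤ)) *
      ∑ p : n.Partition with NoRepeatedOddParts p, (ω ^ k) ^ mTwoRank p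
      = ∑ p : n.Partition with NoRepeatedOddParts p, (ω ^ (mTwoRank p - a)) ^ k := by
    intro k
    rw [Finset.mul_sum]
    refine Finset.sum_congr rfl fun p _ => ?_
    rw [← zpow_add₀ (pow_ne_zero k hω0), ← zpow_natCast ω k, ← zpow_natCast (ω ^ _) k, ← zpow_mul,
      ← zpow_mul]
    congr 1
    ring
  have h0 : (0 : ℕ) ∈ Finset.range M := Finset.mem_range.2 hM
  simp only [hswap]
  rw [Finset.sum_comm, deviationCoeff, hcount, countPo, Finset.card_eq_sum_ones, Nat.cast_sum,
    Finset.sum_div, ← Finset.sum_sub_distrib, Finset.mul_sum]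
  refine Finset.sum_congr rfl fun p _ => ?_
  have h1 := Finset.sum_erase_add (Finset.range M) (fun k => (ω ^ (mTwoRank p - a)) ^ k) h0
  rw [sum_pow_root_of_unity hω, pow_zero] at h1
  rw [eq_sub_of_add_eq h1]
  split_ifs
  · push_cast
    field_simp
  · push_cast
    field_simp
    ring

theorem hasSum_deviation {ω q : ℂ} {M : ℕ} (hM : 0 < M) (hω : IsPrimitiveRoot ω M) (hq : ‖q‖ < 1)
    (a : ℕ) : HasSum (fun n : ℕ => deviationCoeff a M n * q ^ n) ((1 / M : ℂ) *
      ∑ k ∈ (Finset.range M).erase 0, (ω ^ k) ^ (-(a : ℤ)) * rankGF (ω ^ k) q) := by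
  have hn : ∀ k : ℕ, ‖ω ^ k‖ = 1 := fun k => by
    rw [norm_pow, hω.norm'_eq_one hM.ne', one_pow]
  refine hasSum_of_forall_eq (fun n => ?_) ((hasSum_sum fun k (_ : k ∈ (Finset.range M).erase 0) =>
    (hasSum_rankGF_partition (hn k) hq).mul_left ((ω ^ k) ^ (-(a : ℤ)))).mul_left (1 / M : ℂ))
  rw [deviationCoeff_eq hM hω, mul_assoc, Finset.sum_mul]
  congr 1
  exact Finset.sum_congr rfl fun k _ => by ring

/-! ### Two transformations of the Appell–Lerch sum -/

/-- The theta quotient by which two Appell–Lerch sums `m(x, q, z)` and `m(x, q, z')` differ,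
multiplied by `j(z'; q)`. -/
noncomputable def thetaChange (x q z z' : ℂ) : ℂ :=
  z * qPochInf q q ^ 3 * jTheta (z' / z) q * jTheta (x * z * z') q
    / (jTheta z q * jTheta (x * z) q * jTheta (x * z') q)

/-- The change of the third argument from `z` to `z'`, multiplied out by `j(z'; q)`, so that `z'` may be
a power of `q`. -/
theorem lerchSeries_eq_appellLerch_mul {x q z z' : ℂ} (hq0 : q ≠ 0) (hq : ‖q‖ < 1) (hx : x ≠ 0)
    (hz : z ≠ 0) (hz' : z' ≠ 0) (h : ∀ k : ℤ, z ≠ q ^ k) (hxz : ∀ k : ℤ, x * z ≠ q ^ k)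
    (hxz' : ∀ k : ℤ, x * z' ≠ q ^ k) :
    lerchSeries (x * z') z' q = appellLerch x q z * jTheta z' q + thetaChange x q z z' := by
  have hj := jTheta_ne_zero hq0 hq hz h
  have hc := lerchSeries_change (t := x⁻¹) hq0 hq (mul_ne_zero hx hz) (mul_ne_zero hx hz')
    (inv_ne_zero hx) hxz hxz'
  have e1 : x * z' * x⁻¹ = z' := by field_simp
  have e2 : x * z * x⁻¹ = z := by field_simp
  have e3 : x * z' / (x * z) = z' / z := by field_simp
  have e4 : x * z * (x * z') * x⁻¹ = x * z * z' := by field_simp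
  rw [e1, e2, e3, e4] at hc
  have hj1 := jTheta_ne_zero hq0 hq (mul_ne_zero hx hz) hxz
  have hj2 := jTheta_ne_zero hq0 hq (mul_ne_zero hx hz') hxz'
  rw [appellLerch_eq, thetaChange]
  apply mul_right_cancel₀ hj
  rw [hc]
  field_simp

/-- The functional equation `m(q x, q, z) = 1 - x m(x, q, z)`. -/
theorem appellLerch_mul_left {x q z : ℂ} (h : AppellLerchAdmissible x q z) :
    appellLerch (q * x) q z = 1 - x * appellLerch x q z := by
  obtain ⟨hx, hq0, hq, hz, hzq, hxz⟩ := h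
  have hj := jTheta_ne_zero hq0 hq hz hzq
  have ha : x * z ≠ 0 := mul_ne_zero hx hz
  have h1 := summable_norm_lerch hq0 hq ha z
  have h2 := summable_norm_theta hq0 hq z
  have key : lerchSeries (q * x * z) z q = jTheta z q - x * lerchSeries (x * z) z q := by
    rw [jTheta_eq_thetaSeries hq0 hq hz, thetaSeries, lerchSeries, lerchSeries,
      ← tsum_shift fun r : ℤ => (-1) ^ r * q ^ binomTwo r * z ^ r * (1 - q ^ (r - 1) * (x * z))⁻¹,
      ← tsum_mul_left, ← h2.of_norm.tsum_sub ((summable_shift h1.of_norm).mul_left x)]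
    refine tsum_congr fun r => ?_
    have e1 : q ^ (r - 1) * (q * x * z) = q ^ r * (x * z) := by
      rw [zpow_sub_one₀ hq0]
      field_simp
    have e2 : (-1 : ℂ) ^ (r + 1) = -(-1) ^ r := by
      rw [zpow_add_one₀ (by norm_num)]
      ring
    have hne := one_sub_zpow_mul_ne_zero hxz r
    rw [e1, binomTwo_add_one, add_sub_cancel_right, e2, zpow_add₀ hq0, zpow_add_one₀ hz]
    generalize hy : q ^ r * (x * z) = y at hne
    have hy' : x * q ^ r * z = y := by rw [← hy]; ring
    linear_combination ((-1) ^ r * q ^ binomTwo r * z ^ r) * inv_mul_cancel₀ hne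
      - ((-1) ^ r * q ^ binomTwo r * z ^ r * (1 - y)⁻¹) * hy'
  rw [appellLerch_eq, appellLerch_eq, key]
  field_simp

/-! ### Theta quotients evaluated on a domain -/

/-- A set of parameters `(p, z₀, z₁)` with `0 < |p| < 1` and `z₀`, `z₁` nonzero. -/
structure ThetaDomain where
  Mem : ℂ → ℂ → ℂ → Prop
  ne_zero : ∀ {p z₀ z₁}, Mem p z₀ z₁ → p ≠ 0
  norm_lt_one : ∀ {p z₀ z₁}, Mem p z₀ z₁ → ‖p‖ < 1
  z₀_ne_zero : ∀ {p z₀ z₁}, Mem p z₀ z₁ → z₀ ≠ 0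
  z₁_ne_zero : ∀ {p z₀ z₁}, Mem p z₀ z₁ → z₁ ≠ 0

namespace ThetaDomain

variable {D : ThetaDomain}

/-- On `D`, the function `f` agrees with a monomial in `p`, `z₀`, `z₁` whose coefficient is a root
of unity. -/
def IsMonomial (D : ThetaDomain) (f : ℂ → ℂ → ℂ → ℂ) : Prop :=
  ∃ ω : ℂ, (∃ n : ℕ, 0 < n ∧ ω ^ n = 1) ∧ ∃ α β γ : ℤ, ∀ p z₀ z₁, D.Mem p z₀ z₁ →
    f p z₀ z₁ = ω * p ^ α * z₀ ^ β * z₁ ^ γ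

theorem isMonomial_root {ω : ℂ} {n : ℕ} (hn : 0 < n) (h : ω ^ n = 1) :
    D.IsMonomial fun _ _ _ => ω :=
  ⟨ω, ⟨n, hn, h⟩, 0, 0, 0, fun _ _ _ _ => by simp⟩

theorem isMonomial_zpow (α : ℤ) : D.IsMonomial fun p _ _ => p ^ α :=
  ⟨1, ⟨1, one_pos, one_pow 1⟩, α, 0, 0, fun _ _ _ _ => by simp⟩

theorem isMonomial_z₀ : D.IsMonomial fun _ z₀ _ => z₀ :=
  ⟨1, ⟨1, one_pos, one_pow 1⟩, 0, 1, 0, fun _ _ _ _ => by simp⟩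

theorem isMonomial_z₁ : D.IsMonomial fun _ _ z₁ => z₁ :=
  ⟨1, ⟨1, one_pos, one_pow 1⟩, 0, 0, 1, fun _ _ _ _ => by simp⟩

theorem IsMonomial.mul {f g : ℂ → ℂ → ℂ → ℂ} (hf : D.IsMonomial f) (hg : D.IsMonomial g) :
    D.IsMonomial fun p z₀ z₁ => f p z₀ z₁ * g p z₀ z₁ := by
  obtain ⟨ω, ⟨n, hn, hω⟩, α, β, γ, h⟩ := hf
  obtain ⟨ω', ⟨n', hn', hω'⟩, α', β', γ', h'⟩ := hg
  refine ⟨ω * ω', ⟨n * n', Nat.mul_pos hn hn', ?_⟩, α + α', β + β', γ + γ', fun p z₀ z₁ hD => ?_⟩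
  · rw [mul_pow, pow_mul, hω, one_pow, mul_comm n, pow_mul, hω', one_pow, one_mul]
  · beta_reduce
    rw [h p z₀ z₁ hD, h' p z₀ z₁ hD, zpow_add₀ (D.ne_zero hD), zpow_add₀ (D.z₀_ne_zero hD),
      zpow_add₀ (D.z₁_ne_zero hD)]
    ring

theorem IsMonomial.inv {f : ℂ → ℂ → ℂ → ℂ} (hf : D.IsMonomial f) :
    D.IsMonomial fun p z₀ z₁ => (f p z₀ z₁)⁻¹ := by
  obtain ⟨ω, ⟨n, hn, hω⟩, α, β, γ, h⟩ := hf
  refine ⟨ω⁻¹, ⟨n, hn, by rw [inv_pow, hω, inv_one]⟩, -α, -β, -γ, fun p z₀ z₁ hD => ?_⟩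
  beta_reduce
  rw [h p z₀ z₁ hD, mul_inv, mul_inv, mul_inv, zpow_neg, zpow_neg, zpow_neg]

theorem IsMonomial.div {f g : ℂ → ℂ → ℂ → ℂ} (hf : D.IsMonomial f) (hg : D.IsMonomial g) :
    D.IsMonomial fun p z₀ z₁ => f p z₀ z₁ / g p z₀ z₁ := by
  simpa only [div_eq_mul_inv] using hf.mul hg.inv

theorem IsMonomial.pow {f : ℂ → ℂ → ℂ → ℂ} (hf : D.IsMonomial f) (k : ℕ) :
    D.IsMonomial fun p z₀ z₁ => f p z₀ z₁ ^ k := by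
  induction k with
  | zero => simpa using isMonomial_root (D := D) one_pos (one_pow 1)
  | succ k ih => simpa only [pow_succ] using ih.mul hf

theorem IsMonomial.congr {f g : ℂ → ℂ → ℂ → ℂ} (hf : D.IsMonomial f)
    (h : ∀ p z₀ z₁, D.Mem p z₀ z₁ → f p z₀ z₁ = g p z₀ z₁) : D.IsMonomial g := by
  obtain ⟨ω, hω, α, β, γ, h'⟩ := hf
  exact ⟨ω, hω, α, β, γ, fun p z₀ z₁ hD => (h p z₀ z₁ hD).symm.trans (h' p z₀ z₁ hD)⟩

theorem IsMonomial.neg {f : ℂ → ℂ → ℂ → ℂ} (hf : D.IsMonomial f) :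
    D.IsMonomial fun p z₀ z₁ => -f p z₀ z₁ :=
  ((isMonomial_root two_pos (by norm_num : (-1 : ℂ) ^ 2 = 1)).mul hf).congr
    fun _ _ _ _ => neg_one_mul _

/-- On `D`, the function `F` of `p = -q`, `z₀`, `z₁` is the value of a regular theta quotient in
`q`, `z₀`, `z₁` of weight `n / 2`. -/
def IsThetaQuotient (D : ThetaDomain) (n : ℤ) (F : ℂ → ℂ → ℂ → ℂ) : Prop :=
  ∃ t : ThetaQuotient, (t.num.length : ℤ) - t.den.length = n ∧ ∀ p z₀ z₁, D.Mem p z₀ z₁ →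
    t.Regular (-p) z₀ z₁ ∧ t.eval (-p) z₀ z₁ = F p z₀ z₁

theorem IsThetaQuotient.congr {n : ℤ} {F G : ℂ → ℂ → ℂ → ℂ} (hF : D.IsThetaQuotient n F)
    (h : ∀ p z₀ z₁, D.Mem p z₀ z₁ → F p z₀ z₁ = G p z₀ z₁) : D.IsThetaQuotient n G := by
  obtain ⟨t, ht, h'⟩ := hF
  exact ⟨t, ht, fun p z₀ z₁ hD => ⟨(h' p z₀ z₁ hD).1, (h' p z₀ z₁ hD).2.trans (h p z₀ z₁ hD)⟩⟩

end ThetaDomain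

/-- The product of two theta quotients. -/
noncomputable def ThetaQuotient.mul (s t : ThetaQuotient) : ThetaQuotient :=
  ⟨s.coeff * t.coeff, s.qExp + t.qExp, s.z₀Exp + t.z₀Exp, s.z₁Exp + t.z₁Exp, s.num ++ t.num,
    s.den ++ t.den⟩

theorem ThetaQuotient.eval_mul (s t : ThetaQuotient) {q z₀ z₁ : ℂ} (hq : q ≠ 0) (hz₀ : z₀ ≠ 0)
    (hz₁ : z₁ ≠ 0) : (s.mul t).eval q z₀ z₁ = s.eval q z₀ z₁ * t.eval q z₀ z₁ := by
  simp only [ThetaQuotient.eval, ThetaQuotient.mul, List.map_append, List.prod_append,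
    zpow_add₀ hq, zpow_add₀ hz₀, zpow_add₀ hz₁]
  rw [div_mul_div_comm]
  congr 1
  ring

theorem ThetaQuotient.regular_mul {s t : ThetaQuotient} {q z₀ z₁ : ℂ} (hs : s.Regular q z₀ z₁)
    (ht : t.Regular q z₀ z₁) : (s.mul t).Regular q z₀ z₁ := fun f hf =>
  (List.mem_append.1 hf).elim (hs f) (ht f)

/-- The product formula `(q; q)_∞ = (q; q³)_∞ (q²; q³)_∞ (q³; q³)_∞ = j(q; q³)`. -/
theorem jTheta_self_pow_three {q : ℂ} (hq0 : q ≠ 0) (hq : ‖q‖ < 1) :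
    jTheta q (q ^ 3) = qPochInf q q := by
  have hq3 : ‖q ^ 3‖ < 1 := by
    rw [norm_pow]
    exact pow_lt_one₀ (norm_nonneg q) hq three_ne_zero
  have e : q ^ 3 / q = q ^ 2 := by field_simp
  have h1 := ((tendsto_qPochInf hq3 q).mul (tendsto_qPochInf hq3 (q ^ 2))).mul
    (tendsto_qPochInf hq3 (q ^ 3))
  have h2 := (tendsto_qPochInf hq q).comp (tendsto_id.const_mul_atTop' three_pos)
  rw [jTheta, e]
  have h3 : ∀ f : ℕ → ℂ, ∏ i ∈ Finset.range 3, f i = f 0 * f 1 * f 2 := fun f => by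
    simp [Finset.prod_range_succ]
  refine tendsto_nhds_unique h1 (h2.congr fun N => ?_)
  simp only [Function.comp_apply, id]
  induction N with
  | zero => simp
  | succ N ih =>
    rw [mul_add_one, Finset.prod_range_add, ih, Finset.prod_range_succ _ N,
      Finset.prod_range_succ _ N, Finset.prod_range_succ _ N]
    rw [h3]
    ring

namespace ThetaDomain

variable {D : ThetaDomain} {n m : ℤ} {F G f : ℂ → ℂ → ℂ → ℂ}

theorem IsThetaQuotient.mul (hF : D.IsThetaQuotient n F) (hG : D.IsThetaQuotient m G) :
    D.IsThetaQuotient (n + m) fun p z₀ z₁ => F p z₀ z₁ * G p z₀ z₁ := by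
  obtain ⟨s, hs, h⟩ := hF
  obtain ⟨t, ht, h'⟩ := hG
  refine ⟨s.mul t, ?_, fun p z₀ z₁ hD => ⟨ThetaQuotient.regular_mul (h p z₀ z₁ hD).1
    (h' p z₀ z₁ hD).1, ?_⟩⟩
  · simp only [ThetaQuotient.mul, List.length_append, Nat.cast_add, ← hs, ← ht]
    ring
  · rw [ThetaQuotient.eval_mul s t (neg_ne_zero.2 (D.ne_zero hD)) (D.z₀_ne_zero hD)
      (D.z₁_ne_zero hD), (h p z₀ z₁ hD).2, (h' p z₀ z₁ hD).2]

theorem isThetaQuotient_const (c : ℂ) : D.IsThetaQuotient 0 fun _ _ _ => c :=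
  ⟨⟨c, 0, 0, 0, [], []⟩, by simp, fun _ _ _ _ =>
    ⟨fun _ h => absurd h List.not_mem_nil, by simp [ThetaQuotient.eval]⟩⟩

theorem neg_zpow_mul_zpow (p : ℂ) (α : ℤ) : (-1) ^ α * (-p) ^ α = p ^ α := by
  rw [← mul_zpow, neg_one_mul, neg_neg]

theorem IsMonomial.isThetaQuotient (hf : D.IsMonomial f) : D.IsThetaQuotient 0 f := by
  obtain ⟨ω, -, α, β, γ, h⟩ := hf
  refine ⟨⟨ω * (-1) ^ α, α, β, γ, [], []⟩, by simp, fun p z₀ z₁ hD =>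
    ⟨fun _ h => absurd h List.not_mem_nil, ?_⟩⟩
  rw [h p z₀ z₁ hD, ← neg_zpow_mul_zpow p α]
  simp [ThetaQuotient.eval, mul_assoc]

/-- In terms of `q = -p`, the base is `p ^ k = (-1) ^ k q ^ k`; this is where the signs in the
bases of the theta factors are needed. -/
theorem IsMonomial.exists_thetaFactor (hf : D.IsMonomial f) {k : ℕ} (hk : 0 < k) :
    ∃ φ : ThetaFactor, ∀ p z₀ z₁, D.Mem p z₀ z₁ →
      φ.eval (-p) z₀ z₁ = jTheta (f p z₀ z₁) (p ^ k) := by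
  obtain ⟨ω, ⟨n, hn, hω⟩, α, β, γ, h⟩ := hf
  refine ⟨⟨ω * (-1) ^ α, ⟨n * 2, by omega, ?_⟩, α, β, γ, (-1) ^ k, k, hk⟩, fun p z₀ z₁ hD => ?_⟩
  · have h1 : ((-1 : ℂ) ^ α) ^ 2 = 1 := by
      rw [← zpow_natCast, ← zpow_mul, mul_comm, zpow_mul]
      simp
    rw [mul_pow, pow_mul, hω, one_pow, one_mul, mul_comm, pow_mul, h1, one_pow]
  · have e1 : ω * (-1) ^ α * (-p) ^ α = ω * p ^ α := by rw [mul_assoc, neg_zpow_mul_zpow]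
    have e2 : (((((-1) ^ k : ℤˣ) : ℤ) : ℂ)) * (-p) ^ k = p ^ k := by
      push_cast
      rw [← mul_pow, neg_one_mul, neg_neg]
    rw [ThetaFactor.eval, h p z₀ z₁ hD, e1, e2]

theorem IsMonomial.jTheta (hf : D.IsMonomial f) {k : ℕ} (hk : 0 < k) :
    D.IsThetaQuotient 1 fun p z₀ z₁ => jTheta (f p z₀ z₁) (p ^ k) := by
  obtain ⟨φ, h⟩ := hf.exists_thetaFactor hk
  refine ⟨⟨1, 0, 0, 0, [φ], []⟩, by simp, fun p z₀ z₁ hD =>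
    ⟨fun _ h => absurd h List.not_mem_nil, ?_⟩⟩
  simp [ThetaQuotient.eval, h p z₀ z₁ hD]

theorem IsMonomial.inv_jTheta (hf : D.IsMonomial f) {k : ℕ} (hk : 0 < k)
    (h0 : ∀ p z₀ z₁, D.Mem p z₀ z₁ → f p z₀ z₁ ≠ 0 ∧ ∀ j : ℤ, f p z₀ z₁ ≠ (p ^ k) ^ j) :
    D.IsThetaQuotient (-1) fun p z₀ z₁ => (_root_.jTheta (f p z₀ z₁) (p ^ k))⁻¹ := by
  obtain ⟨φ, h⟩ := hf.exists_thetaFactor hk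
  refine ⟨⟨1, 0, 0, 0, [], [φ]⟩, by simp, fun p z₀ z₁ hD => ⟨fun φ' h' => ?_, ?_⟩⟩
  · rw [List.mem_singleton.1 h', h p z₀ z₁ hD]
    refine jTheta_ne_zero (pow_ne_zero _ (D.ne_zero hD)) ?_ (h0 p z₀ z₁ hD).1 (h0 p z₀ z₁ hD).2
    rw [norm_pow]
    exact pow_lt_one₀ (norm_nonneg p) (D.norm_lt_one hD) hk.ne'
  · simp [ThetaQuotient.eval, h p z₀ z₁ hD]

theorem isThetaQuotient_qPochInf {k : ℕ} (hk : 0 < k) :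
    D.IsThetaQuotient 1 fun p _ _ => qPochInf (p ^ k) (p ^ k) := by
  refine ((isMonomial_zpow (k : ℤ)).jTheta (k := k * 3) (by omega)).congr fun p z₀ z₁ hD => ?_
  rw [zpow_natCast, pow_mul]
  refine jTheta_self_pow_three (pow_ne_zero _ (D.ne_zero hD)) ?_
  rw [norm_pow]
  exact pow_lt_one₀ (norm_nonneg p) (D.norm_lt_one hD) hk.ne'

theorem isThetaQuotient_qPochInf_pow_three {k : ℕ} (hk : 0 < k) :
    D.IsThetaQuotient 3 fun p _ _ => qPochInf (p ^ k) (p ^ k) ^ 3 :=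
  (((isThetaQuotient_qPochInf hk).mul (isThetaQuotient_qPochInf hk)).mul
    (isThetaQuotient_qPochInf hk)).congr fun p _ _ _ => by ring

/-- On `D`, the function `f` is nonzero and avoids the integral powers of `p ^ k`, so that
`j(f; p ^ k)` does not vanish. -/
def Avoids (D : ThetaDomain) (k : ℕ) (f : ℂ → ℂ → ℂ → ℂ) : Prop :=
  ∀ p z₀ z₁, D.Mem p z₀ z₁ → f p z₀ z₁ ≠ 0 ∧ ∀ j : ℤ, f p z₀ z₁ ≠ (p ^ k) ^ j

theorem isThetaQuotient_change {x z z' : ℂ → ℂ → ℂ → ℂ} {k : ℕ} (hk : 0 < k)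
    (hx : D.IsMonomial x) (hz : D.IsMonomial z) (hz' : D.IsMonomial z') (h : D.Avoids k z)
    (hxz : D.Avoids k fun p z₀ z₁ => x p z₀ z₁ * z p z₀ z₁)
    (hxz' : D.Avoids k fun p z₀ z₁ => x p z₀ z₁ * z' p z₀ z₁) :
    D.IsThetaQuotient 2 fun p z₀ z₁ =>
      thetaChange (x p z₀ z₁) (p ^ k) (z p z₀ z₁) (z' p z₀ z₁) := by
  have h1 := ((((((hz.isThetaQuotient.mul (isThetaQuotient_qPochInf_pow_three hk)).mul
    ((hz'.div hz).jTheta hk)).mul (((hx.mul hz).mul hz').jTheta hk)).mul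
    (hz.inv_jTheta hk h)).mul ((hx.mul hz).inv_jTheta hk hxz)).mul
    ((hx.mul hz').inv_jTheta hk hxz'))
  refine IsThetaQuotient.congr (n := 2) h1 fun p z₀ z₁ _ => ?_
  rw [thetaChange, div_eq_mul_inv (_ * _ * _ * _), mul_inv, mul_inv]
  ring

/-! ### Sums of theta quotients of weight `1/2` -/

/-- On `D`, the function `F` of `p = -q`, `z₀`, `z₁` is a finite sum of regular theta quotients of
weight `1/2`. -/
def IsThetaSum (D : ThetaDomain) (F : ℂ → ℂ → ℂ → ℂ) : Prop :=
  ∃ T : List ThetaQuotient, (∀ t ∈ T, t.weight = 1 / 2) ∧ ∀ p z₀ z₁, D.Mem p z₀ z₁ →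
    (∀ t ∈ T, t.Regular (-p) z₀ z₁) ∧ thetaSumEval T (-p) z₀ z₁ = F p z₀ z₁

theorem IsThetaSum.congr (hF : D.IsThetaSum F)
    (h : ∀ p z₀ z₁, D.Mem p z₀ z₁ → F p z₀ z₁ = G p z₀ z₁) : D.IsThetaSum G := by
  obtain ⟨T, hT, h'⟩ := hF
  exact ⟨T, hT, fun p z₀ z₁ hD => ⟨(h' p z₀ z₁ hD).1, (h' p z₀ z₁ hD).2.trans (h p z₀ z₁ hD)⟩⟩

theorem isThetaSum_zero : D.IsThetaSum fun _ _ _ => 0 :=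
  ⟨[], by simp, fun _ _ _ _ => ⟨by simp, by simp [thetaSumEval]⟩⟩

theorem IsThetaSum.add (hF : D.IsThetaSum F) (hG : D.IsThetaSum G) :
    D.IsThetaSum fun p z₀ z₁ => F p z₀ z₁ + G p z₀ z₁ := by
  obtain ⟨S, hS, h⟩ := hF
  obtain ⟨T, hT, h'⟩ := hG
  refine ⟨S ++ T, fun t ht => (List.mem_append.1 ht).elim (hS t) (hT t), fun p z₀ z₁ hD =>
    ⟨fun t ht => (List.mem_append.1 ht).elim ((h p z₀ z₁ hD).1 t) ((h' p z₀ z₁ hD).1 t), ?_⟩⟩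
  beta_reduce
  rw [← (h p z₀ z₁ hD).2, ← (h' p z₀ z₁ hD).2]
  simp [thetaSumEval]

theorem isThetaSum_sum {ι : Type*} (s : Finset ι) {F : ι → ℂ → ℂ → ℂ → ℂ}
    (h : ∀ i ∈ s, D.IsThetaSum (F i)) :
    D.IsThetaSum fun p z₀ z₁ => ∑ i ∈ s, F i p z₀ z₁ := by
  classical
  induction s using Finset.induction_on with
  | empty => simpa using isThetaSum_zero
  | insert i s hi ih =>
    simp only [Finset.sum_insert hi]
    exact (h i (Finset.mem_insert_self i s)).add
      (ih fun j hj => h j (Finset.mem_insert_of_mem hj))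

theorem IsThetaQuotient.isThetaSum (hF : D.IsThetaQuotient 1 F) : D.IsThetaSum F := by
  obtain ⟨t, ht, h⟩ := hF
  refine ⟨[t], fun t' ht' => ?_, fun p z₀ z₁ hD => ⟨fun t' ht' => ?_, ?_⟩⟩
  · rw [List.mem_singleton.1 ht', ThetaQuotient.weight]
    rw [sub_eq_iff_eq_add] at ht
    have : (t.num.length : ℚ) = 1 + t.den.length := by exact_mod_cast ht
    rw [this]
    ring
  · rw [List.mem_singleton.1 ht']
    exact (h p z₀ z₁ hD).1
  · simp [thetaSumEval, (h p z₀ z₁ hD).2]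

theorem IsThetaSum.mul (hF : D.IsThetaSum F) (hG : D.IsThetaQuotient 0 G) :
    D.IsThetaSum fun p z₀ z₁ => F p z₀ z₁ * G p z₀ z₁ := by
  obtain ⟨T, hT, h⟩ := hF
  obtain ⟨s, hs, h'⟩ := hG
  refine ⟨T.map fun t => t.mul s, fun t ht => ?_, fun p z₀ z₁ hD => ⟨fun t ht => ?_, ?_⟩⟩
  · obtain ⟨t, ht', rfl⟩ := List.mem_map.1 ht
    have hs' : (s.num.length : ℚ) - s.den.length = 0 := by exact_mod_cast hs
    rw [← hT t ht', ThetaQuotient.weight, ThetaQuotient.weight]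
    simp only [ThetaQuotient.mul, List.length_append, Nat.cast_add]
    linear_combination hs' / 2
  · obtain ⟨t, ht', rfl⟩ := List.mem_map.1 ht
    exact ThetaQuotient.regular_mul ((h p z₀ z₁ hD).1 t ht') (h' p z₀ z₁ hD).1
  · beta_reduce
    rw [← (h p z₀ z₁ hD).2, ← (h' p z₀ z₁ hD).2, thetaSumEval, thetaSumEval, List.map_map,
      ← List.sum_map_mul_right]
    congr 1
    refine List.map_congr_left fun t _ => ?_
    exact ThetaQuotient.eval_mul t s (neg_ne_zero.2 (D.ne_zero hD)) (D.z₀_ne_zero hD)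
      (D.z₁_ne_zero hD)

theorem IsThetaSum.const_mul (hF : D.IsThetaSum F) (c : ℂ) :
    D.IsThetaSum fun p z₀ z₁ => c * F p z₀ z₁ :=
  (hF.mul (isThetaQuotient_const c)).congr fun _ _ _ _ => mul_comm _ _

/-- Changing the third argument of an Appell–Lerch sum costs one theta quotient of weight `1/2`. -/
theorem isThetaSum_appellLerch_sub {x z z' : ℂ → ℂ → ℂ → ℂ} {k : ℕ} (hk : 0 < k)
    (hx : D.IsMonomial x) (hz : D.IsMonomial z) (hz' : D.IsMonomial z') (h : D.Avoids k z)
    (h' : D.Avoids k z') (hxz : D.Avoids k fun p z₀ z₁ => x p z₀ z₁ * z p z₀ z₁)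
    (hxz' : D.Avoids k fun p z₀ z₁ => x p z₀ z₁ * z' p z₀ z₁) :
    D.IsThetaSum fun p z₀ z₁ => appellLerch (x p z₀ z₁) (p ^ k) (z' p z₀ z₁)
      - appellLerch (x p z₀ z₁) (p ^ k) (z p z₀ z₁) := by
  have h1 := (isThetaQuotient_change hk hx hz hz' h hxz hxz').mul (hz'.inv_jTheta hk h')
  refine (IsThetaQuotient.isThetaSum h1).congr fun p z₀ z₁ hD => ?_
  have hq0 : p ^ k ≠ 0 := pow_ne_zero _ (D.ne_zero hD)
  have hq : ‖p ^ k‖ < 1 := by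
    rw [norm_pow]
    exact pow_lt_one₀ (norm_nonneg p) (D.norm_lt_one hD) hk.ne'
  obtain ⟨a1, a2⟩ := h p z₀ z₁ hD
  obtain ⟨b1, b2⟩ := h' p z₀ z₁ hD
  have hj := jTheta_ne_zero hq0 hq b1 b2
  rw [appellLerch_eq _ _ (z' p z₀ z₁), lerchSeries_eq_appellLerch_mul hq0 hq
    (left_ne_zero_of_mul (hxz p z₀ z₁ hD).1) a1 b1 a2 (hxz p z₀ z₁ hD).2 (hxz' p z₀ z₁ hD).2,
    add_div, mul_div_cancel_right₀ _ hj, add_sub_cancel_left, div_eq_mul_inv _ (_root_.jTheta _ _)]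

end ThetaDomain

/-! ### The rank generating function at roots of unity, modulo theta functions -/

theorem mul_zpow_ne_pow_zpow {p c : ℂ} (hp0 : p ≠ 0) (hp : ‖p‖ < 1) (hc : ‖c‖ = 1) (hc1 : c ≠ 1)
    (e : ℤ) (k : ℕ) (j : ℤ) : c * p ^ e ≠ (p ^ k) ^ j := by
  intro h
  apply ne_zpow_of_norm_eq_one hp hc hc1 (k * j - e)
  rw [zpow_sub₀ hp0, zpow_mul, zpow_natCast, ← h, mul_div_cancel_right₀ _ (zpow_ne_zero e hp0)]

/-- The argument `x` of the Appell–Lerch sums in the dissection modulo `M`. -/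
noncomputable def lerchArg (M : ℕ) (s : ℤ) (p : ℂ) : ℂ := -p ^ (binomTwo M - (M : ℤ) * s)

theorem lerchArg_ne_zero {p : ℂ} (hp0 : p ≠ 0) (M : ℕ) (s : ℤ) : lerchArg M s p ≠ 0 :=
  neg_ne_zero.2 (zpow_ne_zero _ hp0)

theorem lerchArg_mul_dissectArg {p ζ η : ℂ} (hp0 : p ≠ 0) {M : ℕ} (hζ : ζ ^ M = 1) (s u : ℕ) :
    lerchArg M s p * dissectArg (-η) p M (u + s)
      = p ^ ((M : ℤ) ^ 2 + M * ((u : ℤ) - 1)) * (ζ * η) ^ M := by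
  have h := two_mul_binomTwo M
  have e : p ^ ((M : ℤ) ^ 2 + M * ((u : ℤ) - 1))
      = p ^ (binomTwo M - (M : ℤ) * s) * p ^ (binomTwo M + (M : ℤ) * ((u + s : ℕ) : ℤ)) := by
    rw [← zpow_add₀ hp0]
    congr 1
    push_cast
    linear_combination -h
  have hs : (-1 : ℂ) ^ M * (-1) ^ M = 1 := by rw [← mul_pow]; simp
  rw [lerchArg, dissectArg, e, mul_pow ζ, hζ, neg_pow η, pow_succ]
  linear_combination (p ^ (binomTwo M - (M : ℤ) * s)
    * p ^ (binomTwo M + (M : ℤ) * ((u + s : ℕ) : ℤ)) * η ^ M) * hs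

/-- The coefficients in the dissection of `m(-ζ, p, -η)`. -/
noncomputable def dissectCoeff (p ζ η : ℂ) (s u : ℕ) : ℂ :=
  (-1) ^ u * p ^ binomTwo u * (-η) ^ u * (p ^ ((u : ℤ) - 1) * (ζ * η)) ^ s

theorem I_norm_one : ‖Complex.I‖ = 1 := Complex.norm_I

theorem I_ne_one : Complex.I ≠ 1 := fun h => by simpa using congrArg Complex.re h

theorem neg_I_ne_one : -Complex.I ≠ 1 := fun h => by simpa using congrArg Complex.re h

/-- The dissection of `m(-ζ, p, -η)` for `ζ ^ M = 1`. All the resulting series are moved to the third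
argument `i`; then the `M` theta factors belonging to the same `s` recombine to `j(-η; p)`, which
removes `η` from the Appell–Lerch part. -/
theorem appellLerch_dissect {p ζ η : ℂ} (hp0 : p ≠ 0) (hp : ‖p‖ < 1) {M : ℕ} (hM : 0 < M)
    (hζ : ζ ^ M = 1) (hη : ‖η‖ = 1) (hη1 : η ≠ -1) (hηM : η ^ M ≠ 1) :
    appellLerch (-ζ) p (-η) = ∑ s ∈ Finset.range M, ζ ^ s * (p ^ (-binomTwo (s + 1)) *
        appellLerch (lerchArg M s p) (p ^ (M ^ 2)) Complex.I)
      + ∑ s ∈ Finset.range M, ∑ u ∈ Finset.range M, dissectCoeff p ζ η s u *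
        thetaChange (lerchArg M s p) (p ^ (M ^ 2)) Complex.I (dissectArg (-η) p M (u + s))
          / jTheta (-η) p := by
  have hη0 : η ≠ 0 := norm_ne_zero_iff.1 (by rw [hη]; exact one_ne_zero)
  have hζ0 : ζ ≠ 0 := fun h => by simp [h, hM.ne'] at hζ
  have hζη : (ζ * η) ^ M = η ^ M := by rw [mul_pow, hζ, one_mul]
  have hηMn : ‖η ^ M‖ = 1 := by rw [norm_pow, hη, one_pow]
  have hj : jTheta (-η) p ≠ 0 := jTheta_ne_zero hp0 hp (neg_ne_zero.2 hη0)
    (ne_zpow_of_norm_eq_one hp (by rwa [norm_neg]) fun h => hη1 (by rw [← h, neg_neg]))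
  have hd : ∀ k, dissectArg (-η) p M k ≠ 0 := fun k =>
    mul_ne_zero (mul_ne_zero (pow_ne_zero _ (by norm_num)) (pow_ne_zero _ (neg_ne_zero.2 hη0)))
      (zpow_ne_zero _ hp0)
  have hterm : ∀ s u : ℕ, lerchSeries (p ^ ((M : ℤ) ^ 2 + M * ((u : ℤ) - 1)) * (ζ * η) ^ M)
      (dissectArg (-η) p M (u + s)) (p ^ (M ^ 2))
      = appellLerch (lerchArg M s p) (p ^ (M ^ 2)) Complex.I
          * jTheta (dissectArg (-η) p M (u + s)) (p ^ (M ^ 2))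
        + thetaChange (lerchArg M s p) (p ^ (M ^ 2)) Complex.I (dissectArg (-η) p M (u + s)) := by
    intro s u
    rw [← lerchArg_mul_dissectArg hp0 hζ s u]
    refine lerchSeries_eq_appellLerch_mul (pow_ne_zero _ hp0) (norm_pow_sq_lt_one hp hM)
      (lerchArg_ne_zero hp0 M s) Complex.I_ne_zero (hd _) (fun k => ?_) (fun k => ?_) fun k => ?_
    · simpa using mul_zpow_ne_pow_zpow hp0 hp I_norm_one I_ne_one 0 (M ^ 2) k
    · have := mul_zpow_ne_pow_zpow hp0 hp (by rw [norm_neg, I_norm_one]) neg_I_ne_one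
        (binomTwo M - (M : ℤ) * s) (M ^ 2) k
      rwa [lerchArg, neg_mul, mul_comm, ← neg_mul]
    · rw [lerchArg_mul_dissectArg hp0 hζ, hζη, mul_comm]
      exact mul_zpow_ne_pow_zpow hp0 hp hηMn hηM _ _ k
  have hsum : ∀ s : ℕ, ∑ u ∈ Finset.range M, dissectCoeff p ζ η s u *
      lerchSeries (p ^ ((M : ℤ) ^ 2 + M * ((u : ℤ) - 1)) * (ζ * η) ^ M)
        (dissectArg (-η) p M (u + s)) (p ^ (M ^ 2))
      = ζ ^ s * (p ^ (-binomTwo (s + 1)) * appellLerch (lerchArg M s p) (p ^ (M ^ 2)) Complex.I)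
          * jTheta (-η) p
        + ∑ u ∈ Finset.range M, dissectCoeff p ζ η s u *
          thetaChange (lerchArg M s p) (p ^ (M ^ 2)) Complex.I (dissectArg (-η) p M (u + s)) := by
    intro s
    have h1 := sum_jTheta_dissectArg (a := ζ * η) hp0 hp (neg_ne_zero.2 hη0) hM s
    have e : -(ζ * η) / -η = ζ := by field_simp
    rw [e] at h1
    simp only [hterm, mul_add, Finset.sum_add_distrib]
    congr 1
    calc _ = appellLerch (lerchArg M s p) (p ^ (M ^ 2)) Complex.I * ∑ u ∈ Finset.range M,
          dissectCoeff p ζ η s u * jTheta (dissectArg (-η) p M (u + s)) (p ^ (M ^ 2)) := by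
            rw [Finset.mul_sum]
            exact Finset.sum_congr rfl fun u _ => by ring
      _ = _ := by
            simp only [dissectCoeff]
            rw [h1]
            ring
  have h : lerchSeries (ζ * η) (-η) p = ∑ s ∈ Finset.range M, ∑ u ∈ Finset.range M,
      dissectCoeff p ζ η s u * lerchSeries (p ^ ((M : ℤ) ^ 2 + M * ((u : ℤ) - 1)) * (ζ * η) ^ M)
        (dissectArg (-η) p M (u + s)) (p ^ (M ^ 2)) := lerchSeries_dissect (a := ζ * η) (w := -η) hp0 hp (mul_ne_zero hζ0 hη0)
    (neg_ne_zero.2 hη0) hM fun k => hζη ▸ ne_zpow_of_norm_eq_one hp hηMn hηM k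
  rw [appellLerch_eq, neg_mul_neg, h, Finset.sum_congr rfl fun s _ => hsum s,
    Finset.sum_add_distrib, add_div, ← Finset.sum_mul, mul_div_cancel_right₀ _ hj]
  simp only [Finset.sum_div]

namespace ThetaDomain

variable {D : ThetaDomain}

theorem Avoids.congr {k : ℕ} {f g : ℂ → ℂ → ℂ → ℂ} (hf : D.Avoids k f)
    (h : ∀ p z₀ z₁, D.Mem p z₀ z₁ → f p z₀ z₁ = g p z₀ z₁) : D.Avoids k g :=
  fun p z₀ z₁ hD => h p z₀ z₁ hD ▸ hf p z₀ z₁ hD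

theorem avoids_mul_zpow {c : ℂ} (hc : ‖c‖ = 1) (hc1 : c ≠ 1) (e : ℤ) (k : ℕ) :
    D.Avoids k fun p _ _ => c * p ^ e := fun p _ _ hD =>
  ⟨mul_ne_zero (norm_ne_zero_iff.1 (by rw [hc]; exact one_ne_zero))
    (zpow_ne_zero e (D.ne_zero hD)),
    mul_zpow_ne_pow_zpow (D.ne_zero hD) (D.norm_lt_one hD) hc hc1 e k⟩

theorem avoids_const {c : ℂ} (hc : ‖c‖ = 1) (hc1 : c ≠ 1) (k : ℕ) : D.Avoids k fun _ _ _ => c :=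
  (avoids_mul_zpow hc hc1 0 k).congr fun _ _ _ _ => by simp

theorem avoids_lerchArg_mul_I (M : ℕ) (s : ℤ) (k : ℕ) :
    D.Avoids k fun p _ _ => lerchArg M s p * Complex.I :=
  (avoids_mul_zpow (by rw [norm_neg, I_norm_one]) neg_I_ne_one (binomTwo M - (M : ℤ) * s) k).congr
    fun p _ _ _ => by
      rw [lerchArg]
      ring

theorem isMonomial_lerchArg (M : ℕ) (s : ℤ) : D.IsMonomial fun p _ _ => lerchArg M s p :=
  (isMonomial_zpow _).neg

theorem isMonomial_I : D.IsMonomial fun _ _ _ => Complex.I :=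
  isMonomial_root (n := 4) (by norm_num) Complex.I_pow_four

theorem isMonomial_dissectArg {η : ℂ} {n : ℕ} (hn : 0 < n) (hη : η ^ n = 1) (M k : ℕ) :
    D.IsMonomial fun p _ _ => dissectArg (-η) p M k :=
  (((isMonomial_root one_pos (one_pow 1)).neg.pow (M + 1)).mul
    ((isMonomial_root hn hη).neg.pow M)).mul (isMonomial_zpow _)

theorem isThetaQuotient_dissectCoeff (ζ η : ℂ) (s u : ℕ) :
    D.IsThetaQuotient 0 fun p _ _ => dissectCoeff p ζ η s u := by
  have h := ((isThetaQuotient_const (D := D) ((-1) ^ u * (-η) ^ u * (ζ * η) ^ s)).mul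
    (isMonomial_zpow (binomTwo u)).isThetaQuotient).mul
    ((isMonomial_zpow ((u : ℤ) - 1)).pow s).isThetaQuotient
  refine IsThetaQuotient.congr (n := 0) h fun p _ _ _ => ?_
  rw [dissectCoeff, mul_pow _ (ζ * η)]
  ring

/-- Modulo theta functions, the rank generating function at an `M`-th root of unity `ζ` is a combination
of `M` Appell–Lerch sums which do not depend on `ζ`. -/
theorem isThetaSum_rankGF {M : ℕ} (hM : 0 < M) {ζ : ℂ} (hζ : ζ ^ M = 1) (hζ1 : ζ ≠ 1) :
    D.IsThetaSum fun p _ _ => rankGF ζ (-p) - (1 - ζ) * ∑ s ∈ Finset.range M, ζ ^ s *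
      (p ^ (-binomTwo (s + 1)) * appellLerch (lerchArg M s p) (p ^ (M ^ 2)) Complex.I) := by
  have h3M : 3 * M ≠ 0 := by omega
  -- `η ^ M` is a primitive cube root of unity: this keeps all arguments off the powers of the base.
  obtain ⟨η, hη⟩ : ∃ η : ℂ, IsPrimitiveRoot η (3 * M) := ⟨_, Complex.isPrimitiveRoot_exp _ h3M⟩
  have hηn : ‖η‖ = 1 := hη.norm'_eq_one h3M
  have hη1 : η ≠ -1 := by
    rintro rfl
    have := Nat.le_of_dvd two_pos (hη.dvd_of_pow_eq_one 2 (by norm_num))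
    omega
  have hηM : η ^ M ≠ 1 := fun h => by
    have := Nat.le_of_dvd hM (hη.dvd_of_pow_eq_one M h)
    omega
  have hζη : (ζ * η) ^ M = η ^ M := by rw [mul_pow, hζ, one_mul]
  have hζη1 : ζ * η ≠ 1 := fun h => hηM (by rw [← hζη, h, one_pow])
  have hζn : ‖ζ‖ = 1 := Complex.norm_eq_one_of_pow_eq_one hζ hM.ne'
  have hζ0 : ζ ≠ 0 := norm_ne_zero_iff.1 (by rw [hζn]; exact one_ne_zero)
  have hη0 : η ≠ 0 := norm_ne_zero_iff.1 (by rw [hηn]; exact one_ne_zero)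
  have n1 : (-1 : ℂ) ≠ 1 := by norm_num
  have mη : D.IsMonomial fun _ _ _ => -η := (isMonomial_root (by omega) hη.pow_eq_one).neg
  have mζ : D.IsMonomial fun _ _ _ => ζ := isMonomial_root hM hζ
  have m1 : D.IsMonomial fun _ _ _ => (-1 : ℂ) := isMonomial_root two_pos (by norm_num)
  have aη : D.Avoids 1 fun _ _ _ => -η :=
    avoids_const (by rwa [norm_neg]) (fun h => hη1 (by rw [← h, neg_neg])) 1
  have a1 : D.Avoids 1 fun _ _ _ => (-1 : ℂ) := avoids_const (by simp) n1 1
  have aζ : D.Avoids 1 fun _ _ _ => ζ := avoids_const hζn hζ1 1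
  have aζη : D.Avoids 1 fun _ _ _ => -ζ * -η := by
    rw [neg_mul_neg]
    exact avoids_const (by rw [norm_mul, hζn, hηn, one_mul]) hζη1 1
  have aζ' : D.Avoids 1 fun _ _ _ => -ζ * -1 := by
    rw [neg_mul_neg, mul_one]
    exact aζ
  -- The three kinds of theta quotients, each of weight `1 / 2`.
  have t1 := (((isThetaQuotient_qPochInf_pow_three one_pos).mul (mζ.inv_jTheta one_pos aζ)).mul
    (m1.inv_jTheta one_pos a1))
  have t2 := (isThetaQuotient_change one_pos mζ.neg mη m1 aη aζη aζ').mul (m1.inv_jTheta one_pos a1)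
  have t3 : ∀ s u : ℕ, _ := fun s u => ((isThetaQuotient_dissectCoeff (D := D) ζ η s u).mul
    (isThetaQuotient_change (k := M ^ 2) (by positivity) (isMonomial_lerchArg M s) isMonomial_I
      (isMonomial_dissectArg (by omega) hη.pow_eq_one M (u + s))
      (avoids_const I_norm_one I_ne_one _) (avoids_lerchArg_mul_I M s _)
      ((avoids_mul_zpow (c := η ^ M) (by rw [norm_pow, hηn, one_pow]) hηM
        ((M : ℤ) ^ 2 + M * ((u : ℤ) - 1)) _).congr fun p _ _ hD => by
          rw [lerchArg_mul_dissectArg (D.ne_zero hD) hζ, hζη, mul_comm]))).mul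
    (mη.inv_jTheta one_pos aη)
  have h1 : D.IsThetaSum _ := IsThetaQuotient.isThetaSum t1
  have h2 : D.IsThetaSum _ := IsThetaQuotient.isThetaSum t2
  have h3 : D.IsThetaSum _ := isThetaSum_sum (Finset.range M) fun s _ =>
    isThetaSum_sum (Finset.range M) fun u _ => IsThetaQuotient.isThetaSum (t3 s u)
  refine (((h1.add h2).add h3).const_mul (1 - ζ)).congr fun p z₀ z₁ hD => ?_
  have hp0 := D.ne_zero hD
  have hp := D.norm_lt_one hD
  simp only [pow_one]
  have e1 := rankGF_mul_jTheta hp0 hp hζn hζ1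
  have e2 := lerchSeries_eq_appellLerch_mul (x := -ζ) (z := -η) (z' := -1) hp0 hp
    (neg_ne_zero.2 hζ0) (neg_ne_zero.2 hη0) (neg_ne_zero.2 one_ne_zero)
    (by simpa using (aη p z₀ z₁ hD).2) (by simpa using (aζη p z₀ z₁ hD).2)
    (by simpa using (aζ' p z₀ z₁ hD).2)
  have e3 := lerchSeries_one_mul_jTheta hp0 hp hζ0 (by simpa using (aζ p z₀ z₁ hD).2)
  have e4 := appellLerch_dissect hp0 hp hM hζ hηn hη1 hηM
  have j1 := jTheta_ne_zero hp0 hp (neg_ne_zero.2 one_ne_zero) (by simpa using (a1 p z₀ z₁ hD).2)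
  have j2 := jTheta_ne_zero hp0 hp hζ0 (by simpa using (aζ p z₀ z₁ hD).2)
  rw [neg_mul_neg, mul_one] at e2
  rw [e2, e4] at e1
  simp only [← div_eq_mul_inv]
  generalize ∑ s ∈ Finset.range M, ∑ u ∈ Finset.range M, dissectCoeff p ζ η s u *
        thetaChange (lerchArg M s p) (p ^ (M ^ 2)) Complex.I (dissectArg (-η) p M (u + s))
          / jTheta (-η) p = S at e1 ⊢
  generalize ∑ s ∈ Finset.range M, ζ ^ s * (p ^ (-binomTwo (s + 1)) *
        appellLerch (lerchArg M s p) (p ^ (M ^ 2)) Complex.I) = U at e1 ⊢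
  have e5 : lerchSeries ζ 1 p = -qPochInf p p ^ 3 / jTheta ζ p := by
    rw [eq_div_iff j2, e3]
  rw [e5] at e1
  apply mul_right_cancel₀ j1
  rw [sub_mul (rankGF ζ (-p)), e1]
  field_simp
  ring

end ThetaDomain

/-! ### Orthogonality and the choice of the third arguments -/

/-- The factor `1 - ω ^ k` vanishes for `k = 0`, so the sum may be extended to all `k`. Orthogonality
then selects the index `a` and, with opposite sign, the index `c` congruent to `a - 1`. -/
theorem sum_erase_orthogonality {ω : ℂ} {M : ℕ} (hω : IsPrimitiveRoot ω M) {a c : ℕ} (ha : a < M)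
    (hc : c < M) (hac : (M : ℤ) ∣ c + 1 - a) (b : ℕ → ℂ) :
    (1 / M : ℂ) * ∑ k ∈ (Finset.range M).erase 0, (ω ^ k) ^ (-(a : ℤ)) *
      ((1 - ω ^ k) * ∑ s ∈ Finset.range M, (ω ^ k) ^ s * b s) = b a - b c := by
  have hM : 0 < M := by omega
  have hM0 : (M : ℂ) ≠ 0 := Nat.cast_ne_zero.2 hM.ne'
  have hω0 : ω ≠ 0 := hω.ne_zero hM.ne'
  rw [Finset.sum_erase _ (by simp)]
  have hk : ∀ k : ℕ, (ω ^ k) ^ (-(a : ℤ)) * ((1 - ω ^ k) * ∑ s ∈ Finset.range M, (ω ^ k) ^ s * b s)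
      = ∑ s ∈ Finset.range M, ((ω ^ ((s : ℤ) - a)) ^ k - (ω ^ ((s : ℤ) + 1 - a)) ^ k) * b s := by
    intro k
    rw [Finset.mul_sum, Finset.mul_sum]
    refine Finset.sum_congr rfl fun s _ => ?_
    have e : ∀ d : ℤ, (ω ^ d) ^ k = (ω ^ k) ^ d := fun d => by
      rw [← zpow_natCast, ← zpow_natCast, ← zpow_mul, ← zpow_mul, mul_comm]
    have hk0 : ω ^ k ≠ 0 := pow_ne_zero k hω0
    rw [e, e, sub_eq_neg_add (s : ℤ), zpow_add₀ hk0, sub_eq_neg_add _ (a : ℤ), zpow_add₀ hk0,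
      zpow_add_one₀ hk0, zpow_natCast]
    ring
  have hdvd : ∀ s ∈ Finset.range M, ∀ d : ℕ, d < M → ∀ x : ℤ, (M : ℤ) ∣ x - d →
      ((M : ℤ) ∣ x - s ↔ s = d) := by
    intro s hs d hd x hx
    have hs := Finset.mem_range.1 hs
    rw [← Int.natCast_inj (m := s)]
    constructor
    · intro h
      have h1 : (M : ℤ) ∣ s - d := by simpa using dvd_sub hx h
      have := Int.eq_zero_of_abs_lt_dvd h1 (by rw [abs_lt]; omega)
      omega
    · rintro h
      rwa [h]
  simp only [hk]
  rw [Finset.sum_comm, Finset.mul_sum]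
  have hs : ∀ s ∈ Finset.range M, (1 / M : ℂ) * ∑ k ∈ Finset.range M,
      ((ω ^ ((s : ℤ) - a)) ^ k - (ω ^ ((s : ℤ) + 1 - a)) ^ k) * b s
      = (if s = a then b s else 0) - if s = c then b s else 0 := by
    intro s hs
    rw [← Finset.sum_mul, Finset.sum_sub_distrib, sum_pow_root_of_unity hω,
      sum_pow_root_of_unity hω]
    have h1 : (M : ℤ) ∣ (s : ℤ) - a ↔ s = a := by
      rw [dvd_sub_comm]
      exact hdvd s hs a ha a (by simp)
    have h2 : (M : ℤ) ∣ (s : ℤ) + 1 - a ↔ s = c := by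
      have hac' : (M : ℤ) ∣ (a : ℤ) - 1 - c := by
        rwa [show (a : ℤ) - 1 - c = -(c + 1 - a) by ring, dvd_neg]
      rw [← hdvd s hs c hc ((a : ℤ) - 1) hac',
        show (s : ℤ) + 1 - a = -((a : ℤ) - 1 - s) by ring, dvd_neg]
    simp only [h1, h2]
    split_ifs <;> simp [hM0]
  rw [Finset.sum_congr rfl hs, Finset.sum_sub_distrib, Finset.sum_ite_eq', Finset.sum_ite_eq',
    if_pos (Finset.mem_range.2 ha), if_pos (Finset.mem_range.2 hc)]

/-- The arguments for `s = M - 1` and `s = -1` differ by one factor of the base. -/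
theorem pow_mul_lerchArg {p : ℂ} (hp0 : p ≠ 0) {M : ℕ} (hM : 0 < M) :
    p ^ (M ^ 2) * lerchArg M ((M - 1 : ℕ) : ℤ) p = lerchArg M (-1) p := by
  have h := two_mul_binomTwo M
  rw [lerchArg, lerchArg, mul_neg, ← zpow_natCast, ← zpow_add₀ hp0]
  congr 2
  push_cast [hM]
  ring

theorem lerchArg_pred {p : ℂ} {M : ℕ} (hM : 0 < M) :
    lerchArg M ((M - 1 : ℕ) : ℤ) p = -p ^ (-binomTwo M) := by
  have h := two_mul_binomTwo M
  rw [lerchArg]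
  congr 2
  push_cast [hM]
  linear_combination h

/-- The terms for `s = -1` and `s = M - 1` differ by the constant `1`, which is where the summand
`1` of the theta function for `a = 0` comes from. -/
theorem lerch_term_neg_one {p z : ℂ} {M : ℕ} (hM : 0 < M)
    (h : AppellLerchAdmissible (lerchArg M ((M - 1 : ℕ) : ℤ) p) (p ^ (M ^ 2)) z) (hp0 : p ≠ 0) :
    p ^ (-binomTwo 0) * appellLerch (lerchArg M (-1) p) (p ^ (M ^ 2)) z
      = 1 + p ^ (-binomTwo (((M - 1 : ℕ) : ℤ) + 1)) *
        appellLerch (lerchArg M ((M - 1 : ℕ) : ℤ) p) (p ^ (M ^ 2)) z := by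
  have e : ((M - 1 : ℕ) : ℤ) + 1 = M := by omega
  rw [← pow_mul_lerchArg hp0 hM, appellLerch_mul_left h, binomTwo_zero, neg_zero, zpow_zero, one_mul,
    e]
  conv_lhs => rw [lerchArg_pred hM]
  rw [lerchArg_pred hM]
  ring

namespace ThetaDomain

variable {D : ThetaDomain}

/-- The two Appell–Lerch sums that survive orthogonality, still with third argument `i`, at which
none of the sums `m(± p ^ e, p ^ k, i)` is singular. -/
theorem isThetaSum_deviation {ω : ℂ} {M : ℕ} (hω : IsPrimitiveRoot ω M) {a : ℕ} (ha : a < M) :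
    D.IsThetaSum fun p _ _ => (1 / M : ℂ) * ∑ k ∈ (Finset.range M).erase 0,
        (ω ^ k) ^ (-(a : ℤ)) * rankGF (ω ^ k) (-p)
      - (p ^ (-binomTwo ((a : ℤ) + 1)) * appellLerch (lerchArg M a p) (p ^ (M ^ 2)) Complex.I
        - p ^ (-binomTwo (a : ℤ)) *
          appellLerch (lerchArg M ((a : ℤ) - 1) p) (p ^ (M ^ 2)) Complex.I
        + if a = 0 then 1 else 0) := by
  have hM : 0 < M := by omega
  have h1 : D.IsThetaSum _ := isThetaSum_sum ((Finset.range M).erase 0) fun k hk =>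
    (isThetaSum_rankGF (D := D) hM (ζ := ω ^ k)
      (by rw [← pow_mul, mul_comm, pow_mul, hω.pow_eq_one, one_pow])
      (hω.pow_ne_one_of_pos_of_lt (Finset.ne_of_mem_erase hk)
        (Finset.mem_range.1 (Finset.mem_of_mem_erase hk)))).const_mul ((ω ^ k) ^ (-(a : ℤ)))
  refine (h1.const_mul (1 / M : ℂ)).congr fun p z₀ z₁ hD => ?_
  have hp0 := D.ne_zero hD
  have hp := D.norm_lt_one hD
  simp only [mul_sub, Finset.sum_sub_distrib]
  rw [← mul_sub]
  rcases Nat.eq_zero_or_pos a with rfl | ha0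
  · rw [if_pos rfl, mul_sub]
    have h2 := sum_erase_orthogonality hω ha (c := M - 1) (by omega) (by
      rw [Nat.cast_zero, sub_zero]; exact ⟨1, by omega⟩)
      fun s => p ^ (-binomTwo (s + 1)) * appellLerch (lerchArg M s p) (p ^ (M ^ 2)) Complex.I
    have h3 := lerch_term_neg_one (p := p) (z := Complex.I) hM
      ⟨lerchArg_ne_zero hp0 _ _, pow_ne_zero _ hp0, norm_pow_sq_lt_one hp hM, Complex.I_ne_zero,
        (avoids_const I_norm_one I_ne_one _ p z₀ z₁ hD).2,
        (avoids_lerchArg_mul_I M _ _ p z₀ z₁ hD).2⟩ hp0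
    simp only [Nat.cast_zero, zero_sub] at h2 ⊢
    rw [h2, h3]
    ring
  · rw [if_neg ha0.ne', mul_sub]
    have h2 := sum_erase_orthogonality hω ha (c := a - 1) (by omega) (by
      exact ⟨0, by omega⟩)
      fun s => p ^ (-binomTwo (s + 1)) * appellLerch (lerchArg M s p) (p ^ (M ^ 2)) Complex.I
    have e : ((a - 1 : ℕ) : ℤ) = a - 1 := by omega
    rw [e, sub_add_cancel] at h2
    rw [h2]
    ring

end ThetaDomain

/-- The parameters `p = -q`, `z₀`, `z₁` for which both Appell–Lerch sums are defined. -/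
def deviationDomain (a M : ℕ) : ThetaDomain where
  Mem p z₀ z₁ := p ≠ 0 ∧ ‖p‖ < 1 ∧ AppellLerchAdmissible (lerchArg M a p) (p ^ (M ^ 2)) z₀ ∧
    AppellLerchAdmissible (lerchArg M ((a : ℤ) - 1) p) (p ^ (M ^ 2)) z₁
  ne_zero h := h.1
  norm_lt_one h := h.2.1
  z₀_ne_zero h := h.2.2.1.2.2.2.1
  z₁_ne_zero h := h.2.2.2.2.2.2.1

open ThetaDomain in
/-- The third arguments are moved from `i` to `z₀` and `z₁`. -/
theorem isThetaSum_deviationDomain {ω : ℂ} {a M : ℕ} (hω : IsPrimitiveRoot ω M) (ha : a < M) :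
    (deviationDomain a M).IsThetaSum fun p z₀ z₁ => (1 / M : ℂ) *
        ∑ k ∈ (Finset.range M).erase 0, (ω ^ k) ^ (-(a : ℤ)) * rankGF (ω ^ k) (-p)
      - (p ^ (-binomTwo ((a : ℤ) + 1)) * appellLerch (lerchArg M a p) (p ^ (M ^ 2)) z₀
        - p ^ (-binomTwo (a : ℤ)) * appellLerch (lerchArg M ((a : ℤ) - 1) p) (p ^ (M ^ 2)) z₁
        + if a = 0 then 1 else 0) := by
  have hk : 0 < M ^ 2 := pow_pos (by omega) 2
  have h0 := (isThetaSum_appellLerch_sub (D := deviationDomain a M) hk (isMonomial_lerchArg M a)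
    isMonomial_z₀ isMonomial_I (fun p z₀ z₁ h => ⟨h.2.2.1.2.2.2.1, h.2.2.1.2.2.2.2.1⟩)
    (avoids_const I_norm_one I_ne_one _)
    (fun p z₀ z₁ h => ⟨mul_ne_zero h.2.2.1.1 h.2.2.1.2.2.2.1, h.2.2.1.2.2.2.2.2⟩)
    (avoids_lerchArg_mul_I M a _)).mul
      (isMonomial_zpow (-binomTwo ((a : ℤ) + 1))).isThetaQuotient
  have h1 := (isThetaSum_appellLerch_sub (D := deviationDomain a M) hk
    (isMonomial_lerchArg M ((a : ℤ) - 1)) isMonomial_I isMonomial_z₁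
    (avoids_const I_norm_one I_ne_one _)
    (fun p z₀ z₁ h => ⟨h.2.2.2.2.2.2.1, h.2.2.2.2.2.2.2.1⟩) (avoids_lerchArg_mul_I M _ _)
    (fun p z₀ z₁ h => ⟨mul_ne_zero h.2.2.2.1 h.2.2.2.2.2.2.1, h.2.2.2.2.2.2.2.2⟩)).mul
      (isMonomial_zpow (-binomTwo (a : ℤ))).isThetaQuotient
  refine (((isThetaSum_deviation hω ha).add h0).add h1).congr fun p z₀ z₁ _ => ?_
  ring

theorem theorem6p1 (a M : ℕ) (haM : a < M) :
    ∃ T : List ThetaQuotient,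
      (a ≠ 0 → ∀ t ∈ T, t.weight = 1 / 2) ∧
      (a = 0 → ∃ T' : List ThetaQuotient,
        T = ThetaQuotient.one :: T' ∧ ∀ t ∈ T', t.weight = 1 / 2) ∧
      ∀ q z₀ z₁ : ℂ, 0 < ‖q‖ → ‖q‖ < 1 →
        AppellLerchAdmissible
          (-(-q) ^ (binomTwo M - (M : ℤ) * a)) ((-q) ^ (M ^ 2)) z₀ →
        AppellLerchAdmissible
          (-(-q) ^ (binomTwo M - (M : ℤ) * ((a : ℤ) - 1))) ((-q) ^ (M ^ 2)) z₁ →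
        (∀ t ∈ T, t.Regular q z₀ z₁) ∧
        HasSum (fun n : ℕ => deviationCoeff a M n * q ^ n)
          ((-q) ^ (-binomTwo ((a : ℤ) + 1)) *
              appellLerch (-(-q) ^ (binomTwo M - (M : ℤ) * a)) ((-q) ^ (M ^ 2)) z₀
            - (-q) ^ (-binomTwo (a : ℤ)) *
              appellLerch (-(-q) ^ (binomTwo M - (M : ℤ) * ((a : ℤ) - 1))) ((-q) ^ (M ^ 2)) z₁
            + thetaSumEval T q z₀ z₁) := by
  have hM : 0 < M := by omega
  obtain ⟨ω, hω⟩ : ∃ ω : ℂ, IsPrimitiveRoot ω M := ⟨_, Complex.isPrimitiveRoot_exp _ hM.ne'⟩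
  obtain ⟨T, hT, h⟩ := isThetaSum_deviationDomain hω haM
  have key : ∀ q z₀ z₁ : ℂ, 0 < ‖q‖ → ‖q‖ < 1 →
      AppellLerchAdmissible (lerchArg M a (-q)) ((-q) ^ (M ^ 2)) z₀ →
      AppellLerchAdmissible (lerchArg M ((a : ℤ) - 1) (-q)) ((-q) ^ (M ^ 2)) z₁ →
      (∀ t ∈ T, t.Regular q z₀ z₁) ∧ HasSum (fun n : ℕ => deviationCoeff a M n * q ^ n)
        ((-q) ^ (-binomTwo ((a : ℤ) + 1)) * appellLerch (lerchArg M a (-q)) ((-q) ^ (M ^ 2)) z₀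
          - (-q) ^ (-binomTwo (a : ℤ)) *
            appellLerch (lerchArg M ((a : ℤ) - 1) (-q)) ((-q) ^ (M ^ 2)) z₁
          + ((if a = 0 then 1 else 0) + thetaSumEval T q z₀ z₁)) := by
    intro q z₀ z₁ hq0 hq h₀ h₁
    obtain ⟨hreg, hval⟩ := h (-q) z₀ z₁
      ⟨neg_ne_zero.2 (norm_pos_iff.1 hq0), by rwa [norm_neg], h₀, h₁⟩
    rw [neg_neg] at hreg hval
    refine ⟨hreg, ?_⟩
    convert hasSum_deviation hM hω hq a using 1
    rw [hval]
    beta_reduce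
    rw [neg_neg]
    abel
  rcases Nat.eq_zero_or_pos a with ha | ha
  · refine ⟨ThetaQuotient.one :: T, fun h0 => absurd ha h0, fun _ => ⟨T, rfl, hT⟩,
      fun q z₀ z₁ hq0 hq h₀ h₁ => ?_⟩
    obtain ⟨hreg, hsum⟩ := key q z₀ z₁ hq0 hq h₀ h₁
    refine ⟨fun t ht => ?_, ?_⟩
    · rcases List.mem_cons.1 ht with rfl | ht
      · exact fun f hf => absurd hf List.not_mem_nil
      · exact hreg t ht
    · rw [if_pos ha] at hsum
      have e : thetaSumEval (ThetaQuotient.one :: T) q z₀ z₁ = 1 + thetaSumEval T q z₀ z₁ := by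
        simp [thetaSumEval, ThetaQuotient.one, ThetaQuotient.eval]
      rw [e]
      exact hsum
  · refine ⟨T, fun _ => hT, fun h0 => absurd h0 ha.ne', fun q z₀ z₁ hq0 hq h₀ h₁ => ?_⟩
    have hsum := key q z₀ z₁ hq0 hq h₀ h₁
    rw [if_neg ha.ne', zero_add] at hsum
    exact hsum
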